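/- **Two-Sided Boundary Labeling with Adjacent Sides.** An instance consists of an axis-parallel rectangle $R=[0,W]\times[0,H]$ with $W,H>0$, a set of $n$ points in $R$ (the sites), and $m\le n$ labels attached to $R$ from the outside, each of them on the top or on the right side of $R$, with pairwise distinct fixed ports: the port of a top (right) label is a prescribed point of the top (right) side of $R$. It is assumed that no two sites lie on a common horizontal or vertical line, and that no site lies on a horizontal or vertical line through a port. The ($po$-)leader from a site $p$ to the port $t$ of a label consists of a first segment that starts at $p$ and is parallel to the side of $R$ carrying the label, and a second segment that is orthogonal to that side and ends at $t$ (either segment may be degenerate). A planar solution assigns to each of the $m$ labels a site, different labels getting different sites, such that the $m$ resulting leaders are pairwise disjoint. To solve the problem means to decide whether a planar solution exists and, if so, to output one. **Theorem.** Two-Sided Boundary Labeling with Adjacent Sides can be solved in $O(n^3)$ time using $O(n^2)$ space. More precisely, there are a single program for a random access machine with unit-cost operations on words of $O(\log n)$ bits, which accesses the coordinates of the input only by comparing two of them, and a constant $C$ such that on every instance with $n$ sites the program solves the problem after at most $C(n+1)^3$ operations, using a memory of $C$ banks of $C(n+1)^2$ words each, where each word holds a number below $(n+2)^C$. -/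

import Mathlib

/-! # A comparison-based word RAM

A program is a fixed (finite) piece of code over finitely many memory banks, each bank being an
array of words (natural numbers).  Real numbers occur only in read-only input arrays; the only
operation on them is the comparison of two entries.  Running time is the number of elementary
operations executed.  Memory capacity and word length are enforced: an operation that would touch a
bank or a cell beyond the capacity, or produce a number that does not fit into a word, has no
execution rule, so that the machine gets stuck. -/

namespace WordRAM

/-- Memory contents: `σ a i` is the word in cell `i` of bank `a`. -/
abbrev Store := ℕ → ℕ → ℕ

/-- The read-only real input: `x a i` is entry `i` of array `a`. -/
abbrev RealInput := ℕ → ℕ → ℝ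

/-- Resources of the machine: the number of banks, the number of cells of each bank (so that the
memory has `banks * size` cells), and the number `word` of values that a word can take. -/
structure Limits where
  banks : ℕ
  size : ℕ
  word : ℕ

/-- Word-valued expressions.  Subtraction is truncated. -/
inductive Expr where
  | const (k : ℕ)
  | load (a : ℕ) (i : Expr)
  | add (e₁ e₂ : Expr)
  | sub (e₁ e₂ : Expr)
  | mul (e₁ e₂ : Expr)

namespace Expr

def eval (σ : Store) : Expr → ℕ
  | const k => k
  | load a i => σ a (i.eval σ)
  | add e₁ e₂ => e₁.eval σ + e₂.eval σ
  | sub e₁ e₂ => e₁.eval σ - e₂.eval σ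
  | mul e₁ e₂ => e₁.eval σ * e₂.eval σ

/-- The evaluation stays within the limits: all intermediate values fit into a word and all
cells that are read exist. -/
def Fits (L : Limits) (σ : Store) : Expr → Prop
  | const k => k < L.word
  | load a i => i.Fits L σ ∧ a < L.banks ∧ i.eval σ < L.size ∧ σ a (i.eval σ) < L.word
  | add e₁ e₂ => e₁.Fits L σ ∧ e₂.Fits L σ ∧ e₁.eval σ + e₂.eval σ < L.word
  | sub e₁ e₂ => e₁.Fits L σ ∧ e₂.Fits L σ
  | mul e₁ e₂ => e₁.Fits L σ ∧ e₂.Fits L σ ∧ e₁.eval σ * e₂.eval σ < L.word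

/-- The number of operations needed to evaluate an expression. -/
def cost : Expr → ℕ
  | const _ => 1
  | load _ i => i.cost + 1
  | add e₁ e₂ => e₁.cost + e₂.cost + 1
  | sub e₁ e₂ => e₁.cost + e₂.cost + 1
  | mul e₁ e₂ => e₁.cost + e₂.cost + 1

end Expr

/-- Tests. `realLt a i b j` compares entry `i` of the real input array `a` with entry `j` of the
real input array `b`. -/
inductive Test where
  | lt (e₁ e₂ : Expr)
  | realLt (a : ℕ) (i : Expr) (b : ℕ) (j : Expr)
  | not (c : Test)
  | and (c₁ c₂ : Test)

namespace Test

def Holds (x : RealInput) (σ : Store) : Test → Prop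
  | lt e₁ e₂ => e₁.eval σ < e₂.eval σ
  | realLt a i b j => x a (i.eval σ) < x b (j.eval σ)
  | not c => ¬ c.Holds x σ
  | and c₁ c₂ => c₁.Holds x σ ∧ c₂.Holds x σ

def Fits (L : Limits) (σ : Store) : Test → Prop
  | lt e₁ e₂ => e₁.Fits L σ ∧ e₂.Fits L σ
  | realLt _ i _ j => i.Fits L σ ∧ j.Fits L σ
  | not c => c.Fits L σ
  | and c₁ c₂ => c₁.Fits L σ ∧ c₂.Fits L σ

def cost : Test → ℕ
  | lt e₁ e₂ => e₁.cost + e₂.cost + 1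
  | realLt _ i _ j => i.cost + j.cost + 1
  | not c => c.cost + 1
  | and c₁ c₂ => c₁.cost + c₂.cost + 1

end Test

/-- Programs. `store a i e` writes the value of `e` into the cell of bank `a` whose index is the
value of `i`. -/
inductive Prog where
  | skip
  | store (a : ℕ) (i e : Expr)
  | seq (p q : Prog)
  | ite (c : Test) (p q : Prog)
  | while (c : Test) (p : Prog)

/-- The store after writing `v` into cell `i` of bank `a`. -/
def write (σ : Store) (a i v : ℕ) : Store :=
  fun b j => if b = a ∧ j = i then v else σ b j

/-- `Exec L x p σ σ' t`: on a machine with resources `L` and real input `x`, the program `p`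
started with memory contents `σ` halts after `t` operations with memory contents `σ'`, without
ever exceeding the resources. -/
inductive Exec (L : Limits) (x : RealInput) : Prog → Store → Store → ℕ → Prop where
  | skip (σ : Store) : Exec L x .skip σ σ 1
  | store (σ : Store) (a : ℕ) (i e : Expr) (hi : i.Fits L σ) (he : e.Fits L σ)
      (ha : a < L.banks) (hs : i.eval σ < L.size) :
      Exec L x (.store a i e) σ (write σ a (i.eval σ) (e.eval σ)) (i.cost + e.cost + 1)
  | seq {p q : Prog} {σ σ' σ'' : Store} {t t' : ℕ}
      (hp : Exec L x p σ σ' t) (hq : Exec L x q σ' σ'' t') :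
      Exec L x (.seq p q) σ σ'' (t + t')
  | ite_true {c : Test} {p q : Prog} {σ σ' : Store} {t : ℕ} (hf : c.Fits L σ)
      (hc : c.Holds x σ) (hp : Exec L x p σ σ' t) :
      Exec L x (.ite c p q) σ σ' (c.cost + t)
  | ite_false {c : Test} {p q : Prog} {σ σ' : Store} {t : ℕ} (hf : c.Fits L σ)
      (hc : ¬ c.Holds x σ) (hq : Exec L x q σ σ' t) :
      Exec L x (.ite c p q) σ σ' (c.cost + t)
  | while_true {c : Test} {p : Prog} {σ σ' σ'' : Store} {t t' : ℕ} (hf : c.Fits L σ)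
      (hc : c.Holds x σ) (hp : Exec L x p σ σ' t)
      (hw : Exec L x (.while c p) σ' σ'' t') :
      Exec L x (.while c p) σ σ'' (c.cost + t + t')
  | while_false {c : Test} {p : Prog} {σ : Store} (hf : c.Fits L σ)
      (hc : ¬ c.Holds x σ) :
      Exec L x (.while c p) σ σ c.cost

end WordRAM

/-! # Two-sided boundary labeling with adjacent sides -/

namespace BoundaryLabeling

/-- The two sides of the enclosing rectangle that carry labels. -/
inductive Side where
  | top
  | right
  deriving DecidableEq

/-- An instance with `n` sites and `m ≤ n` labels on the top and right sides of
`R = [0, W] × [0, H]`, with fixed ports.  A label is represented by its port, the prescribed point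
of the boundary of `R` in which the leader has to end. -/
structure Instance (n m : ℕ) where
  W : ℝ
  H : ℝ
  W_pos : 0 < W
  H_pos : 0 < H
  le : m ≤ n
  site : Fin n → ℝ × ℝ
  site_mem : ∀ i, site i ∈ Set.Icc (0 : ℝ) W ×ˢ Set.Icc (0 : ℝ) H
  side : Fin m → Side
  port : Fin m → ℝ × ℝ
  port_top : ∀ j, side j = .top → (port j).1 ∈ Set.Icc (0 : ℝ) W ∧ (port j).2 = H
  port_right : ∀ j, side j = .right → (port j).1 = W ∧ (port j).2 ∈ Set.Icc (0 : ℝ) H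
  port_injective : Function.Injective port
  /-- No two sites lie on a common vertical or horizontal line. -/
  site_x_injective : Function.Injective fun i => (site i).1
  site_y_injective : Function.Injective fun i => (site i).2
  /-- No site lies on the vertical or horizontal line through a port. -/
  site_x_ne_port : ∀ i j, (site i).1 ≠ (port j).1
  site_y_ne_port : ∀ i j, (site i).2 ≠ (port j).2

/-- The bend of the `po`-leader from the site `p` to the port `t` on side `s`. -/
def bend (s : Side) (p t : ℝ × ℝ) : ℝ × ℝ :=
  match s with
  | .top => (t.1, p.2)
  | .right => (p.1, t.2)

/-- The `po`-leader from the site `p` to the port `t` on side `s`: the first segment, starting at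
`p`, is parallel to the side `s`, and the second one is orthogonal to it. -/
def leader (s : Side) (p t : ℝ × ℝ) : Set (ℝ × ℝ) :=
  segment ℝ p (bend s p t) ∪ segment ℝ (bend s p t) t

namespace Instance

variable {n m : ℕ} (I : Instance n m)

/-- Assigning to each label `j` the site `f j` is a planar solution: distinct labels get distinct
sites, and the leaders are pairwise disjoint. -/
def IsPlanarSolution (f : Fin m → Fin n) : Prop :=
  Function.Injective f ∧
    ∀ j k, j ≠ k → Disjoint (leader (I.side j) (I.site (f j)) (I.port j))
      (leader (I.side k) (I.site (f k)) (I.port k))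

/-- The instance has a planar solution. -/
def Solvable : Prop := ∃ f : Fin m → Fin n, I.IsPlanarSolution f

/-- The real input of the machine: arrays 0 and 1 hold the coordinates of the sites, arrays
2 and 3 those of the ports, and array 4 holds the width and the height of `R`. -/
noncomputable def realInput : WordRAM.RealInput
  | 0, i => if h : i < n then (I.site ⟨i, h⟩).1 else 0
  | 1, i => if h : i < n then (I.site ⟨i, h⟩).2 else 0
  | 2, j => if h : j < m then (I.port ⟨j, h⟩).1 else 0
  | 3, j => if h : j < m then (I.port ⟨j, h⟩).2 else 0
  | 4, 0 => I.W
  | 4, 1 => I.H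
  | _, _ => 0

/-- The initial memory: cells 0 and 1 of bank 0 hold `n` and `m`, cell `j` of bank 1 holds the
side of the label `j` (0 for top, 1 for right), and all other cells hold 0. -/
def initStore : WordRAM.Store
  | 0, 0 => n
  | 0, 1 => m
  | 1, j => if h : j < m then (if I.side ⟨j, h⟩ = .top then 0 else 1) else 0
  | _, _ => 0

/-- The final memory is a correct answer: cell 0 of bank 0 tells whether the instance is solvable
(1 for yes, 0 for no), and if it is, then the first `m` cells of bank 1 hold a planar solution,
cell `j` being the number of the site that is connected to the label `j`. -/
def IsCorrectOutput (σ : WordRAM.Store) : Prop :=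
  (σ 0 0 = 1 ∧ ∃ f : Fin m → Fin n, I.IsPlanarSolution f ∧ ∀ j : Fin m, σ 1 j = f j) ∨
    (σ 0 0 = 0 ∧ ¬ I.Solvable)

end Instance

end BoundaryLabeling

/-!
Whether two leaders cross depends only on the order of the coordinates of their sites and ports
(`Instance.isPlanarSolution_iff`), so an instance is replaced by its configuration `Cfg`.

*Separation.*  If a right leader passes to the left of and below a top leader (or the mirror image
of this situation occurs), then the two labels can exchange their sites, after a new matching within
the pocket between them, and this increases the potential `Cfg.pot` (`Cfg.exists_pot_lt`).  A planar
solution of largest potential therefore has all top leaders above and all right leaders below a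
monotone curve (`Cfg.exists_separated`).

*Curves.*  Given a monotone curve, the top labels are served from the sites above it and the right
labels from those below it.  Whether this is possible without touching the curve is a matter of
counting: the conditions in `Cfg.Curve` compare, for each column, the number of ports beyond a line
with the number of sites from which they have to be served.  They are necessary
(`Cfg.Planar.exists_curve`), and if they hold, then a greedy assignment yields a planar solution: it
processes the sites of one side starting with those closest to that side, and gives each one the
nearest free port further to the right (or further up), or else the nearest free port
(`GreedyInv`, `Best`, `Cfg.Curve.exists_planar`).

*Dynamic program.*  The conditions at a column involve only the height of the curve there and the
number `u` of sites above the curve in the columns from there on.  Going through the columns from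
right to left, it suffices to keep for each `u` the largest possible height, since heights decrease
to the left (`DP.row`, `Cfg.curve_height`, `Cfg.Curve.exists_row_pos`).  There are `O(n ^ 2)` entries,
each of which is updated from `O(n)` heights; the numbers that enter the conditions at a column and a
height are computed in time `O(n)` and used for all `u`.

*Machine.*  `WordRAM.WP` is total correctness including time and word length: the time bound is read
off from the loop structure (`Prog.tb`), and since every operation increases the largest word by at
most its cost (`Expr.tame`), no word overflows.  The program `Algo.mainP` has loops nested to depth
three.

Banks of the program: `0` and `1` input and output; `2`, `3`, `4` the numbers `n`, `m`, `n + 1`; `10`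
and `12` the `x`-ranks and `y`-ranks of the sites, `11` and `13` the inverse permutations; `14` the
`y`-ranks by `x`-rank; `15`, `16`, `17` the numbers `Cfg.tc`, `Cfg.rc`, `Cfg.nT`; `18` the table; `19`
flags for the sites above the curve; `20` the assignment, where `0` stands for a free label; all other
banks hold scalar variables.
-/

/-! ### A program logic for the word RAM -/

namespace WordRAM

/-- All index computations of the expression address cells below `S`. -/
def Expr.Inb (S : ℕ) (σ : Store) : Expr → Prop
  | .const _ => True
  | .load _ i => i.Inb S σ ∧ i.eval σ < S
  | .add a b => a.Inb S σ ∧ b.Inb S σ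
  | .sub a b => a.Inb S σ ∧ b.Inb S σ
  | .mul a b => a.Inb S σ ∧ b.Inb S σ

/-- All index computations of the test address cells below `S`; reads of the real input are not
restricted. -/
def Test.Inb (S : ℕ) (σ : Store) : Test → Prop
  | .lt a b => a.Inb S σ ∧ b.Inb S σ
  | .realLt _ i _ j => i.Inb S σ ∧ j.Inb S σ
  | .not c => c.Inb S σ
  | .and c d => c.Inb S σ ∧ d.Inb S σ

/-- Syntactic check: only the first `64` banks are read and all constants are at most `1`. -/
def Expr.chk : Expr → Bool
  | .const k => decide (k ≤ 1)
  | .load a i => decide (a < 64) && i.chk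
  | .add a b => a.chk && b.chk
  | .sub a b => a.chk && b.chk
  | .mul a b => a.chk && b.chk

/-- Syntactic check: the value of the expression exceeds the largest word in memory by at most
the cost of the expression, because nothing but constants is ever added. -/
def Expr.tame : Expr → Bool
  | .const k => decide (k ≤ 1)
  | .load _ _ => true
  | .add a (.const k) => a.tame && decide (k ≤ 1)
  | .sub a _ => a.tame
  | _ => false

def Test.chk : Test → Bool
  | .lt a b => a.chk && b.chk && decide (a.cost ≤ 40) && decide (b.cost ≤ 40)
  | .realLt _ i _ j => i.chk && j.chk && decide (i.cost ≤ 40) && decide (j.cost ≤ 40)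
  | .not c => c.chk
  | .and c d => c.chk && d.chk

/-- Syntactic check of a whole program: few banks, small constants, short expressions, and stored
values that grow slowly. -/
def Prog.chk : Prog → Bool
  | .skip => true
  | .store a i e => decide (a < 64) && i.chk && e.chk && e.tame && decide (i.cost ≤ 40) &&
      decide (e.cost ≤ 40)
  | .seq p q => p.chk && q.chk
  | .ite c p q => c.chk && p.chk && q.chk
  | .while c p => c.chk && p.chk

/-- The banks that a program may write to. -/
def Prog.mods : Prog → List ℕ
  | .skip => []
  | .store a _ _ => [a]
  | .seq p q => p.mods ++ q.mods
  | .ite _ p q => p.mods ++ q.mods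
  | .while _ p => p.mods

/-- Time bound for a program each of whose loops makes at most `B` iterations. -/
def Prog.tb (B : ℕ) : Prog → ℕ
  | .skip => 1
  | .store _ i e => i.cost + e.cost + 1
  | .seq p q => p.tb B + q.tb B
  | .ite c p q => c.cost + p.tb B + q.tb B
  | .while c p => B * (c.cost + p.tb B) + c.cost

/-- The loop nesting depth. -/
def Prog.depth : Prog → ℕ
  | .skip => 0
  | .store _ _ _ => 0
  | .seq p q => max p.depth q.depth
  | .ite _ p q => max p.depth q.depth
  | .while _ p => p.depth + 1

/-- The number of operations of a program each of whose loops makes one iteration. -/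
def Prog.coef : Prog → ℕ
  | .skip => 1
  | .store _ i e => i.cost + e.cost + 1
  | .seq p q => p.coef + q.coef
  | .ite c p q => c.cost + p.coef + q.coef
  | .while c p => (c.cost + p.coef) + c.cost

theorem Prog.tb_le {B : ℕ} (hB : 1 ≤ B) (p : Prog) : p.tb B ≤ p.coef * B ^ p.depth := by
  have mono : ∀ {a c d : ℕ}, d ≤ c → a * B ^ d ≤ a * B ^ c := fun h =>
    Nat.mul_le_mul_left _ (Nat.pow_le_pow_right hB h)
  have one : ∀ a d : ℕ, a ≤ a * B ^ d := fun a d => Nat.le_mul_of_pos_right _ (Nat.pow_pos hB)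
  induction p with
  | skip => simp [tb, coef, depth]
  | store a i e => simp [tb, coef, depth]
  | seq p q hp hq =>
    simp only [tb, coef, depth]
    have h1 := mono (a := p.coef) (le_max_left p.depth q.depth)
    have h2 := mono (a := q.coef) (le_max_right p.depth q.depth)
    rw [add_mul]; omega
  | ite c p q hp hq =>
    simp only [tb, coef, depth]
    have h1 := mono (a := p.coef) (le_max_left p.depth q.depth)
    have h2 := mono (a := q.coef) (le_max_right p.depth q.depth)
    have h3 := one c.cost (max p.depth q.depth)
    rw [add_mul, add_mul]; omega
  | _ =>
    rename_i c p hp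
    simp only [tb, coef, depth]
    have h3 := one c.cost (p.depth + 1)
    have h4 := one c.cost p.depth
    have h5 : B * (c.cost + p.tb B) ≤ B * ((c.cost + p.coef) * B ^ p.depth) :=
      Nat.mul_le_mul_left _ (by rw [add_mul]; omega)
    have h6 : B * ((c.cost + p.coef) * B ^ p.depth) = (c.cost + p.coef) * B ^ (p.depth + 1) := by
      rw [pow_succ]; ring
    rw [add_mul _ c.cost]; omega

/-- A program changes only the banks that occur in it as targets of assignments. -/
theorem Exec.frame {L : Limits} {x : RealInput} {p : Prog} {σ σ' : Store} {t : ℕ}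
    (h : Exec L x p σ σ' t) : ∀ a, a ∉ p.mods → σ' a = σ a := by
  induction h with
  | skip σ => intros; rfl
  | store σ a i e hi he ha hs =>
    intro b hb
    simp only [Prog.mods, List.mem_singleton] at hb
    funext j
    simp [write, hb]
  | seq _ _ h1 h2 =>
    intro b hb
    simp only [Prog.mods, List.mem_append, not_or] at hb
    rw [h2 b hb.2, h1 b hb.1]
  | ite_true _ _ _ h1 =>
    intro b hb
    simp only [Prog.mods, List.mem_append, not_or] at hb
    exact h1 b hb.1
  | ite_false _ _ _ h1 =>
    intro b hb
    simp only [Prog.mods, List.mem_append, not_or] at hb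
    exact h1 b hb.2
  | while_true _ _ _ _ h1 h2 =>
    intro b hb
    rw [h2 b hb, h1 b hb]
  | while_false => intros; rfl

/-- The setting of an execution: limits `L`, real input `x`, the maximal number `B` of iterations
of a loop, and a bound `K` on the stored values. -/
structure Env where
  L : Limits
  x : RealInput
  B : ℕ
  K : ℕ
  banks : 64 ≤ L.banks
  word : (K + 2) ^ 40 ≤ L.word

/-- The value of an expression is polynomial in the largest word, with the cost as exponent. -/
theorem Expr.eval_lt {σ : Store} {K : ℕ} (hσ : ∀ a i, σ a i ≤ K) (e : Expr)
    (h : e.chk = true) : e.eval σ + 1 ≤ (K + 2) ^ e.cost := by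
  have two : ∀ e : Expr, 2 ≤ (K + 2) ^ e.cost := by
    intro e
    have h1 : 1 ≤ e.cost := by cases e <;> simp [cost]
    calc 2 ≤ (K + 2) ^ 1 := by simp
      _ ≤ _ := Nat.pow_le_pow_right (by omega) h1
  have key : ∀ a b c : ℕ, 2 ≤ a → 2 ≤ b → c ≤ a * b → c ≤ a * b * (K + 2) := by
    intro a b c ha hb hc
    nlinarith [Nat.zero_le (a * b * K)]
  induction e with
  | const k =>
    simp only [chk, decide_eq_true_eq] at h
    simp only [eval, cost, pow_one]; omega
  | load a i hi =>
    simp only [eval]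
    calc σ a (i.eval σ) + 1 ≤ (K + 2) ^ 1 := by have := hσ a (i.eval σ); simp; omega
      _ ≤ _ := Nat.pow_le_pow_right (by omega) (by simp [cost])
  | add a b ha hb =>
    simp only [chk, Bool.and_eq_true] at h
    simp only [eval, cost, pow_add, pow_one]
    have := ha h.1; have := hb h.2
    apply key _ _ _ (two a) (two b)
    nlinarith [two a, two b]
  | sub a b ha hb =>
    simp only [chk, Bool.and_eq_true] at h
    simp only [eval, cost, pow_add, pow_one]
    have := ha h.1; have := hb h.2
    apply key _ _ _ (two a) (two b)
    nlinarith [two a, two b, Nat.sub_le (a.eval σ) (b.eval σ)]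
  | mul a b ha hb =>
    simp only [chk, Bool.and_eq_true] at h
    simp only [eval, cost, pow_add, pow_one]
    have h1 := ha h.1; have h2 := hb h.2
    apply key _ _ _ (two a) (two b)
    obtain ⟨u, hu⟩ := Nat.exists_eq_add_of_le h1
    obtain ⟨v, hv⟩ := Nat.exists_eq_add_of_le h2
    rw [hu, hv]
    have : a.eval σ * b.eval σ + 1 ≤ (a.eval σ + 1) * (b.eval σ + 1) := by
      rw [add_mul, mul_add]; omega
    exact this.trans (Nat.mul_le_mul (by omega) (by omega))

theorem Expr.eval_tame {σ : Store} {K : ℕ} (hσ : ∀ a i, σ a i ≤ K) (e : Expr)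
    (h : e.tame = true) : e.eval σ ≤ K + e.cost := by
  induction e with
  | const k => simp only [tame, decide_eq_true_eq] at h; simp only [eval, cost]; omega
  | load a i hi => have := hσ a (i.eval σ); simp only [eval, cost]; omega
  | add a b ha hb =>
    cases b with
    | const k =>
      simp only [tame, Bool.and_eq_true, decide_eq_true_eq] at h
      have := ha h.1
      simp only [eval, cost]; omega
    | _ => simp [tame] at h
  | sub a b ha hb =>
    simp only [tame] at h
    have := ha h
    simp only [eval, cost]; omega
  | mul a b ha hb => simp [tame] at h

theorem Expr.fits (E : Env) {σ : Store} (hσ : ∀ a i, σ a i ≤ E.K) (e : Expr)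
    (h : e.chk = true) (hc : e.cost ≤ 40) (hi : e.Inb E.L.size σ) : e.Fits E.L σ := by
  have lt : ∀ e : Expr, e.chk = true → e.cost ≤ 40 → e.eval σ < E.L.word := by
    intro e h hc
    have h1 := e.eval_lt hσ h
    have h2 : (E.K + 2) ^ e.cost ≤ (E.K + 2) ^ 40 := Nat.pow_le_pow_right (by omega) hc
    have := E.word
    omega
  have h0 := lt e h hc
  induction e with
  | const k => exact h0
  | load a i ih =>
    simp only [chk, Bool.and_eq_true, decide_eq_true_eq] at h
    simp only [cost] at hc
    have := E.banks
    exact ⟨ih h.2 (by omega) hi.1 (lt i h.2 (by omega)), by omega, hi.2, h0⟩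
  | add a b ha hb =>
    simp only [chk, Bool.and_eq_true] at h
    simp only [cost] at hc
    exact ⟨ha h.1 (by omega) hi.1 (lt a h.1 (by omega)),
      hb h.2 (by omega) hi.2 (lt b h.2 (by omega)), h0⟩
  | sub a b ha hb =>
    simp only [chk, Bool.and_eq_true] at h
    simp only [cost] at hc
    exact ⟨ha h.1 (by omega) hi.1 (lt a h.1 (by omega)),
      hb h.2 (by omega) hi.2 (lt b h.2 (by omega))⟩
  | mul a b ha hb =>
    simp only [chk, Bool.and_eq_true] at h
    simp only [cost] at hc
    exact ⟨ha h.1 (by omega) hi.1 (lt a h.1 (by omega)),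
      hb h.2 (by omega) hi.2 (lt b h.2 (by omega)), h0⟩

theorem Test.fits (E : Env) {σ : Store} (hσ : ∀ a i, σ a i ≤ E.K) (c : Test)
    (h : c.chk = true) (hi : c.Inb E.L.size σ) : c.Fits E.L σ := by
  induction c with
  | lt a b =>
    simp only [chk, Bool.and_eq_true, decide_eq_true_eq] at h
    exact ⟨a.fits E hσ h.1.1.1 h.1.2 hi.1, b.fits E hσ h.1.1.2 h.2 hi.2⟩
  | realLt u a v b =>
    simp only [chk, Bool.and_eq_true, decide_eq_true_eq] at h
    exact ⟨a.fits E hσ h.1.1.1 h.1.2 hi.1, b.fits E hσ h.1.1.2 h.2 hi.2⟩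
  | not c ih => exact ih h hi
  | and c d hc hd =>
    simp only [chk, Bool.and_eq_true] at h
    exact ⟨hc h.1 hi.1, hd h.2 hi.2⟩

/-- Total correctness: started in `σ`, the program halts within the limits and within the time
`p.tb E.B`, in a store that satisfies `Q`.  Words grow by at most one per operation, so that a
bound `β` on the words of `σ` with `β + p.tb E.B ≤ E.K` keeps all computations within the word
length; the syntactic check is an assumption, as it is done once for the complete program. -/
def WP (E : Env) (p : Prog) (Q : Store → Prop) (σ : Store) : Prop :=
  p.chk = true → ∀ β, (∀ a i, σ a i ≤ β) → β + p.tb E.B ≤ E.K →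
    ∃ σ' t, Exec E.L E.x p σ σ' t ∧ t ≤ p.tb E.B ∧ (∀ a i, σ' a i ≤ β + p.tb E.B) ∧ Q σ'

variable {E : Env} {σ : Store} {p q : Prog} {Q R : Store → Prop}

theorem WP.mono (h : WP E p Q σ) (hQ : ∀ σ', (∀ a, a ∉ p.mods → σ' a = σ a) → Q σ' → R σ') :
    WP E p R σ := by
  intro hc β hβ hK
  obtain ⟨σ', t, h1, h2, h3, h4⟩ := h hc β hβ hK
  exact ⟨σ', t, h1, h2, h3, hQ σ' h1.frame h4⟩

theorem WP.skip (h : Q σ) : WP E .skip Q σ :=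
  fun _ β hβ _ => ⟨σ, 1, .skip σ, le_rfl, fun a i => (hβ a i).trans (by omega), h⟩

theorem WP.store {a : ℕ} {i e : Expr} (hi : i.Inb E.L.size σ) (he : e.Inb E.L.size σ)
    (hs : i.eval σ < E.L.size) (h : Q (write σ a (i.eval σ) (e.eval σ))) :
    WP E (.store a i e) Q σ := by
  intro hc β hβ hK
  simp only [Prog.chk, Bool.and_eq_true, decide_eq_true_eq] at hc
  have hσ : ∀ a i, σ a i ≤ E.K := fun a i => (hβ a i).trans (by omega)
  have := E.banks
  refine ⟨_, _, .store σ a i e (i.fits E hσ hc.1.1.1.1.2 hc.1.2 hi)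
    (e.fits E hσ hc.1.1.1.2 hc.2 he) (by omega) hs, le_rfl, ?_, h⟩
  intro b j
  have := e.eval_tame hβ hc.1.1.2
  have := hβ b j
  simp only [write, Prog.tb]
  split_ifs <;> omega

theorem WP.seq (h : WP E p (fun σ' => WP E q Q σ') σ) : WP E (.seq p q) Q σ := by
  intro hc β hβ hK
  simp only [Prog.chk, Bool.and_eq_true] at hc
  simp only [Prog.tb] at hK
  obtain ⟨σ', t, h1, h2, h3, h4⟩ := h hc.1 β hβ (by omega)
  obtain ⟨σ'', t', h5, h6, h7, h8⟩ := h4 hc.2 (β + p.tb E.B) h3 (by omega)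
  exact ⟨σ'', t + t', .seq h1 h5, by simp only [Prog.tb]; omega,
    fun a i => (h7 a i).trans (by simp only [Prog.tb]; omega), h8⟩

theorem WP.ite {c : Test} (hc : c.Inb E.L.size σ) (h1 : c.Holds E.x σ → WP E p Q σ)
    (h2 : ¬ c.Holds E.x σ → WP E q Q σ) : WP E (.ite c p q) Q σ := by
  intro hk β hβ hK
  simp only [Prog.chk, Bool.and_eq_true] at hk
  simp only [Prog.tb] at hK
  have hσ : ∀ a i, σ a i ≤ E.K := fun a i => (hβ a i).trans (by omega)
  by_cases h : c.Holds E.x σ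
  · obtain ⟨σ', t, h3, h4, h5, h6⟩ := h1 h hk.1.2 β hβ (by omega)
    exact ⟨σ', _, .ite_true (c.fits E hσ hk.1.1 hc) h h3, by simp only [Prog.tb]; omega,
      fun a i => (h5 a i).trans (by simp only [Prog.tb]; omega), h6⟩
  · obtain ⟨σ', t, h3, h4, h5, h6⟩ := h2 h hk.2 β hβ (by omega)
    exact ⟨σ', _, .ite_false (c.fits E hσ hk.1.1 hc) h h3, by simp only [Prog.tb]; omega,
      fun a i => (h5 a i).trans (by simp only [Prog.tb]; omega), h6⟩

/-- The scalar variable kept in cell `0` of bank `v`. -/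
abbrev V (v : ℕ) : Expr := .load v (.const 0)

/-- `for v = 0, …, b - 1 do body`, with scalar variables `v` and `b`. -/
def forP (v b : ℕ) (body : Prog) : Prog :=
  .seq (.store v (.const 0) (.const 0))
    (.while (.lt (V v) (V b)) (.seq body (.store v (.const 0) (.add (V v) (.const 1)))))

/-- The rule for bounded loops: the invariant `J i` holds before iteration `i`. -/
theorem WP.for {v b : ℕ} {body : Prog} (J : ℕ → Store → Prop) (N : ℕ)
    (hS : 0 < E.L.size) (hv : v ∉ body.mods) (hb : b ∉ body.mods) (hvb : b ≠ v)
    (hN : σ b 0 = N) (hNB : N ≤ E.B)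
    (h0 : J 0 (write σ v 0 0))
    (hstep : ∀ i < N, ∀ σ', (∀ a, a ≠ v → a ∉ body.mods → σ' a = σ a) → σ' v 0 = i → J i σ' →
      WP E body (fun σ'' => J (i + 1) (write σ'' v 0 (i + 1))) σ')
    (hQ : ∀ σ', (∀ a, a ≠ v → a ∉ body.mods → σ' a = σ a) → J N σ' → Q σ') :
    WP E (forP v b body) Q σ := by
  unfold forP
  refine WP.seq (WP.store (by simp [Expr.Inb]) (by simp [Expr.Inb])
    (by simpa [Expr.eval] using hS) ?_)
  simp only [Expr.eval]
  set w : Prog := .while (.lt (V v) (V b)) (.seq body (.store v (.const 0)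
    (.add (V v) (.const 1)))) with hw
  intro hc
  simp only [hw, Prog.chk, Bool.and_eq_true] at hc
  -- The remaining `k` iterations take at most `k * s + 5` operations.
  set s := (Test.lt (V v) (V b)).cost + (Prog.seq body (.store v (.const 0)
    (.add (V v) (.const 1)))).tb E.B with hs
  have key : ∀ k, ∀ i, i + k = N → ∀ σ', (∀ a, a ≠ v → a ∉ body.mods → σ' a = σ a) →
      σ' v 0 = i → J i σ' → ∀ β, (∀ a i, σ' a i ≤ β) → β + (k * s + 5) ≤ E.K →
      ∃ σ'' t, Exec E.L E.x w σ' σ'' t ∧ t ≤ k * s + 5 ∧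
        (∀ a i, σ'' a i ≤ β + (k * s + 5)) ∧ Q σ'' := by
    intro k
    induction k with
    | zero =>
      intro i hi σ' hf hvi hJ β hβ hK
      have hσ : ∀ a i, σ' a i ≤ E.K := fun a i => (hβ a i).trans (by omega)
      have e1 : σ' b 0 = N := by rw [hf b hvb hb, hN]
      refine ⟨σ', _, .while_false (Test.fits E hσ _ hc.1
        (by simp [Test.Inb, Expr.Inb, Expr.eval, hS])) ?_, ?_, ?_, ?_⟩
      · simp only [Test.Holds, Expr.eval]; omega
      · simp [Test.cost, Expr.cost]
      · intro a j; exact (hβ a j).trans (by omega)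
      · exact hQ σ' hf (by rwa [show N = i by omega])
    | succ k ih =>
      intro i hi σ' hf hvi hJ β hβ hK
      have hσ : ∀ a i, σ' a i ≤ E.K := fun a i => (hβ a i).trans (by omega)
      have e1 : σ' b 0 = N := by rw [hf b hvb hb, hN]
      have hstep' : WP E (.seq body (.store v (.const 0) (.add (V v) (.const 1))))
          (fun σ'' => (∀ a, a ≠ v → a ∉ body.mods → σ'' a = σ a) ∧ σ'' v 0 = i + 1 ∧
            J (i + 1) σ'') σ' := by
        refine WP.seq ((hstep i (by omega) σ' hf hvi hJ).mono ?_)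
        intro σ'' hf' hJ'
        refine WP.store (by simp [Expr.Inb]) (by simp [Expr.Inb, Expr.eval, hS])
          (by simpa [Expr.eval] using hS) ?_
        have e2 : σ'' v 0 = i := by rw [hf' v hv, hvi]
        simp only [Expr.eval, e2]
        refine ⟨?_, by simp [write], hJ'⟩
        intro a ha ham
        funext j
        simp only [write, ha, false_and, if_false]
        rw [hf' a ham, hf a ha ham]
      rw [add_mul, one_mul] at hK ⊢
      have hsb : (Prog.seq body (.store v (.const 0) (.add (V v) (.const 1)))).tb E.B ≤ s := by
        omega
      obtain ⟨σ'', t, g1, g2, g3, g4, g5, g6⟩ := hstep' (by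
        simp only [Prog.chk, Bool.and_eq_true] at hc ⊢; exact hc.2) β hβ (by omega)
      obtain ⟨σ3, t', l1, l2, l3, l4⟩ := ih (i + 1) (by omega) σ'' g4 g5 g6 _ g3 (by omega)
      refine ⟨σ3, _, .while_true (Test.fits E hσ _ hc.1
        (by simp [Test.Inb, Expr.Inb, Expr.eval, hS])) ?_ g1 l1, ?_, ?_, l4⟩
      · simp only [Test.Holds, Expr.eval]; omega
      · omega
      · intro a j; exact (l3 a j).trans (by omega)
  intro β hβ hK
  have htb : w.tb E.B = E.B * s + 5 := by
    simp only [hw, Prog.tb, hs]; simp [Test.cost, Expr.cost]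
  rw [htb] at hK ⊢
  have hle : N * s ≤ E.B * s := Nat.mul_le_mul_right _ hNB
  obtain ⟨σ3, t', l1, l2, l3, l4⟩ := key N 0 (by omega) _ (by
    intro a ha _; funext j; simp [write, ha]) (by simp [write]) h0 β hβ (by omega)
  exact ⟨σ3, t', l1, by omega, fun a j => (l3 a j).trans (by omega), l4⟩

end WordRAM

/-! ### Combinatorial description of planar solutions -/

namespace BoundaryLabeling

/-- `a` lies strictly between `b` and `c`. -/
def Btw (a b c : ℝ) : Prop := (b < a ∧ a < c) ∨ (c < a ∧ a < b)

/-- The order-theoretic content of an instance: the coordinates of the sites, and for each label its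
side and the coordinate `τ` of its port along that side. -/
structure Cfg (n m : ℕ) where
  X : Fin n → ℝ
  Y : Fin n → ℝ
  τ : Fin m → ℝ
  top : Fin m → Prop
  X_inj : Function.Injective X
  Y_inj : Function.Injective Y
  top_inj : ∀ j k, top j → top k → τ j = τ k → j = k
  right_inj : ∀ j k, ¬ top j → ¬ top k → τ j = τ k → j = k
  X_ne : ∀ i j, top j → X i ≠ τ j
  Y_ne : ∀ i j, ¬ top j → Y i ≠ τ j

namespace Cfg

variable {n m : ℕ}

/-- Reflection in the diagonal, which exchanges the two sides. -/
def mirror (c : Cfg n m) : Cfg n m where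
  X := c.Y
  Y := c.X
  τ := c.τ
  top j := ¬ c.top j
  X_inj := c.Y_inj
  Y_inj := c.X_inj
  top_inj := c.right_inj
  right_inj j k hj hk := c.top_inj j k (not_not.1 hj) (not_not.1 hk)
  X_ne := c.Y_ne
  Y_ne i j hj := c.X_ne i j (not_not.1 hj)

/-- No two leaders of the assignment `f` cross, in terms of the order of the coordinates.  Leaders
to the same side can cross only in that the second segment of one meets the first segment of the
other (`tt` and `rr`); leaders to different sides cross in that their second segments or their first
segments meet (`tr`). -/
structure Planar (c : Cfg n m) (f : Fin m → Fin n) : Prop where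
  inj : Function.Injective f
  tt : ∀ j k, c.top j → c.top k →
    ¬ (c.Y (f j) < c.Y (f k) ∧ Btw (c.τ j) (c.X (f k)) (c.τ k))
  rr : ∀ j k, ¬ c.top j → ¬ c.top k →
    ¬ (c.X (f j) < c.X (f k) ∧ Btw (c.τ j) (c.Y (f k)) (c.τ k))
  tr : ∀ j k, c.top j → ¬ c.top k →
    ¬ (c.X (f k) < c.τ j ∧ c.Y (f j) < c.τ k) ∧
    ¬ (Btw (c.X (f k)) (c.X (f j)) (c.τ j) ∧ Btw (c.Y (f j)) (c.Y (f k)) (c.τ k))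

theorem Planar.mirror {c : Cfg n m} {f : Fin m → Fin n} (h : c.Planar f) : c.mirror.Planar f where
  inj := h.inj
  tt := h.rr
  rr j k hj hk := h.tt j k (not_not.1 hj) (not_not.1 hk)
  tr j k hj hk := by
    have := h.tr k j (not_not.1 hk) hj
    exact ⟨fun h' => this.1 ⟨h'.2, h'.1⟩, fun h' => this.2 ⟨h'.2, h'.1⟩⟩

theorem planar_mirror_iff {c : Cfg n m} {f : Fin m → Fin n} : c.mirror.Planar f ↔ c.Planar f := by
  refine ⟨fun h => ?_, fun h => h.mirror⟩
  have e : c.mirror.mirror = c := by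
    cases c; simp [Cfg.mirror]
  have := h.mirror
  rwa [e] at this

end Cfg

theorem mem_leader_top {p t z : ℝ × ℝ} : z ∈ leader .top p t ↔
    (z.2 = p.2 ∧ z.1 ∈ Set.uIcc p.1 t.1) ∨ (z.1 = t.1 ∧ z.2 ∈ Set.uIcc p.2 t.2) := by
  obtain ⟨a, b⟩ := p
  obtain ⟨c, d⟩ := t
  obtain ⟨u, v⟩ := z
  simp only [leader, bend, Set.mem_union, ← Prod.image_mk_segment_left,
    ← Prod.image_mk_segment_right, segment_eq_uIcc, Set.mem_image, Prod.mk.injEq]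
  constructor
  · rintro (⟨x, h1, rfl, rfl⟩ | ⟨x, h1, rfl, rfl⟩)
    · exact .inl ⟨rfl, h1⟩
    · exact .inr ⟨rfl, h1⟩
  · rintro (⟨rfl, h⟩ | ⟨rfl, h⟩)
    · exact .inl ⟨_, h, rfl, rfl⟩
    · exact .inr ⟨_, h, rfl, rfl⟩

theorem mem_leader_right {p t z : ℝ × ℝ} : z ∈ leader .right p t ↔
    (z.1 = p.1 ∧ z.2 ∈ Set.uIcc p.2 t.2) ∨ (z.2 = t.2 ∧ z.1 ∈ Set.uIcc p.1 t.1) := by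
  obtain ⟨a, b⟩ := p
  obtain ⟨c, d⟩ := t
  obtain ⟨u, v⟩ := z
  simp only [leader, bend, Set.mem_union, ← Prod.image_mk_segment_left,
    ← Prod.image_mk_segment_right, segment_eq_uIcc, Set.mem_image, Prod.mk.injEq]
  constructor
  · rintro (⟨x, h1, rfl, rfl⟩ | ⟨x, h1, rfl, rfl⟩)
    · exact .inl ⟨rfl, h1⟩
    · exact .inr ⟨rfl, h1⟩
  · rintro (⟨rfl, h⟩ | ⟨rfl, h⟩)
    · exact .inl ⟨_, h, rfl, rfl⟩
    · exact .inr ⟨_, h, rfl, rfl⟩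

theorem mem_uIcc_iff_btw {a b c : ℝ} (h1 : a ≠ b) (h2 : a ≠ c) : a ∈ Set.uIcc b c ↔ Btw a b c := by
  rw [Set.mem_uIcc, Btw]
  constructor
  · rintro (⟨h3, h4⟩ | ⟨h3, h4⟩)
    · exact .inl ⟨lt_of_le_of_ne h3 h1.symm, lt_of_le_of_ne h4 h2⟩
    · exact .inr ⟨lt_of_le_of_ne h3 h2.symm, lt_of_le_of_ne h4 h1⟩
  · rintro (⟨h3, h4⟩ | ⟨h3, h4⟩)
    · exact .inl ⟨h3.le, h4.le⟩
    · exact .inr ⟨h3.le, h4.le⟩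

/-- Two leaders to the same side, here the top side at height `H`. -/
theorem disjoint_leader_top_top {p q t s : ℝ × ℝ} {H : ℝ} (ht : t.2 = H) (hs : s.2 = H)
    (hp : p.2 ≤ H) (hq : q.2 ≤ H) (hpq : p.2 ≠ q.2) (hts : t.1 ≠ s.1) (h1 : t.1 ≠ q.1)
    (h2 : s.1 ≠ p.1) :
    Disjoint (leader .top p t) (leader .top q s) ↔
      ¬ (p.2 < q.2 ∧ Btw t.1 q.1 s.1) ∧ ¬ (q.2 < p.2 ∧ Btw s.1 p.1 t.1) := by
  rw [Set.disjoint_left]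
  simp only [mem_leader_top]
  rw [← mem_uIcc_iff_btw h1 hts, ← mem_uIcc_iff_btw h2 hts.symm, ht, hs,
    Set.uIcc_of_le hp, Set.uIcc_of_le hq]
  constructor
  · intro h
    refine ⟨fun h3 => h (a := (t.1, q.2)) (.inr ⟨rfl, h3.1.le, hq⟩) (.inl ⟨rfl, h3.2⟩),
      fun h3 => h (a := (s.1, p.2)) (.inl ⟨rfl, h3.2⟩) (.inr ⟨rfl, h3.1.le, hp⟩)⟩
  · rintro ⟨h3, h4⟩ ⟨u, v⟩ (⟨h5, h6⟩ | ⟨h5, h6⟩) (⟨h7, h8⟩ | ⟨h7, h8⟩)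
    · exact hpq (h5.symm.trans h7)
    · simp only at h5 h6 h7 h8
      subst h5 h7
      exact h4 ⟨lt_of_le_of_ne h8.1 (Ne.symm hpq), h6⟩
    · simp only at h5 h6 h7 h8
      subst h5 h7
      exact h3 ⟨lt_of_le_of_ne h6.1 hpq, h8⟩
    · exact hts (h5.symm.trans h7)

theorem leader_right_eq (p t : ℝ × ℝ) :
    leader .right p t = Prod.swap ⁻¹' leader .top p.swap t.swap := by
  ext z
  simp [mem_leader_right, mem_leader_top]

theorem disjoint_leader_right_right {p q t s : ℝ × ℝ} {W : ℝ} (ht : t.1 = W) (hs : s.1 = W)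
    (hp : p.1 ≤ W) (hq : q.1 ≤ W) (hpq : p.1 ≠ q.1) (hts : t.2 ≠ s.2) (h1 : t.2 ≠ q.2)
    (h2 : s.2 ≠ p.2) :
    Disjoint (leader .right p t) (leader .right q s) ↔
      ¬ (p.1 < q.1 ∧ Btw t.2 q.2 s.2) ∧ ¬ (q.1 < p.1 ∧ Btw s.2 p.2 t.2) := by
  rw [leader_right_eq, leader_right_eq, Set.disjoint_preimage_iff Prod.swap_surjective]
  exact disjoint_leader_top_top (p := p.swap) (q := q.swap) (t := t.swap) (s := s.swap)
    ht hs hp hq hpq hts h1 h2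

theorem disjoint_leader_top_right {p q t s : ℝ × ℝ} {W H : ℝ} (ht : t.2 = H) (hs : s.1 = W)
    (hp : p.2 ≤ H) (hq : q.1 ≤ W) (htW : t.1 ≤ W) (hsH : s.2 ≤ H)
    (hx : p.1 ≠ q.1) (hy : p.2 ≠ q.2) (h1 : q.1 ≠ t.1) (h2 : p.2 ≠ s.2) :
    Disjoint (leader .top p t) (leader .right q s) ↔
      ¬ (q.1 < t.1 ∧ p.2 < s.2) ∧ ¬ (Btw q.1 p.1 t.1 ∧ Btw p.2 q.2 s.2) := by
  rw [Set.disjoint_left]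
  simp only [mem_leader_top, mem_leader_right]
  rw [← mem_uIcc_iff_btw hx.symm h1, ← mem_uIcc_iff_btw hy h2, ht, hs,
    Set.uIcc_of_le hp, Set.uIcc_of_le hq]
  constructor
  · intro h
    refine ⟨fun h3 => h (a := (t.1, s.2)) (.inr ⟨rfl, h3.2.le, hsH⟩) (.inr ⟨rfl, h3.1.le, htW⟩),
      fun h3 => h (a := (q.1, p.2)) (.inl ⟨rfl, h3.1⟩) (.inl ⟨rfl, h3.2⟩)⟩
  · rintro ⟨h3, h4⟩ ⟨u, v⟩ (⟨h5, h6⟩ | ⟨h5, h6⟩) (⟨h7, h8⟩ | ⟨h7, h8⟩)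
    · simp only at h5 h6 h7 h8
      subst h5 h7
      exact h4 ⟨h6, h8⟩
    · exact h2 (h5.symm.trans h7)
    · exact h1 (h7.symm.trans h5)
    · simp only at h5 h6 h7 h8
      subst h5 h7
      exact h3 ⟨lt_of_le_of_ne h8.1 h1, lt_of_le_of_ne h6.1 h2⟩

namespace Instance

variable {n m : ℕ} (I : Instance n m)

/-- The configuration of an instance. -/
noncomputable def cfg : Cfg n m where
  X i := (I.site i).1
  Y i := (I.site i).2
  τ j := if I.side j = .top then (I.port j).1 else (I.port j).2
  top j := I.side j = .top
  X_inj := I.site_x_injective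
  Y_inj := I.site_y_injective
  top_inj j k hj hk h := by
    simp only [hj, hk, if_true] at h
    exact I.port_injective (Prod.ext h ((I.port_top j hj).2.trans (I.port_top k hk).2.symm))
  right_inj j k hj hk h := by
    simp only [hj, hk, if_false] at h
    have side : ∀ j, I.side j ≠ .top → I.side j = .right := fun j h => by
      cases h' : I.side j <;> simp_all
    exact I.port_injective (Prod.ext ((I.port_right j (side j hj)).1.trans
      (I.port_right k (side k hk)).1.symm) h)
  X_ne i j hj := by simp only [hj, if_true]; exact I.site_x_ne_port i j
  Y_ne i j hj := by simp only [hj, if_false]; exact I.site_y_ne_port i j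

theorem isPlanarSolution_iff (f : Fin m → Fin n) : I.IsPlanarSolution f ↔ I.cfg.Planar f := by
  have side : ∀ j, I.side j ≠ .top → I.side j = .right := fun j h => by
    cases h' : I.side j <;> simp_all
  have sW : ∀ i, (I.site i).1 ≤ I.W := fun i => (I.site_mem i).1.2
  have sH : ∀ i, (I.site i).2 ≤ I.H := fun i => (I.site_mem i).2.2
  have tt : Function.Injective f → ∀ j k, j ≠ k → I.side j = .top → I.side k = .top →
      _ := fun hf j k hjk hj hk => disjoint_leader_top_top (p := I.site (f j)) (q := I.site (f k))
        (I.port_top j hj).2 (I.port_top k hk).2 (sH _) (sH _)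
        (fun h => hjk (hf (I.site_y_injective h)))
        (fun h => hjk (I.cfg.top_inj j k hj hk (by simpa [cfg, hj, hk] using h)))
        (I.site_x_ne_port _ _).symm (I.site_x_ne_port _ _).symm
  have rr : Function.Injective f → ∀ j k, j ≠ k → I.side j ≠ .top → I.side k ≠ .top →
      _ := fun hf j k hjk hj hk => disjoint_leader_right_right (p := I.site (f j))
        (q := I.site (f k))
        (I.port_right j (side j hj)).1 (I.port_right k (side k hk)).1 (sW _) (sW _)
        (fun h => hjk (hf (I.site_x_injective h)))
        (fun h => hjk (I.cfg.right_inj j k hj hk (by simpa [cfg, hj, hk] using h)))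
        (I.site_y_ne_port _ _).symm (I.site_y_ne_port _ _).symm
  have tr : Function.Injective f → ∀ j k, I.side j = .top → I.side k ≠ .top →
      _ := fun hf j k hj hk => disjoint_leader_top_right (p := I.site (f j))
        (q := I.site (f k)) (t := I.port j) (s := I.port k)
        (I.port_top j hj).2 (I.port_right k (side k hk)).1 (sH _) (sW _)
        (I.port_top j hj).1.2 (I.port_right k (side k hk)).2.2
        (fun h => hk (by rw [← hf (I.site_x_injective h), hj]))
        (fun h => hk (by rw [← hf (I.site_y_injective h), hj]))
        (I.site_x_ne_port _ _) (I.site_y_ne_port _ _)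
  constructor
  · rintro ⟨hf, h⟩
    refine ⟨hf, ?_, ?_, ?_⟩
    · intro j k hj hk
      have hj' : I.side j = .top := hj
      have hk' : I.side k = .top := hk
      by_cases hjk : j = k
      · subst hjk; exact fun h' => lt_irrefl _ h'.1
      have := h j k hjk
      rw [hj', hk', tt hf j k hjk hj hk] at this
      simpa [cfg, hj', hk'] using this.1
    · intro j k hj hk
      have hj' : I.side j ≠ .top := hj
      have hk' : I.side k ≠ .top := hk
      by_cases hjk : j = k
      · subst hjk; exact fun h' => lt_irrefl _ h'.1
      have := h j k hjk
      rw [side j hj', side k hk', rr hf j k hjk hj hk] at this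
      simpa [cfg, hj', hk'] using this.1
    · intro j k hj hk
      have hj' : I.side j = .top := hj
      have hk' : I.side k ≠ .top := hk
      have := h j k (fun e => hk (e ▸ hj))
      rw [hj', side k hk', tr hf j k hj hk] at this
      simpa [cfg, hj', hk'] using this
  · rintro ⟨hf, htt, hrr, htr⟩
    refine ⟨hf, fun j k hjk => ?_⟩
    by_cases hj : I.side j = .top <;> by_cases hk : I.side k = .top
    · rw [hj, hk, tt hf j k hjk hj hk]
      have h1 := htt j k hj hk
      have h2 := htt k j hk hj
      simp only [cfg, hj, hk, if_true] at h1 h2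
      exact ⟨h1, h2⟩
    · rw [hj, side k hk, tr hf j k hj hk]
      have h1 := htr j k hj hk
      simp only [cfg, hj, hk, if_true, if_false] at h1
      exact h1
    · rw [hk, side j hj, disjoint_comm, tr hf k j hk hj]
      have h1 := htr k j hk hj
      simp only [cfg, hj, hk, if_true, if_false] at h1
      exact h1
    · rw [side j hj, side k hk, rr hf j k hjk hj hk]
      have h1 := hrr j k hj hk
      have h2 := hrr k j hk hj
      simp only [cfg, hj, hk, if_false] at h1 h2
      exact ⟨h1, h2⟩

end Instance

end BoundaryLabeling

/-! ### Separating top leaders from right leaders -/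

namespace BoundaryLabeling

/-- Leaders to a single side can always be drawn without crossings: the site with the largest `y`
takes the port nearest to it in the other coordinate, so that the first segment of its leader passes
below no other port; the remaining sites and ports are matched recursively. -/
theorem exists_oneSided {α β : Type*} [Nonempty α] [DecidableEq α]
    [DecidableEq β] (x y : α → ℝ) (t : β → ℝ)
    (S : Finset α) (P : Finset β) (h : S.card = P.card) :
    ∃ g : β → α, Set.InjOn g P ∧ P.image g = S ∧
      ∀ j ∈ P, ∀ k ∈ P, ¬ (y (g j) < y (g k) ∧ Btw (t j) (x (g k)) (t k)) := by
  induction hn : S.card generalizing S P with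
  | zero =>
    rw [hn] at h
    obtain rfl := Finset.card_eq_zero.1 hn
    obtain rfl := Finset.card_eq_zero.1 h.symm
    exact ⟨fun _ => Classical.arbitrary α, by simp⟩
  | succ N ih =>
    have hS : S.Nonempty := Finset.card_pos.1 (by omega)
    have hP : P.Nonempty := Finset.card_pos.1 (by omega)
    obtain ⟨s, hs, hmax⟩ := Finset.exists_max_image S y hS
    obtain ⟨b, hb, hmin⟩ := Finset.exists_min_image P (fun j => |t j - x s|) hP
    obtain ⟨g, h1, h2, h3⟩ := ih (S.erase s) (P.erase b)
      (by rw [Finset.card_erase_of_mem hs, Finset.card_erase_of_mem hb, h])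
      (by rw [Finset.card_erase_of_mem hs]; omega)
    have hg : ∀ j ∈ P, j ≠ b → g j ∈ S ∧ g j ≠ s := by
      intro j hj hjb
      have : g j ∈ S.erase s := by
        rw [← h2]; exact Finset.mem_image_of_mem g (Finset.mem_erase.2 ⟨hjb, hj⟩)
      exact ⟨Finset.mem_of_mem_erase this, Finset.ne_of_mem_erase this⟩
    refine ⟨Function.update g b s, ?_, ?_, ?_⟩
    · intro j hj k hk hjk
      by_cases hjb : j = b <;> by_cases hkb : k = b
      · rw [hjb, hkb]
      · subst hjb
        simp only [Function.update_self, Function.update_of_ne hkb] at hjk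
        exact absurd hjk.symm (hg k hk hkb).2
      · subst hkb
        simp only [Function.update_self, Function.update_of_ne hjb] at hjk
        exact absurd hjk (hg j hj hjb).2
      · simp only [Function.update_of_ne hjb, Function.update_of_ne hkb] at hjk
        exact h1 (by simp [hjb]; exact hj) (by simp [hkb]; exact hk) hjk
    · rw [← Finset.insert_erase hb, Finset.image_insert, Function.update_self,
        ← Finset.insert_erase hs, ← h2]
      congr 1
      apply Finset.image_congr
      intro j hj
      exact Function.update_of_ne (Finset.ne_of_mem_erase (Finset.mem_coe.1 hj)) _ _
    · intro j hj k hk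
      by_cases hjb : j = b <;> by_cases hkb : k = b
      · rw [hjb, hkb]; exact fun h => lt_irrefl _ h.1
      · subst hjb
        simp only [Function.update_self, Function.update_of_ne hkb]
        exact fun h => not_lt.2 (hmax _ (hg k hk hkb).1) h.1
      · subst hkb
        simp only [Function.update_self, Function.update_of_ne hjb]
        rintro ⟨-, h4 | h4⟩
        · have := hmin j hj
          rw [abs_of_pos (by linarith), abs_of_pos (by linarith)] at this
          linarith
        · have := hmin j hj
          rw [abs_of_neg (by linarith), abs_of_neg (by linarith)] at this
          linarith
      · simp only [Function.update_of_ne hjb, Function.update_of_ne hkb]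
        exact h3 j (Finset.mem_erase.2 ⟨hjb, hj⟩) k (Finset.mem_erase.2 ⟨hkb, hk⟩)

/-- How a sum over the sites of `P` changes when the site `a` is replaced by `b`. -/
theorem sum_exchange {α β : Type*} [DecidableEq α] [DecidableEq β] (F : α → ℝ) {P : Finset β}
    {f g : β → α} {a b : α} (hf : Set.InjOn f P) (hg : Set.InjOn g P) (ha : a ∈ P.image f)
    (hb : b ∉ P.image f) (h : P.image g = insert b ((P.image f).erase a)) :
    ∑ j ∈ P, F (g j) = ∑ j ∈ P, F (f j) - F a + F b := by
  rw [← Finset.sum_image (f := F) hg, ← Finset.sum_image (f := F) hf, h,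
    Finset.sum_insert (fun h' => hb (Finset.mem_of_mem_erase h')), Finset.sum_erase_eq_sub ha]
  ring

namespace Cfg

variable {n m : ℕ}

open Classical in
/-- A potential that increases when a top label and a right label exchange their sites and the top
label gets the one to the upper left. -/
noncomputable def pot (c : Cfg n m) (f : Fin m → Fin n) : ℝ :=
  ∑ j, if c.top j then c.Y (f j) - c.X (f j) else c.X (f j) - c.Y (f j)

theorem pot_mirror (c : Cfg n m) (f : Fin m → Fin n) : c.mirror.pot f = c.pot f := by
  unfold pot mirror
  refine Finset.sum_congr rfl fun j _ => ?_
  by_cases h : c.top j <;> simp [h]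

/-- The leader of the right label `k` passes to the left of and below the leader of the top label
`j`. -/
def Wraps (c : Cfg n m) (f : Fin m → Fin n) (k j : Fin m) : Prop :=
  c.top j ∧ ¬ c.top k ∧ c.X (f k) < c.τ j ∧ c.X (f k) < c.X (f j) ∧ c.τ k < c.Y (f j) ∧
    c.Y (f j) < c.Y (f k)

/-- If a right leader wraps around a top leader, then some exchange of their sites increases the
potential.  The top labels `J` with sites in the pocket between the two leaders, and the right
labels `K` with ports in it, are matched anew with their old sites, where one top site and one right
site change sides; `exists_oneSided` provides the new matchings, and they do not interfere with the
other leaders. -/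
theorem exists_pot_lt (c : Cfg n m) (f : Fin m → Fin n) (hf : c.Planar f)
    (hw : ∃ k j, c.Wraps f k j) : ∃ f', c.Planar f' ∧ c.pot f < c.pot f' := by
  classical
  -- Among the right leaders that wrap around a top leader take the one with the highest port, and
  -- among the top leaders in its pocket the one with the lowest site.
  obtain ⟨k₀, hk₀, hkmax⟩ := Finset.exists_max_image
    (Finset.univ.filter fun k => ∃ j, c.Wraps f k j) c.τ
    (by obtain ⟨k, j, h⟩ := hw; exact ⟨k, by simpa using ⟨j, h⟩⟩)
  simp only [Finset.mem_filter, Finset.mem_univ, true_and] at hk₀ hkmax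
  obtain ⟨j₀, hj₀, hjmin⟩ := Finset.exists_min_image
    (Finset.univ.filter fun j => c.Wraps f k₀ j) (fun j => c.Y (f j))
    (by obtain ⟨j, h⟩ := hk₀; exact ⟨j, by simpa using h⟩)
  simp only [Finset.mem_filter, Finset.mem_univ, true_and] at hj₀ hjmin
  have hkmax' : ∀ k j, c.Wraps f k j → c.τ k ≤ c.τ k₀ := fun k j h => hkmax k ⟨j, h⟩
  clear hkmax hk₀ hw
  obtain ⟨tj₀, tk₀, w1, w2, w3, w4⟩ := id hj₀
  have hne : ∀ {j k}, c.top j → ¬ c.top k → j ≠ k := fun h1 h2 h3 => h2 (h3 ▸ h1)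
  have Xne : ∀ {j k}, j ≠ k → c.X (f j) ≠ c.X (f k) := fun h1 h2 => h1 (hf.inj (c.X_inj h2))
  have Yne : ∀ {j k}, j ≠ k → c.Y (f j) ≠ c.Y (f k) := fun h1 h2 => h1 (hf.inj (c.Y_inj h2))
  set J := Finset.univ.filter fun j => c.Wraps f k₀ j ∧ c.τ j ≤ c.τ j₀ with hJ
  set K := Finset.univ.filter fun k => k = k₀ ∨ (¬ c.top k ∧ c.X (f k₀) < c.X (f k) ∧
    c.X (f k) < c.X (f j₀) ∧ c.τ k₀ < c.τ k ∧ c.τ k < c.Y (f j₀)) with hK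
  have memJ : ∀ j, j ∈ J ↔ c.Wraps f k₀ j ∧ c.τ j ≤ c.τ j₀ := fun j => by simp [hJ]
  have memK : ∀ k, k ∈ K ↔ k = k₀ ∨ (¬ c.top k ∧ c.X (f k₀) < c.X (f k) ∧
    c.X (f k) < c.X (f j₀) ∧ c.τ k₀ < c.τ k ∧ c.τ k < c.Y (f j₀)) := fun k => by simp [hK]
  have j₀J : j₀ ∈ J := (memJ _).2 ⟨hj₀, le_rfl⟩
  have k₀K : k₀ ∈ K := (memK _).2 (.inl rfl)
  have topJ : ∀ j ∈ J, c.top j := fun j hj => ((memJ j).1 hj).1.1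
  have topK : ∀ k ∈ K, ¬ c.top k := fun k hk => by
    rcases (memK k).1 hk with rfl | h
    exacts [tk₀, h.1]
  have q_notJ : f k₀ ∉ J.image f := by
    intro h
    obtain ⟨j, hj, h⟩ := Finset.mem_image.1 h
    exact hne (topJ j hj) tk₀ (hf.inj h)
  have p_notK : f j₀ ∉ K.image f := by
    intro h
    obtain ⟨j, hj, h⟩ := Finset.mem_image.1 h
    exact hne tj₀ (topK j hj) (hf.inj h).symm
  have pJ := Finset.mem_image_of_mem f j₀J
  have qK := Finset.mem_image_of_mem f k₀K
  have : Nonempty (Fin n) := ⟨f k₀⟩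
  obtain ⟨gJ, gJi, gJim, gJp⟩ := exists_oneSided c.X c.Y c.τ
    (insert (f k₀) ((J.image f).erase (f j₀))) J (by
      rw [Finset.card_insert_of_notMem (fun h => q_notJ (Finset.mem_of_mem_erase h)),
        Finset.card_erase_add_one pJ, Finset.card_image_of_injective _ hf.inj])
  obtain ⟨gK, gKi, gKim, gKp⟩ := exists_oneSided c.Y c.X c.τ
    (insert (f j₀) ((K.image f).erase (f k₀))) K (by
      rw [Finset.card_insert_of_notMem (fun h => p_notK (Finset.mem_of_mem_erase h)),
        Finset.card_erase_add_one qK, Finset.card_image_of_injective _ hf.inj])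
  -- Positions of the reassigned sites.
  have hJ' : ∀ j ∈ J, c.X (f k₀) ≤ c.X (gJ j) ∧ c.X (gJ j) < c.τ j₀ ∧
      c.Y (f j₀) < c.Y (gJ j) ∧ c.Y (gJ j) ≤ c.Y (f k₀) := by
    intro j hj
    have h := Finset.mem_image_of_mem gJ hj
    rw [gJim, Finset.mem_insert, Finset.mem_erase, Finset.mem_image] at h
    rcases h with h | ⟨h, i, hi, hij⟩
    · rw [h]; exact ⟨le_rfl, w1, w4, le_rfl⟩
    · rw [← hij] at h ⊢
      obtain ⟨⟨ti, _, v1, v2, v3, v4⟩, v5⟩ := (memJ i).1 hi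
      have hi0 : i ≠ j₀ := fun e => h (by rw [e])
      have y1 : c.Y (f j₀) < c.Y (f i) := lt_of_le_of_ne (hjmin i ((memJ i).1 hi).1) (Yne hi0.symm)
      have y2 := hf.tt j₀ i tj₀ ti
      have y3 : c.τ i < c.τ j₀ := lt_of_le_of_ne v5 (fun e => hi0 (c.top_inj _ _ ti tj₀ e))
      have y4 := c.X_ne (f i) j₀ tj₀
      refine ⟨v2.le, ?_, y1, v4.le⟩
      by_contra y5
      exact y2 ⟨y1, .inr ⟨y3, lt_of_le_of_ne (not_lt.1 y5) y4.symm⟩⟩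
  have hK' : ∀ k ∈ K, c.X (f k₀) < c.X (gK k) ∧ c.X (gK k) ≤ c.X (f j₀) ∧
      c.τ k₀ < c.Y (gK k) ∧ c.Y (gK k) ≤ c.Y (f j₀) := by
    intro k hk
    have h := Finset.mem_image_of_mem gK hk
    rw [gKim, Finset.mem_insert, Finset.mem_erase, Finset.mem_image] at h
    rcases h with h | ⟨h, i, hi, hik⟩
    · rw [h]; exact ⟨w2, le_rfl, w3, le_rfl⟩
    · rw [← hik] at h ⊢
      rcases (memK i).1 hi with rfl | ⟨ti, v1, v2, v3, v4⟩
      · exact absurd rfl h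
      have y1 := hf.rr k₀ i tk₀ ti
      have y2 := hf.tr j₀ i tj₀ ti
      have y3 := hkmax' i j₀
      have y4 := c.Y_ne (f i) k₀ tk₀
      have y5 := c.X_ne (f i) j₀ tj₀
      simp only [Wraps, Btw] at y1 y2 y3
      clear * - v1 v2 v3 v4 y1 y2 y3 y4 y5 w1 w2 w3 w4 ti tj₀ tk₀
      refine ⟨v1, v2.le, ?_, ?_⟩ <;> grind
  have hJτ : ∀ j ∈ J, c.X (f k₀) < c.τ j ∧ c.τ j ≤ c.τ j₀ ∧ c.Y (f j) < c.Y (f k₀) ∧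
      c.τ k₀ < c.Y (f j) := by
    intro j hj
    obtain ⟨⟨_, _, v1, v2, v3, v4⟩, v5⟩ := (memJ j).1 hj
    exact ⟨v1, v5, v4, v3⟩
  have hKτ : ∀ k ∈ K, c.τ k₀ ≤ c.τ k ∧ c.τ k < c.Y (f j₀) ∧ c.X (f k) < c.X (f j₀) := by
    intro k hk
    rcases (memK k).1 hk with rfl | ⟨_, v1, v2, v3, v4⟩
    · exact ⟨le_rfl, w3, w2⟩
    · exact ⟨v3.le, v4, v2⟩
  set f' : Fin m → Fin n := fun j => if j ∈ J then gJ j else if j ∈ K then gK j else f j with hf'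
  have eJ : ∀ j ∈ J, f' j = gJ j := fun j hj => by simp [hf', hj]
  have eK : ∀ k ∈ K, f' k = gK k := fun k hk => by
    have : k ∉ J := fun h => topK k hk (topJ k h)
    simp [hf', hk, this]
  have eo : ∀ k, k ∉ J → k ∉ K → f' k = f k := fun k h1 h2 => by simp [hf', h1, h2]
  have JnK : ∀ j ∈ J, j ∉ K := fun j h1 h2 => topK j h2 (topJ j h1)
  refine ⟨f', ⟨?_, ?_, ?_, ?_⟩, ?_⟩
  · have iJ : ∀ j ∈ J, (gJ j = f k₀) ∨ ∃ i ∈ J, i ≠ j₀ ∧ gJ j = f i := by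
      intro j hj
      have h := Finset.mem_image_of_mem gJ hj
      rw [gJim, Finset.mem_insert, Finset.mem_erase, Finset.mem_image] at h
      rcases h with h | ⟨h, i, hi, hij⟩
      · exact .inl h
      · exact .inr ⟨i, hi, fun e => h (by rw [← hij, e]), hij.symm⟩
    have iK : ∀ j ∈ K, (gK j = f j₀) ∨ ∃ i ∈ K, i ≠ k₀ ∧ gK j = f i := by
      intro j hj
      have h := Finset.mem_image_of_mem gK hj
      rw [gKim, Finset.mem_insert, Finset.mem_erase, Finset.mem_image] at h
      rcases h with h | ⟨h, i, hi, hij⟩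
      · exact .inl h
      · exact .inr ⟨i, hi, fun e => h (by rw [← hij, e]), hij.symm⟩
    have JK : ∀ j ∈ J, ∀ k ∈ K, gJ j ≠ gK k := by
      intro j hj k hk h
      have := hf.inj
      grind [Function.Injective]
    have Jo : ∀ j ∈ J, ∀ k, k ∉ J → k ∉ K → gJ j ≠ f k := by
      intro j hj k h1 h2 h
      have := hf.inj
      grind [Function.Injective]
    have Ko : ∀ j ∈ K, ∀ k, k ∉ J → k ∉ K → gK j ≠ f k := by
      intro j hj k h1 h2 h
      have := hf.inj
      grind [Function.Injective]
    intro j k hjk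
    by_cases hj : j ∈ J
    · by_cases hk : k ∈ J
      · rw [eJ j hj, eJ k hk] at hjk; exact gJi hj hk hjk
      · by_cases hk' : k ∈ K
        · rw [eJ j hj, eK k hk'] at hjk; exact absurd hjk (JK j hj k hk')
        · rw [eJ j hj, eo k hk hk'] at hjk; exact absurd hjk (Jo j hj k hk hk')
    · by_cases hj' : j ∈ K
      · by_cases hk : k ∈ J
        · rw [eK j hj', eJ k hk] at hjk; exact absurd hjk.symm (JK k hk j hj')
        · by_cases hk' : k ∈ K
          · rw [eK j hj', eK k hk'] at hjk; exact gKi hj' hk' hjk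
          · rw [eK j hj', eo k hk hk'] at hjk; exact absurd hjk (Ko j hj' k hk hk')
      · by_cases hk : k ∈ J
        · rw [eo j hj hj', eJ k hk] at hjk; exact absurd hjk.symm (Jo k hk j hj hj')
        · by_cases hk' : k ∈ K
          · rw [eo j hj hj', eK k hk'] at hjk; exact absurd hjk.symm (Ko k hk' j hj hj')
          · rw [eo j hj hj', eo k hk hk'] at hjk; exact hf.inj hjk
  · intro j k tj tk
    have jK : j ∉ K := fun h => topK j h tj
    have kK : k ∉ K := fun h => topK k h tk
    by_cases hj : j ∈ J <;> by_cases hk : k ∈ J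
    · rw [eJ j hj, eJ k hk]; exact gJp j hj k hk
    · rw [eJ j hj, eo k hk kK]
      have z1 := hJ' j hj
      have z2 := hJτ j hj
      have z3 := hf.tr k k₀ tk tk₀
      have z4 := hf.tt j k tj tk
      have z5 := hf.tt j₀ k tj₀ tk
      have z6 := mt (memJ k).2 hk
      have z7 := Xne (hne tk tk₀)
      have z9 : c.Y (f j) ≠ c.Y (f k) := Yne (fun e => hk (e ▸ hj))
      have z10 := c.X_ne (f k₀) k tk
      simp only [Wraps, Btw] at z3 z4 z5 z6 ⊢
      clear * - z1 z2 z3 z4 z5 z6 z7 z9 z10 w1 w2 w3 w4 tj tk tj₀ tk₀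
      grind
    · rw [eJ k hk, eo j hj jK]
      have z1 := hJ' k hk
      have z2 := hJτ k hk
      have z3 := hf.tr j k₀ tj tk₀
      have z6 := mt (memJ j).2 hj
      have z7 := Xne (hne tj tk₀)
      have z8 := c.Y_ne (f j) k₀ tk₀
      simp only [Wraps, Btw] at z3 z6 ⊢
      clear * - z1 z2 z3 z6 z7 z8 w1 w2 w3 w4 tj tk tj₀ tk₀
      grind
    · rw [eo j hj jK, eo k hk kK]; exact hf.tt j k tj tk
  · intro j k tj tk
    have jJ : j ∉ J := fun h => tj (topJ j h)
    have kJ : k ∉ J := fun h => tk (topJ k h)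
    by_cases hj : j ∈ K <;> by_cases hk : k ∈ K
    · rw [eK j hj, eK k hk]; exact gKp j hj k hk
    · rw [eK j hj, eo k kJ hk]
      have z1 := hK' j hj
      have z2 := hKτ j hj
      have z3 := hf.tr j₀ k tj₀ tk
      have z4 := hf.rr j k tj tk
      have z5 := hf.rr k₀ k tk₀ tk
      have z6 := mt (memK k).2 hk
      have z7 : c.X (f j) ≠ c.X (f k) := Xne (fun e => hk (e ▸ hj))
      have z8 := c.Y_ne (f k) k₀ tk₀
      have z9 := c.X_ne (f k) j₀ tj₀
      have z10 : c.X (f k) ≠ c.X (f j₀) := Xne (hne tj₀ tk).symm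
      have z11 : c.Y (f k) ≠ c.Y (f j₀) := Yne (hne tj₀ tk).symm
      have z12 := c.Y_ne (f j₀) k tk
      have z13 : c.τ k ≠ c.τ k₀ := fun e => hk (by rw [c.right_inj k k₀ tk tk₀ e]; exact k₀K)
      simp only [Btw] at z3 z4 z5 z6 ⊢
      clear * - z1 z2 z3 z4 z5 z6 z7 z8 z9 z10 z11 z12 z13 w1 w2 w3 w4 tj tk tj₀ tk₀
      grind
    · rw [eK k hk, eo j jJ hj]
      have z1 := hK' k hk
      have z2 := hKτ k hk
      have z5 := hf.rr j k₀ tj tk₀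
      have z6 := mt (memK j).2 hj
      have z7 : c.X (f j) ≠ c.X (f k₀) := Xne (fun e => hj (e ▸ k₀K))
      simp only [Btw] at z5 z6 ⊢
      clear * - z1 z2 z5 z6 z7 w1 w2 w3 w4 tj tk tj₀ tk₀
      grind
    · rw [eo j jJ hj, eo k kJ hk]; exact hf.rr j k tj tk
  · intro j k tj tk
    have jK : j ∉ K := fun h => topK j h tj
    have kJ : k ∉ J := fun h => tk (topJ k h)
    by_cases hj : j ∈ J <;> by_cases hk : k ∈ K
    · rw [eJ j hj, eK k hk]
      have z1 := hJ' j hj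
      have z2 := hK' k hk
      have z3 := hKτ k hk
      simp only [Btw]
      clear * - z1 z2 z3 w1 w2 w3 w4 tj tk tj₀ tk₀
      grind
    · rw [eJ j hj, eo k kJ hk]
      have z1 := hJ' j hj
      have z2 := hJτ j hj
      have z3 := hf.tr j₀ k tj₀ tk
      have z4 := hf.rr k₀ k tk₀ tk
      have z5 := hkmax' k j₀
      have z6 : c.τ k ≠ c.τ k₀ := fun e => hk (by rw [c.right_inj k k₀ tk tk₀ e]; exact k₀K)
      have z7 := c.Y_ne (f j₀) k tk
      have z8 : c.X (f k) ≠ c.X (f j₀) := Xne (hne tj₀ tk).symm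
      simp only [Wraps, Btw] at z3 z4 z5 ⊢
      clear * - z1 z2 z3 z4 z5 z6 z7 z8 w1 w2 w3 w4 tj tk tj₀ tk₀
      grind
    · rw [eo j hj jK, eK k hk]
      have z1 := hK' k hk
      have z2 := hKτ k hk
      have z3 := hf.tr j k₀ tj tk₀
      have z4 := hjmin j
      have z5 := c.Y_ne (f j) k₀ tk₀
      have z6 := Xne (hne tj tk₀)
      have z7 := c.X_ne (f k₀) j tj
      simp only [Wraps, Btw] at z3 z4 ⊢
      clear * - z1 z2 z3 z4 z5 z6 z7 w1 w2 w3 w4 tj tk tj₀ tk₀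
      grind
    · rw [eo j hj jK, eo k kJ hk]; exact hf.tr j k tj tk
  · have disj : Disjoint J K := Finset.disjoint_left.2 JnK
    have split : ∀ F : Fin m → ℝ, ∑ j, F j = ∑ j ∈ J, F j + ∑ j ∈ K, F j +
        ∑ j ∈ Finset.univ \ (J ∪ K), F j := fun F => by
      rw [← Finset.sum_union disj, add_comm, Finset.sum_sdiff (Finset.subset_univ _)]
    have key : ∀ g : Fin m → Fin n, c.pot g = ∑ j ∈ J, (c.Y (g j) - c.X (g j)) +
        ∑ j ∈ K, (c.X (g j) - c.Y (g j)) + ∑ j ∈ Finset.univ \ (J ∪ K),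
          if c.top j then c.Y (g j) - c.X (g j) else c.X (g j) - c.Y (g j) := fun g => by
      rw [pot, split]
      congr 2
      · exact Finset.sum_congr rfl fun j hj => if_pos (topJ j hj)
      · exact Finset.sum_congr rfl fun j hj => if_neg (topK j hj)
    have e1 : ∑ j ∈ J, (c.Y (f' j) - c.X (f' j)) = ∑ j ∈ J, (c.Y (gJ j) - c.X (gJ j)) :=
      Finset.sum_congr rfl fun j hj => by rw [eJ j hj]
    have e2 : ∑ j ∈ K, (c.X (f' j) - c.Y (f' j)) = ∑ j ∈ K, (c.X (gK j) - c.Y (gK j)) :=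
      Finset.sum_congr rfl fun j hj => by rw [eK j hj]
    have e3 : (∑ j ∈ Finset.univ \ (J ∪ K),
        if c.top j then c.Y (f' j) - c.X (f' j) else c.X (f' j) - c.Y (f' j)) =
        ∑ j ∈ Finset.univ \ (J ∪ K),
        if c.top j then c.Y (f j) - c.X (f j) else c.X (f j) - c.Y (f j) :=
      Finset.sum_congr rfl fun j hj => by
        simp only [Finset.mem_sdiff, Finset.mem_union, not_or] at hj
        rw [eo j hj.2.1 hj.2.2]
    rw [key f', key f, e1, e2, e3,
      sum_exchange (fun s => c.Y s - c.X s) hf.inj.injOn gJi pJ q_notJ gJim,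
      sum_exchange (fun s => c.X s - c.Y s) hf.inj.injOn gKi qK p_notK gKim]
    linarith

/-- A solvable instance has a planar solution in which every right leader lies to the right of and
below every top leader, so that a monotone curve separates the two kinds. -/
theorem exists_separated (c : Cfg n m) (h : ∃ f, c.Planar f) :
    ∃ f, c.Planar f ∧ ∀ j k, c.top j → ¬ c.top k →
      (max (c.X (f j)) (c.τ j) < c.X (f k) ∨ max (c.Y (f k)) (c.τ k) < c.Y (f j)) := by
  classical
  obtain ⟨f, hf, hmax⟩ := Finset.exists_max_image (Finset.univ.filter c.Planar) c.pot
    (by obtain ⟨f, hf⟩ := h; exact ⟨f, by simpa using hf⟩)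
  simp only [Finset.mem_filter, Finset.mem_univ, true_and] at hf hmax
  refine ⟨f, hf, fun j k hj hk => ?_⟩
  by_contra hcon
  have hjk : j ≠ k := fun e => hk (e ▸ hj)
  have h1 : c.X (f j) ≠ c.X (f k) := fun h => hjk (hf.inj (c.X_inj h))
  have h2 : c.Y (f j) ≠ c.Y (f k) := fun h => hjk (hf.inj (c.Y_inj h))
  have h3 := c.X_ne (f k) j hj
  have h4 := c.Y_ne (f j) k hk
  have h5 := hf.tr j k hj hk
  have h6 : c.Wraps f k j ∨ c.mirror.Wraps f j k := by
    simp only [Wraps, mirror, Btw, max_lt_iff] at *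
    grind
  rcases h6 with h6 | h6
  · obtain ⟨f', h7, h8⟩ := c.exists_pot_lt f hf ⟨k, j, h6⟩
    exact absurd (hmax f' h7) (not_le.2 h8)
  · obtain ⟨f', h7, h8⟩ := c.mirror.exists_pot_lt f hf.mirror ⟨j, k, h6⟩
    rw [pot_mirror, pot_mirror] at h8
    exact absurd (hmax f' (planar_mirror_iff.1 h7)) (not_le.2 h8)

end Cfg

end BoundaryLabeling

/-! ### Ranks and separating curves -/

namespace BoundaryLabeling

section Rank

variable {n : ℕ}

open Classical in
/-- The number of sites whose coordinate `v` is smaller than `a`. -/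
noncomputable def gap (v : Fin n → ℝ) (a : ℝ) : ℕ := (Finset.univ.filter fun i => v i < a).card

/-- The rank of a site with respect to the coordinate `v`. -/
noncomputable def rk (v : Fin n → ℝ) (i : Fin n) : ℕ := gap v (v i)

theorem gap_mono (v : Fin n → ℝ) {a b : ℝ} (h : a ≤ b) : gap v a ≤ gap v b := by
  classical
  exact Finset.card_le_card fun i hi => by
    simp only [Finset.mem_filter, Finset.mem_univ, true_and] at hi ⊢; linarith

theorem gap_le (v : Fin n → ℝ) (a : ℝ) : gap v a ≤ n := by
  classical
  exact (Finset.card_le_univ _).trans (by simp)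

theorem rk_lt_gap_iff {v : Fin n → ℝ} {i : Fin n} {a : ℝ} : rk v i < gap v a ↔ v i < a := by
  classical
  constructor
  · intro h
    by_contra h'
    exact absurd (gap_mono v (not_lt.1 h')) (not_le.2 h)
  · intro h
    unfold rk gap
    refine Finset.card_lt_card ((Finset.ssubset_iff_of_subset fun k hk => ?_).2 ⟨i, ?_, ?_⟩)
    · simp only [Finset.mem_filter, Finset.mem_univ, true_and] at hk ⊢; linarith
    · simpa using h
    · simp

theorem rk_lt_rk_iff {v : Fin n → ℝ} {i j : Fin n} : rk v i < rk v j ↔ v i < v j := rk_lt_gap_iff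

theorem rk_le_rk_iff {v : Fin n → ℝ} {i j : Fin n} : rk v i ≤ rk v j ↔ v i ≤ v j := by
  rw [← not_lt, rk_lt_rk_iff, not_lt]

theorem rk_lt (v : Fin n → ℝ) (i : Fin n) : rk v i < n := by
  classical
  refine (Finset.card_lt_card (Finset.filter_ssubset.2 ⟨i, Finset.mem_univ _, ?_⟩)).trans_le
    (by simp)
  simp

theorem rk_injective {v : Fin n → ℝ} (hv : Function.Injective v) : Function.Injective (rk v) := by
  intro i j h
  have h1 := rk_le_rk_iff.1 h.le
  have h2 := rk_le_rk_iff.1 h.ge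
  exact hv (le_antisymm h1 h2)

theorem exists_rk_eq {v : Fin n → ℝ} (hv : Function.Injective v) {k : ℕ} (hk : k < n) :
    ∃ i, rk v i = k := by
  have h1 : Function.Injective fun i => (⟨rk v i, rk_lt v i⟩ : Fin n) := fun i j h =>
    rk_injective hv (Fin.mk.inj_iff.1 h)
  obtain ⟨i, hi⟩ := (Finite.injective_iff_surjective.1 h1) ⟨k, hk⟩
  exact ⟨i, Fin.mk.inj_iff.1 hi⟩

end Rank

namespace Cfg

variable {n m : ℕ}

open Classical in
/-- The number of top ports to the right of the site of `x`-rank `k`. -/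
noncomputable def tc (c : Cfg n m) (k : ℕ) : ℕ :=
  (Finset.univ.filter fun j => c.top j ∧ ∃ i, rk c.X i = k ∧ c.X i < c.τ j).card

/-- The number of right ports above the site of `y`-rank `k`. -/
noncomputable def rc (c : Cfg n m) (k : ℕ) : ℕ := c.mirror.tc k

open Classical in
theorem rc_eq (c : Cfg n m) (y : ℕ) : c.rc y =
    (Finset.univ.filter fun j => ¬ c.top j ∧ ∃ i, rk c.Y i = y ∧ c.Y i < c.τ j).card := by
  unfold rc tc
  congr

open Classical in
/-- The number of top labels. -/
noncomputable def nT (c : Cfg n m) : ℕ := (Finset.univ.filter fun j => c.top j).card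

/-- The site lies above the curve whose height at the site of `x`-rank `k` is just below the site
of `y`-rank `h k`. -/
def Above (c : Cfg n m) (h : ℕ → ℕ) (i : Fin n) : Prop := h (rk c.X i) ≤ rk c.Y i

open Classical in
/-- The number of sites of `x`-rank at least `k` above the curve. -/
noncomputable def up (c : Cfg n m) (h : ℕ → ℕ) (k : ℕ) : ℕ :=
  (Finset.univ.filter fun i => k ≤ rk c.X i ∧ c.Above h i).card

open Classical in
/-- The number of sites with `x`-rank in `[j, k)` and `y`-rank at least `y`. -/
noncomputable def box (c : Cfg n m) (j k y : ℕ) : ℕ :=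
  (Finset.univ.filter fun i => j ≤ rk c.X i ∧ rk c.X i < k ∧ y ≤ rk c.Y i).card

/-- A monotone curve that leaves enough sites above it for the top labels and enough sites below it
for the right labels, also in the parts of the rectangle where the curve forces labels to be
served.  Heights are given by `y`-ranks, and `h k` is the height from the site of `x`-rank `k`
(inclusive) to the next one.  By `a`, for every column `k` there is a site of rank `j` such that the
top ports to the right of it do not outnumber the sites that are not to the left of it and above
both the curve and the row `h k`; `b` is the analogous condition for the right ports and the sites below the curve and to
the right of column `k`. -/
structure Curve (c : Cfg n m) (h : ℕ → ℕ) : Prop where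
  le : ∀ k < n, h k ≤ n
  mono : ∀ k l, k ≤ l → l < n → h k ≤ h l
  a : ∀ k < n, ∃ j ≤ k, c.tc j ≤ c.up h k + c.box j k (h k)
  b : ∀ k < n, ∃ y ≤ h k, c.rc y + c.up h (k + 1) ≤ c.box (k + 1) n y
  t : c.nT ≤ c.up h 0
  r : m + c.up h 0 ≤ n + c.nT

/-- A solvable configuration has a separating curve: the boundary of the region to the upper left of
the top leaders of a separated solution. -/
theorem Planar.exists_curve {c : Cfg n m} (hc : ∃ f, c.Planar f) : ∃ h, c.Curve h := by
  classical
  obtain ⟨f, hf, sep⟩ := c.exists_separated hc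
  set S : ℕ → Set ℕ := fun k => {r | r = n ∨ ∃ j i, c.top j ∧ rk c.X i = k ∧
    c.X i ≤ max (c.X (f j)) (c.τ j) ∧ r = rk c.Y (f j)} with hS
  have hSn : ∀ k, n ∈ S k := fun k => .inl rfl
  set h : ℕ → ℕ := fun k => sInf (S k) with hh
  have hle : ∀ k, h k ≤ n := fun k => Nat.sInf_le (hSn k)
  have hle' : ∀ j i, c.top j → c.X i ≤ max (c.X (f j)) (c.τ j) → h (rk c.X i) ≤ rk c.Y (f j) :=
    fun j i h1 h2 => Nat.sInf_le (.inr ⟨j, i, h1, rfl, h2, rfl⟩)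
  have hmem : ∀ k, h k ∈ S k := fun k => Nat.sInf_mem ⟨n, hSn k⟩
  have hmono : ∀ k l, k ≤ l → l < n → h k ≤ h l := by
    intro k l hkl hl
    rcases hmem l with h1 | ⟨j, i, h1, h2, h3, h4⟩
    · rw [h1]; exact hle k
    · obtain ⟨i', hi'⟩ := exists_rk_eq c.X_inj (hkl.trans_lt hl)
      rw [h4, ← hi']
      refine hle' j i' h1 (le_trans (rk_le_rk_iff.1 ?_) h3)
      omega
  have topAbove : ∀ j, c.top j → c.Above h (f j) := fun j hj => hle' j (f j) hj (le_max_left _ _)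
  -- A right leader that starts at or to the left of a column stays below the curve there.
  have rightBelow : ∀ q i, ¬ c.top q → c.X (f q) ≤ c.X i →
      rk c.Y (f q) < h (rk c.X i) ∧ gap c.Y (c.τ q) ≤ h (rk c.X i) := by
    intro q i hq hi
    rcases hmem (rk c.X i) with h1 | ⟨j, i', h1, h2, h3, h4⟩
    · rw [h1]; exact ⟨rk_lt _ _, gap_le _ _⟩
    · obtain rfl := rk_injective c.X_inj h2
      rw [h4]
      have h5 : max (c.Y (f q)) (c.τ q) < c.Y (f j) := by
        rcases sep j q h1 hq with h5 | h5
        · linarith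
        · exact h5
      exact ⟨rk_lt_rk_iff.2 (lt_of_le_of_lt (le_max_left _ _) h5),
        gap_mono _ (lt_of_le_of_lt (le_max_right _ _) h5).le⟩
  refine ⟨h, fun k _ => hle k, hmono, ?_, ?_, ?_, ?_⟩
  · intro k hk
    obtain ⟨i₀, hi₀⟩ := exists_rk_eq c.X_inj hk
    -- It suffices to find a threshold beyond which all ports are served by sites above row `h k`.
    have key : ∀ j₁ ≤ k, (∀ j, c.top j → (∃ i, rk c.X i = j₁ ∧ c.X i < c.τ j) →
        j₁ ≤ rk c.X (f j) ∧ h k ≤ rk c.Y (f j)) → c.tc j₁ ≤ c.up h k + c.box j₁ k (h k) := by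
      intro j₁ _ H
      refine le_trans ?_ (Finset.card_union_le _ _)
      refine Finset.card_le_card_of_injOn f ?_ hf.inj.injOn
      intro j hj
      simp only [Finset.coe_filter, Finset.mem_univ, true_and, Set.mem_ofPred_eq] at hj
      simp only [Finset.coe_union, Finset.coe_filter, Finset.mem_univ, true_and, Set.mem_union,
        Set.mem_ofPred_eq]
      obtain ⟨h1, h2⟩ := H j hj.1 hj.2
      by_cases h3 : k ≤ rk c.X (f j)
      · exact .inl ⟨h3, topAbove j hj.1⟩
      · exact .inr ⟨h1, not_le.1 h3, h2⟩
    by_cases hlow : ∃ l, c.top l ∧ rk c.Y (f l) < h k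
    · obtain ⟨l, hl, hmax⟩ := Finset.exists_max_image
        (Finset.univ.filter fun l => c.top l ∧ rk c.Y (f l) < h k) c.τ
        (by obtain ⟨l, hl⟩ := hlow; exact ⟨l, by simpa using hl⟩)
      simp only [Finset.mem_filter, Finset.mem_univ, true_and] at hl hmax
      have h1 : max (c.X (f l)) (c.τ l) < c.X i₀ := by
        by_contra h1
        have := hle' l i₀ hl.1 (not_lt.1 h1)
        rw [hi₀] at this
        omega
      have h2 : gap c.X (c.τ l) ≤ k := by
        rw [← hi₀]; exact gap_mono _ (lt_of_le_of_lt (le_max_right _ _) h1).le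
      refine ⟨gap c.X (c.τ l), h2, key _ h2 ?_⟩
      rintro j hj ⟨i, h3, h4⟩
      have h5 : c.τ l < c.τ j := by
        have : ¬ c.X i < c.τ l := fun h' => by
          have := rk_lt_gap_iff.2 h'; omega
        linarith
      have h6 : h k ≤ rk c.Y (f j) := by
        by_contra h6
        have := hmax j ⟨hj, not_le.1 h6⟩
        linarith
      refine ⟨?_, h6⟩
      by_contra h7
      have h8 : c.X (f j) < c.τ l := rk_lt_gap_iff.1 (not_le.1 h7)
      exact hf.tt l j hl.1 hj ⟨rk_lt_rk_iff.1 (hl.2.trans_le h6), .inl ⟨h8, h5⟩⟩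
    · push Not at hlow
      exact ⟨0, Nat.zero_le _, key 0 (Nat.zero_le _) fun j hj _ => ⟨Nat.zero_le _, hlow j hj⟩⟩
  · intro k hk
    obtain ⟨i₀, hi₀⟩ := exists_rk_eq c.X_inj hk
    have key : ∀ y ≤ h k, (∀ q, ¬ c.top q → (∃ i, rk c.Y i = y ∧ c.Y i < c.τ q) →
        k + 1 ≤ rk c.X (f q) ∧ y ≤ rk c.Y (f q)) →
        c.rc y + c.up h (k + 1) ≤ c.box (k + 1) n y := by
      intro y hy H
      have e : c.rc y = ((Finset.univ.filter fun q => ¬ c.top q ∧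
          ∃ i, rk c.Y i = y ∧ c.Y i < c.τ q).image f).card := by
        rw [Finset.card_image_of_injective _ hf.inj, rc_eq]
      rw [e, up, ← Finset.card_union_of_disjoint]
      · refine Finset.card_le_card fun i hi => ?_
        simp only [Finset.mem_union, Finset.mem_image, Finset.mem_filter, Finset.mem_univ,
          true_and] at hi ⊢
        rcases hi with ⟨q, hq, rfl⟩ | ⟨h1, h2⟩
        · obtain ⟨h1, h2⟩ := H q hq.1 hq.2
          exact ⟨h1, rk_lt _ _, h2⟩
        · have := hmono k (rk c.X i) (by omega) (rk_lt _ _)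
          have h3 : h (rk c.X i) ≤ rk c.Y i := h2
          exact ⟨h1, rk_lt _ _, by omega⟩
      · rw [Finset.disjoint_left]
        intro i hi hi'
        simp only [Finset.mem_image, Finset.mem_filter, Finset.mem_univ, true_and] at hi hi'
        obtain ⟨q, hq, rfl⟩ := hi
        have h1 := (rightBelow q (f q) hq.1 le_rfl).1
        have h2 : h (rk c.X (f q)) ≤ rk c.Y (f q) := hi'.2
        omega
    by_cases hleft : ∃ l, ¬ c.top l ∧ c.X (f l) ≤ c.X i₀
    · obtain ⟨l, hl, hmax⟩ := Finset.exists_max_image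
        (Finset.univ.filter fun l => ¬ c.top l ∧ c.X (f l) ≤ c.X i₀) c.τ
        (by obtain ⟨l, hl⟩ := hleft; exact ⟨l, by simpa using hl⟩)
      simp only [Finset.mem_filter, Finset.mem_univ, true_and] at hl hmax
      have h2 : gap c.Y (c.τ l) ≤ h k := by
        rw [← hi₀]; exact (rightBelow l i₀ hl.1 hl.2).2
      refine ⟨gap c.Y (c.τ l), h2, key _ h2 ?_⟩
      rintro q hq ⟨i, h3, h4⟩
      have h5 : c.τ l < c.τ q := by
        have : ¬ c.Y i < c.τ l := fun h' => by
          have := rk_lt_gap_iff.2 h'; omega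
        linarith
      have h6 : c.X i₀ < c.X (f q) := by
        by_contra h6
        have := hmax q ⟨hq, not_lt.1 h6⟩
        linarith
      refine ⟨?_, ?_⟩
      · have := rk_lt_rk_iff.2 h6; omega
      by_contra h7
      have h8 : c.Y (f q) < c.τ l := rk_lt_gap_iff.1 (not_le.1 h7)
      exact hf.rr l q hl.1 hq ⟨lt_of_le_of_lt hl.2 h6, .inl ⟨h8, h5⟩⟩
    · push Not at hleft
      refine ⟨0, Nat.zero_le _, key 0 (Nat.zero_le _) fun q hq _ => ⟨?_, Nat.zero_le _⟩⟩
      have := rk_lt_rk_iff.2 (hleft q hq); omega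
  · refine Finset.card_le_card_of_injOn f ?_ hf.inj.injOn
    intro j hj
    simp only [Finset.coe_filter, Finset.mem_univ, true_and, Set.mem_ofPred_eq] at hj ⊢
    exact ⟨Nat.zero_le _, topAbove j hj⟩
  · have e1 : (Finset.univ.filter fun j => ¬ c.top j).card ≤
        (Finset.univ.filter fun i => ¬ c.Above h i).card := by
      refine Finset.card_le_card_of_injOn f ?_ hf.inj.injOn
      intro j hj
      simp only [Finset.coe_filter, Finset.mem_univ, true_and, Set.mem_ofPred_eq] at hj ⊢
      exact not_le.2 (rightBelow j (f j) hj le_rfl).1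
    have e2 := Finset.card_filter_add_card_filter_not (s := Finset.univ) (fun j => c.top j)
    have e3 := Finset.card_filter_add_card_filter_not (s := Finset.univ) (fun i => c.Above h i)
    simp only [Finset.card_univ, Fintype.card_fin] at e2 e3
    simp only [nT, up, Nat.zero_le, true_and]
    omega

end Cfg

/-! ### Greedy assignment to one side -/

section Greedy

variable {n m : ℕ}

open Classical in
/-- Invariant of the greedy assignment of the sites `S`, in the order of decreasing `prio`, to the
ports `P` of one side; `o j` is the site that has been assigned to the port `j`, and the sites of
priority at least `θ` have been processed.  By `count`, the sites of priority at least `θ'` fill up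
the ports beyond any position `x`, unless there are too few such sites beyond `x`, in which case
they fill at least as many of these ports as their number. -/
structure GreedyInv (prio : Fin n → ℕ) (ξ : Fin n → ℝ) (τ : Fin m → ℝ) (S : Fin n → Prop)
    (P : Fin m → Prop) (θ : ℕ) (o : Fin m → Option (Fin n)) : Prop where
  mem : ∀ j i, o j = some i → P j ∧ S i ∧ θ ≤ prio i
  inj : ∀ j k i, o j = some i → o k = some i → j = k
  noncross : ∀ j k i, o j = some i → P k →
    (o k = none ∨ ∃ i', o k = some i' ∧ prio i' < prio i) → ¬ Btw (τ k) (ξ i) (τ j)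
  count : ∀ θ' ≥ θ, ∀ x, (∀ j, P j → x < τ j → ∃ i, o j = some i ∧ θ' ≤ prio i) ∨
    (Finset.univ.filter fun i => S i ∧ θ' ≤ prio i ∧ x ≤ ξ i).card ≤
    (Finset.univ.filter fun j => P j ∧ x < τ j ∧ ∃ i, o j = some i ∧ θ' ≤ prio i).card

/-- The port `b` is the best free port for a site at position `x`: the nearest one to the right, or
the nearest one to the left if there is none to the right. -/
def Best (τ : Fin m → ℝ) (P : Fin m → Prop) (o : Fin m → Option (Fin n)) (x : ℝ) (b : Fin m) :
    Prop :=
  P b ∧ o b = none ∧ ∀ k, P k → o k = none →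
    (x < τ b ∧ (x < τ k → τ b ≤ τ k)) ∨ (τ b ≤ x ∧ τ k ≤ τ b)

variable {prio : Fin n → ℕ} {ξ : Fin n → ℝ} {τ : Fin m → ℝ} {S : Fin n → Prop} {P : Fin m → Prop}
  {θ : ℕ} {o : Fin m → Option (Fin n)}

theorem GreedyInv.start (hprio : ∀ i, prio i < n) :
    GreedyInv prio ξ τ S P n (fun _ => none) := by
  classical
  refine ⟨by simp, by simp, by simp, fun θ' hθ x => .inr ?_⟩
  rw [Finset.filter_false_of_mem]
  · simp
  · rintro i - ⟨-, h, -⟩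
    have := hprio i
    omega

/-- A site that is not to be assigned, or for which no port is left, is skipped. -/
theorem GreedyInv.skip (h : GreedyInv prio ξ τ S P (θ + 1) o) {s : Fin n} (hs : prio s = θ)
    (hprio : Function.Injective prio) (hskip : ¬ S s ∨ ∀ j, P j → o j ≠ none) :
    GreedyInv prio ξ τ S P θ o := by
  classical
  refine ⟨fun j i hj => ?_, h.inj, h.noncross, fun θ' hθ x => ?_⟩
  · obtain ⟨h1, h2, h3⟩ := h.mem j i hj
    exact ⟨h1, h2, by omega⟩
  · rcases Nat.lt_or_ge θ θ' with h1 | h1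
    · exact h.count θ' h1 x
    obtain rfl : θ' = θ := by omega
    rcases hskip with h2 | h2
    · rcases h.count (θ' + 1) le_rfl x with h3 | h3
      · refine .inl fun j hj hx => ?_
        obtain ⟨i, h4, h5⟩ := h3 j hj hx
        exact ⟨i, h4, by omega⟩
      · refine .inr ((Finset.card_le_card fun i hi => ?_).trans
          (h3.trans (Finset.card_le_card fun j hj => ?_)))
        · simp only [Finset.mem_filter, Finset.mem_univ, true_and] at hi ⊢
          have : prio i ≠ θ' := fun e => h2 (hprio (hs.trans e.symm) ▸ hi.1)
          exact ⟨hi.1, by omega, hi.2.2⟩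
        · simp only [Finset.mem_filter, Finset.mem_univ, true_and] at hj ⊢
          obtain ⟨h4, h5, i, h6, h7⟩ := hj
          exact ⟨h4, h5, i, h6, by omega⟩
    · refine .inl fun j hj _ => ?_
      obtain ⟨i, hi⟩ := Option.ne_none_iff_exists'.1 (h2 j hj)
      exact ⟨i, hi, by have := (h.mem j i hi).2.2; omega⟩

/-- A site is assigned to the best free port. -/
theorem GreedyInv.assign (h : GreedyInv prio ξ τ S P (θ + 1) o) {s : Fin n} (hs : prio s = θ)
    (hprio : Function.Injective prio) (hS : S s) {b : Fin m} (hb : Best τ P o (ξ s) b) :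
    GreedyInv prio ξ τ S P θ (Function.update o b (some s)) := by
  classical
  obtain ⟨hPb, hob, hbest⟩ := hb
  have upd : ∀ j i, Function.update o b (some s) j = some i ↔
      (j = b ∧ i = s) ∨ (j ≠ b ∧ o j = some i) := by
    intro j i
    by_cases hj : j = b
    · subst hj; simp [eq_comm]
    · simp [hj]
  have updn : ∀ j, Function.update o b (some s) j = none ↔ j ≠ b ∧ o j = none := by
    intro j
    by_cases hj : j = b
    · subst hj; simp
    · simp [hj]
  refine ⟨fun j i hj => ?_, fun j k i hj hk => ?_, fun j k i hj hk hlow => ?_,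
    fun θ' hθ x => ?_⟩
  · rcases (upd j i).1 hj with ⟨rfl, rfl⟩ | ⟨-, hj⟩
    · exact ⟨hPb, hS, hs.ge⟩
    · obtain ⟨h1, h2, h3⟩ := h.mem j i hj
      exact ⟨h1, h2, by omega⟩
  · have hn : ∀ j, o j ≠ some s := fun j hj => by have := (h.mem j s hj).2.2; omega
    rcases (upd j i).1 hj with ⟨rfl, rfl⟩ | ⟨_, hj⟩ <;> rcases (upd k i).1 hk with ⟨h1, h2⟩ | ⟨_, hk⟩
    · exact h1.symm
    · exact absurd hk (hn k)
    · exact absurd (h2 ▸ hj) (hn j)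
    · exact h.inj j k i hj hk
  · rcases (upd j i).1 hj with ⟨rfl, rfl⟩ | ⟨hjb, hj⟩
    · have hko : o k = none ∨ k = j := by
        rcases hlow with h1 | ⟨i', h1, h2⟩
        · exact .inl ((updn k).1 h1).2
        · rcases (upd k i').1 h1 with ⟨rfl, rfl⟩ | ⟨_, h3⟩
          · exact .inr rfl
          · have := (h.mem k i' h3).2.2; omega
      rcases hko with hko | rfl
      · have := hbest k hk hko
        simp only [Btw]
        rintro (h1 | h1) <;> rcases this with h2 | h2
        · linarith [h2.2 h1.1]
        · linarith
        · linarith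
        · linarith
      · simp [Btw]
    · refine h.noncross j k i hj hk ?_
      rcases hlow with h1 | ⟨i', h1, h2⟩
      · exact .inl ((updn k).1 h1).2
      · rcases (upd k i').1 h1 with ⟨rfl, rfl⟩ | ⟨_, h3⟩
        · exact .inl hob
        · exact .inr ⟨i', h3, h2⟩
  · have keep : ∀ j i, o j = some i → Function.update o b (some s) j = some i := fun j i hj =>
      (upd j i).2 (.inr ⟨fun e => by rw [e, hob] at hj; simp at hj, hj⟩)
    rcases Nat.lt_or_ge θ θ' with h1 | h1
    · rcases h.count θ' h1 x with h2 | h2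
      · refine .inl fun j hj hx => ?_
        obtain ⟨i, h3, h4⟩ := h2 j hj hx
        exact ⟨i, keep j i h3, h4⟩
      · refine .inr (h2.trans (Finset.card_le_card fun j hj => ?_))
        simp only [Finset.mem_filter, Finset.mem_univ, true_and] at hj ⊢
        obtain ⟨h4, h5, i, h6, h7⟩ := hj
        exact ⟨h4, h5, i, keep j i h6, h7⟩
    obtain rfl : θ' = θ := by omega
    by_cases hfree : ∃ k, P k ∧ o k = none ∧ x < τ k
    swap
    · refine .inl fun j hj hx => ?_
      have : o j ≠ none := fun e => hfree ⟨j, hj, e, hx⟩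
      obtain ⟨i, hi⟩ := Option.ne_none_iff_exists'.1 this
      exact ⟨i, keep j i hi, by have := (h.mem j i hi).2.2; omega⟩
    obtain ⟨k₀, hk₀, hk₀', hxk₀⟩ := hfree
    rcases h.count (θ' + 1) le_rfl x with h2 | h2
    · obtain ⟨i, h3, _⟩ := h2 k₀ hk₀ hxk₀
      rw [hk₀'] at h3; simp at h3
    right
    set A := Finset.univ.filter fun i => S i ∧ θ' + 1 ≤ prio i ∧ x ≤ ξ i with hA
    set B := Finset.univ.filter fun j => P j ∧ x < τ j ∧ ∃ i, o j = some i ∧ θ' + 1 ≤ prio i with hB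
    have hsub : B ⊆ (Finset.univ.filter fun j => P j ∧ x < τ j ∧
        ∃ i, Function.update o b (some s) j = some i ∧ θ' ≤ prio i) := fun j hj => by
      simp only [hB, Finset.mem_filter, Finset.mem_univ, true_and] at hj ⊢
      obtain ⟨h4, h5, i, h6, h7⟩ := hj
      exact ⟨h4, h5, i, keep j i h6, by omega⟩
    by_cases hxs : x ≤ ξ s
    · -- The port `b` lies beyond `x` as well.
      have hxb : x < τ b := by
        rcases hbest k₀ hk₀ hk₀' with h3 | h3 <;> linarith
      have e1 : (Finset.univ.filter fun i => S i ∧ θ' ≤ prio i ∧ x ≤ ξ i) ⊆ insert s A := by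
        intro i hi
        simp only [hA, Finset.mem_filter, Finset.mem_univ, true_and, Finset.mem_insert] at hi ⊢
        by_cases his : i = s
        · exact .inl his
        · have : prio i ≠ θ' := fun e => his (hprio (e.trans hs.symm))
          exact .inr ⟨hi.1, by omega, hi.2.2⟩
      have hbB : b ∉ B := by
        simp [hB, hob]
      have e2 : insert b B ⊆ (Finset.univ.filter fun j => P j ∧ x < τ j ∧
          ∃ i, Function.update o b (some s) j = some i ∧ θ' ≤ prio i) := by
        refine Finset.insert_subset ?_ hsub
        simp only [Finset.mem_filter, Finset.mem_univ, true_and]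
        exact ⟨hPb, hxb, s, by simp, hs.ge⟩
      have e3 := Finset.card_le_card e1
      have e4 := Finset.card_le_card e2
      have e5 := Finset.card_insert_le s A
      rw [Finset.card_insert_of_notMem hbB] at e4
      omega
    · refine le_trans (Finset.card_le_card fun i hi => ?_) (h2.trans (Finset.card_le_card hsub))
      simp only [hA, Finset.mem_filter, Finset.mem_univ, true_and] at hi ⊢
      have : prio i ≠ θ' := fun e => hxs (hprio (hs.trans e.symm) ▸ hi.2.2)
      exact ⟨hi.1, by omega, hi.2.2⟩

/-- The ports beyond `x` get sites of priority at least `θ'` if there are enough such sites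
beyond `x`. -/
theorem GreedyInv.assigned (h : GreedyInv prio ξ τ S P 0 o) {θ' : ℕ} {x : ℝ} {a b : ℕ}
    [DecidablePred fun j => P j ∧ x < τ j] [DecidablePred fun i => S i ∧ θ' ≤ prio i ∧ x ≤ ξ i]
    (ha : (Finset.univ.filter fun j => P j ∧ x < τ j).card ≤ a)
    (hb : b ≤ (Finset.univ.filter fun i => S i ∧ θ' ≤ prio i ∧ x ≤ ξ i).card) (hab : a ≤ b)
    {j : Fin m} (hj : P j) (hx : x < τ j) : ∃ i, o j = some i ∧ θ' ≤ prio i := by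
  classical
  rcases h.count θ' (Nat.zero_le _) x with h1 | h1
  · exact h1 j hj hx
  · have hsub : (Finset.univ.filter fun j => P j ∧ x < τ j ∧ ∃ i, o j = some i ∧ θ' ≤ prio i) ⊆
        Finset.univ.filter fun j => P j ∧ x < τ j := fun k hk => by
      simp only [Finset.mem_filter, Finset.mem_univ, true_and] at hk ⊢
      exact ⟨hk.1, hk.2.1⟩
    have h2 := Finset.eq_of_subset_of_card_le hsub (by
      refine le_trans ?_ h1
      convert ha.trans (hab.trans hb))
    have h3 : j ∈ Finset.univ.filter fun j => P j ∧ x < τ j := by simp [hj, hx]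
    rw [← h2] at h3
    simp only [Finset.mem_filter, Finset.mem_univ, true_and] at h3
    exact h3.2.2

end Greedy

/-- The greedy assignments on the two sides of a separating curve make up a planar solution: the
conditions on the curve keep the top leaders above it and the right leaders below it. -/
theorem Cfg.Curve.exists_planar {n m : ℕ} {c : Cfg n m} {h : ℕ → ℕ} (hc : c.Curve h)
    {oT oR : Fin m → Option (Fin n)}
    (hT : GreedyInv (rk c.Y) c.X c.τ (c.Above h) c.top 0 oT)
    (hR : GreedyInv (rk c.X) c.Y c.τ (fun i => ¬ c.Above h i) (fun j => ¬ c.top j) 0 oR) :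
    ∃ f, c.Planar f ∧ ∀ j, (c.top j → oT j = some (f j)) ∧ (¬ c.top j → oR j = some (f j)) := by
  classical
  -- A position before all sites and ports.
  obtain ⟨z, hz⟩ : ∃ z : ℝ, (∀ i, z ≤ c.X i ∧ z ≤ c.Y i) ∧ ∀ j, z < c.τ j := by
    obtain ⟨z₁, h1⟩ := (Set.finite_range c.X).bddBelow
    obtain ⟨z₂, h2⟩ := (Set.finite_range c.Y).bddBelow
    obtain ⟨z₃, h3⟩ := (Set.finite_range c.τ).bddBelow
    refine ⟨min (min z₁ z₂) (z₃ - 1), fun i => ⟨?_, ?_⟩, fun j => ?_⟩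
    · exact (min_le_left _ _).trans ((min_le_left _ _).trans (h1 ⟨i, rfl⟩))
    · exact (min_le_left _ _).trans ((min_le_right _ _).trans (h2 ⟨i, rfl⟩))
    · have := h3 ⟨j, rfl⟩
      exact lt_of_le_of_lt (min_le_right _ _) (by linarith)
  have top1 : ∀ j, c.top j → ∃ i, oT j = some i := by
    intro j hj
    obtain ⟨i, hi, _⟩ := hT.assigned (θ' := 0) (x := z) (a := c.nT) (b := c.up h 0)
      (Finset.card_le_card fun k hk => by
        simp only [Finset.mem_filter, Finset.mem_univ, true_and] at hk ⊢; exact hk.1)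
      (Finset.card_le_card fun k hk => by
        simp only [Finset.mem_filter, Finset.mem_univ, true_and] at hk ⊢
        exact ⟨hk.2, Nat.zero_le _, (hz.1 k).1⟩) hc.t hj (hz.2 j)
    exact ⟨i, hi⟩
  have right1 : ∀ j, ¬ c.top j → ∃ i, oR j = some i := by
    intro j hj
    have e2 := Finset.card_filter_add_card_filter_not (s := Finset.univ) (fun j => c.top j)
    have e3 := Finset.card_filter_add_card_filter_not (s := Finset.univ) (fun i => c.Above h i)
    have e4 := hc.r
    simp only [Finset.card_univ, Fintype.card_fin] at e2 e3
    simp only [nT, up, Nat.zero_le, true_and] at e4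
    obtain ⟨i, hi, _⟩ := hR.assigned (θ' := 0) (x := z)
      (a := (Finset.univ.filter fun j => ¬ c.top j).card)
      (b := (Finset.univ.filter fun i => ¬ c.Above h i).card)
      (Finset.card_le_card fun k hk => by
        simp only [Finset.mem_filter, Finset.mem_univ, true_and] at hk ⊢; exact hk.1)
      (Finset.card_le_card fun k hk => by
        simp only [Finset.mem_filter, Finset.mem_univ, true_and] at hk ⊢
        exact ⟨hk, Nat.zero_le _, (hz.1 k).2⟩) (by omega) hj (hz.2 j)
    exact ⟨i, hi⟩
  have ex : ∀ j, ∃ i, (c.top j → oT j = some i) ∧ (¬ c.top j → oR j = some i) := by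
    intro j
    by_cases hj : c.top j
    · obtain ⟨i, hi⟩ := top1 j hj
      exact ⟨i, fun _ => hi, fun h' => absurd hj h'⟩
    · obtain ⟨i, hi⟩ := right1 j hj
      exact ⟨i, fun h' => absurd h' hj, fun _ => hi⟩
  choose f hf using ex
  have fT : ∀ j, c.top j → oT j = some (f j) := fun j hj => (hf j).1 hj
  have fR : ∀ j, ¬ c.top j → oR j = some (f j) := fun j hj => (hf j).2 hj
  have aT : ∀ j, c.top j → h (rk c.X (f j)) ≤ rk c.Y (f j) := fun j hj =>
    (hT.mem j _ (fT j hj)).2.1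
  have aR : ∀ j, ¬ c.top j → rk c.Y (f j) < h (rk c.X (f j)) := fun j hj =>
    not_le.1 (hR.mem j _ (fR j hj)).2.1
  -- The vertical segment of a top leader stays above the curve.
  have bT : ∀ j i, c.top j → c.X i < c.τ j → h (rk c.X i) ≤ rk c.Y (f j) := by
    intro j i hj hi
    obtain ⟨j₁, h1, h2⟩ := hc.a (rk c.X i) (rk_lt _ _)
    obtain ⟨i₁, rfl⟩ := exists_rk_eq c.X_inj (h1.trans_lt (rk_lt _ _))
    obtain ⟨i', h3, h4⟩ := hT.assigned (θ' := h (rk c.X i)) (x := c.X i₁)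
      (a := c.tc (rk c.X i₁)) (b := c.up h (rk c.X i) + c.box (rk c.X i₁) (rk c.X i) (h (rk c.X i)))
      (Finset.card_le_card fun k hk => by
        simp only [Finset.mem_filter, Finset.mem_univ, true_and] at hk ⊢
        exact ⟨hk.1, i₁, rfl, hk.2⟩)
      (by
        rw [up, box, ← Finset.card_union_of_disjoint]
        · refine Finset.card_le_card fun k hk => ?_
          simp only [Finset.mem_union, Finset.mem_filter, Finset.mem_univ, true_and] at hk ⊢
          rcases hk with ⟨h5, h6⟩ | ⟨h5, h6, h7⟩
          · have := hc.mono _ _ h5 (rk_lt _ _)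
            have h7 : h (rk c.X k) ≤ rk c.Y k := h6
            exact ⟨h6, by omega, rk_le_rk_iff.1 (by omega)⟩
          · have := hc.mono _ _ h6.le (rk_lt _ _)
            exact ⟨show h (rk c.X k) ≤ rk c.Y k by omega, h7, rk_le_rk_iff.1 h5⟩
        · rw [Finset.disjoint_left]
          intro k hk hk'
          simp only [Finset.mem_filter, Finset.mem_univ, true_and] at hk hk'
          omega) h2 hj (lt_of_le_of_lt (rk_le_rk_iff.1 h1) hi)
    rw [fT j hj] at h3
    obtain rfl := Option.some.inj h3
    exact h4
  -- The horizontal segment of a right leader stays below the curve.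
  have bR : ∀ j, ¬ c.top j → gap c.Y (c.τ j) ≤ h (rk c.X (f j)) := by
    intro j hj
    by_contra hcon
    obtain ⟨y, h1, h2⟩ := hc.b (rk c.X (f j)) (rk_lt _ _)
    have h0 : y < gap c.Y (c.τ j) := by omega
    obtain ⟨i₁, rfl⟩ := exists_rk_eq c.Y_inj (h0.trans_le (gap_le _ _))
    obtain ⟨i', h3, h4⟩ := hR.assigned (θ' := rk c.X (f j) + 1) (x := c.Y i₁)
      (a := c.rc (rk c.Y i₁)) (b := c.box (rk c.X (f j) + 1) n (rk c.Y i₁) -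
        c.up h (rk c.X (f j) + 1))
      (by
        rw [Cfg.rc_eq]
        refine Finset.card_le_card fun k hk => ?_
        simp only [Finset.mem_filter, Finset.mem_univ, true_and] at hk ⊢
        exact ⟨hk.1, i₁, rfl, hk.2⟩)
      (by
        rw [up, box, tsub_le_iff_right, ← Finset.card_union_of_disjoint]
        · refine Finset.card_le_card fun k hk => ?_
          simp only [Finset.mem_union, Finset.mem_filter, Finset.mem_univ, true_and] at hk ⊢
          by_cases h5 : c.Above h k
          · exact .inr ⟨hk.1, h5⟩
          · exact .inl ⟨h5, hk.1, rk_le_rk_iff.1 hk.2.2⟩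
        · rw [Finset.disjoint_left]
          intro k hk hk'
          simp only [Finset.mem_filter, Finset.mem_univ, true_and] at hk hk'
          exact hk.1 hk'.2) (by omega) hj (rk_lt_gap_iff.1 h0)
    rw [fR j hj] at h3
    obtain rfl := Option.some.inj h3
    omega
  refine ⟨f, ⟨?_, ?_, ?_, ?_⟩, hf⟩
  · intro j k hjk
    by_cases hj : c.top j <;> by_cases hk : c.top k
    · exact hT.inj j k (f j) (fT j hj) (by rw [hjk]; exact fT k hk)
    · have h1 := aT j hj
      have h2 := aR k hk
      rw [hjk] at h1; omega
    · have h1 := aR j hj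
      have h2 := aT k hk
      rw [hjk] at h1; omega
    · exact hR.inj j k (f j) (fR j hj) (by rw [hjk]; exact fR k hk)
  · rintro j k hj hk ⟨h1, h2⟩
    exact hT.noncross k j (f k) (fT k hk) hj (.inr ⟨f j, fT j hj, rk_lt_rk_iff.2 h1⟩) h2
  · rintro j k hj hk ⟨h1, h2⟩
    exact hR.noncross k j (f k) (fR k hk) hj (.inr ⟨f j, fR j hj, rk_lt_rk_iff.2 h1⟩) h2
  · intro j k hj hk
    have h1 := aR k hk
    have h2 := bR k hk
    have h3 := aT j hj
    have h4 := fun h' => bT j (f k) hj h'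
    refine ⟨fun ⟨h5, h6⟩ => ?_, fun ⟨h5, h6⟩ => ?_⟩
    · have := rk_lt_gap_iff.2 h6
      have := h4 h5
      omega
    · have h7 : rk c.Y (f j) < h (rk c.X (f k)) := by
        rcases h6 with h6 | h6
        · have := rk_lt_gap_iff.2 h6.2; omega
        · have := rk_lt_rk_iff.2 h6.2; omega
      rcases h5 with h5 | h5
      · have := h4 h5.2; omega
      · have := hc.mono _ _ (rk_lt_rk_iff.2 h5.2).le (rk_lt _ _); omega

end BoundaryLabeling

/-! ### The dynamic program -/

namespace BoundaryLabeling

namespace DP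

variable (n : ℕ) (yr tc rc : ℕ → ℕ)

/-- Whether the site of `x`-rank `k` lies above a curve of height `h`, as a number. -/
def δ (h k : ℕ) : ℕ := if h ≤ yr k then 1 else 0

/-- The least number of sites of `x`-rank at least `k` that have to lie above a curve of height `h`
at the site of `x`-rank `k`. -/
def accA (h : ℕ) : ℕ → ℕ
  | 0 => tc 0
  | k + 1 => min (accA h k - δ yr h k) (tc (k + 1))

/-- The number of sites of `x`-rank more than `k` and less than `i` and of `y`-rank at least `y`. -/
def cN (k y i : ℕ) : ℕ := Nat.count (fun j => k < j ∧ y ≤ yr j) i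

/-- One more than the largest number of sites of `x`-rank more than `k` that may lie above a curve
whose height at the site of `x`-rank `k` is at most `h - 1`; `0` if there is no such number. -/
def accB (k : ℕ) : ℕ → ℕ
  | 0 => 0
  | h + 1 => max (accB k h) (cN yr k h n + 1 - rc h)

/-- A curve of height `h` at the site of `x`-rank `k` that has `u` sites of `x`-rank at least `k`
above it continues a curve described by the entry `prev (u - δ)`. -/
def Cond (prev : ℕ → ℕ) (k u h : ℕ) : Prop :=
  δ yr h k ≤ u ∧ u - δ yr h k < n ∧ accA yr tc h k ≤ u ∧ u - δ yr h k < accB n yr rc k (h + 1) ∧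
    h < prev (u - δ yr h k)

open Classical in
/-- One more than the largest height below `i` that satisfies the condition, `0` if there is none. -/
noncomputable def cell (prev : ℕ → ℕ) (k u : ℕ) : ℕ → ℕ
  | 0 => 0
  | h + 1 => if Cond n yr tc rc prev k u h then h + 1 else cell prev k u h

/-- The table of the dynamic program: `row d u` is one more than the largest height at the site of
`x`-rank `n - d` of a partial curve that has `u` of the `d` sites from there on above it. -/
noncomputable def row : ℕ → ℕ → ℕ
  | 0 => fun u => if u = 0 then n + 1 else 0
  | d + 1 => fun u => cell n yr tc rc (row d) (n - 1 - d) u (n + 1)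

variable {n yr tc rc}

theorem cell_le (prev : ℕ → ℕ) (k u i : ℕ) : cell n yr tc rc prev k u i ≤ i := by
  induction i with
  | zero => simp [cell]
  | succ i ih => simp only [cell]; split_ifs <;> omega

theorem cond_of_cell {prev : ℕ → ℕ} {k u i v : ℕ} (h : cell n yr tc rc prev k u i = v + 1) :
    Cond n yr tc rc prev k u v := by
  induction i with
  | zero => simp [cell] at h
  | succ i ih =>
    simp only [cell] at h
    split_ifs at h with h1
    · obtain rfl : i = v := by omega
      exact h1
    · exact ih h

theorem lt_cell {prev : ℕ → ℕ} {k u i v : ℕ} (h : Cond n yr tc rc prev k u v) (hv : v < i) :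
    v < cell n yr tc rc prev k u i := by
  induction i with
  | zero => omega
  | succ i ih =>
    simp only [cell]
    split_ifs with h1
    · omega
    · rcases Nat.lt_succ_iff_lt_or_eq.1 hv with h2 | rfl
      · exact ih h2
      · exact absurd h h1

theorem accA_le_iff (h k u : ℕ) : accA yr tc h k ≤ u ↔
    ∃ j ≤ k, tc j ≤ u + Nat.count (fun i => j ≤ i ∧ h ≤ yr i) k := by
  induction k generalizing u with
  | zero =>
    simp only [accA, Nat.count_zero, add_zero, Nat.le_zero]
    exact ⟨fun h => ⟨0, rfl, h⟩, by rintro ⟨j, rfl, h⟩; exact h⟩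
  | succ k ih =>
    simp only [accA, min_le_iff, tsub_le_iff_right, ih]
    constructor
    · rintro (⟨j, h1, h2⟩ | h1)
      · refine ⟨j, by omega, ?_⟩
        rw [Nat.count_succ]
        simp only [δ] at h2
        simp only [h1, true_and]
        omega
      · exact ⟨k + 1, le_rfl, by omega⟩
    · rintro ⟨j, h1, h2⟩
      rw [Nat.count_succ] at h2
      rcases Nat.le_succ_iff.1 h1 with h3 | rfl
      · refine .inl ⟨j, h3, ?_⟩
        simp only [h3, true_and] at h2
        simp only [δ]
        omega
      · right
        have : Nat.count (fun i => k + 1 ≤ i ∧ h ≤ yr i) k = 0 := by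
          rw [Nat.count_eq_card_filter_range, Finset.card_eq_zero, Finset.filter_eq_empty_iff]
          intro i hi
          have := Finset.mem_range.1 hi
          omega
        simp only [Nat.succ_eq_add_one, this] at h2
        simpa using h2

theorem lt_accB_iff (k h u : ℕ) : u < accB n yr rc k (h + 1) ↔
    ∃ y ≤ h, rc y + u ≤ cN yr k y n := by
  induction h with
  | zero =>
    simp only [accB, Nat.le_zero, lt_max_iff]
    constructor
    · rintro (h | h)
      · omega
      · exact ⟨0, rfl, by omega⟩
    · rintro ⟨y, rfl, h⟩
      right; omega
  | succ h ih =>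
    rw [accB, lt_max_iff, ih]
    constructor
    · rintro (⟨y, h1, h2⟩ | h1)
      · exact ⟨y, by omega, h2⟩
      · exact ⟨h + 1, le_rfl, by omega⟩
    · rintro ⟨y, h1, h2⟩
      rcases Nat.le_succ_iff.1 h1 with h3 | rfl
      · exact .inl ⟨y, h3, h2⟩
      · right; simp only [Nat.succ_eq_add_one] at h2; omega

end DP

namespace Cfg

variable {n m : ℕ} {c : Cfg n m} {yr : ℕ → ℕ}

theorem tc_eq_zero (c : Cfg n m) : c.tc n = 0 := by
  classical
  simp only [tc, Finset.card_eq_zero, Finset.filter_eq_empty_iff]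
  rintro j - ⟨-, i, h, -⟩
  have := rk_lt c.X i
  omega

/-- Sites can be counted by their `x`-ranks. -/
theorem card_rk {v : Fin n → ℝ} (hv : Function.Injective v) (p : ℕ → Prop) [DecidablePred p]
    [DecidablePred fun i : Fin n => p (rk v i)] :
    (Finset.univ.filter fun i => p (rk v i)).card = ((Finset.range n).filter p).card := by
  classical
  have e : (Finset.range n).filter p = (Finset.univ.filter fun i => p (rk v i)).image (rk v) := by
    ext k
    simp only [Finset.mem_filter, Finset.mem_range, Finset.mem_image, Finset.mem_univ, true_and]
    constructor
    · rintro ⟨h1, h2⟩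
      obtain ⟨i, rfl⟩ := exists_rk_eq hv h1
      exact ⟨i, h2, rfl⟩
    · rintro ⟨i, h1, rfl⟩
      exact ⟨rk_lt v i, h1⟩
  rw [e, Finset.card_image_of_injective _ (rk_injective hv)]

theorem up_eq (hyr : ∀ i, yr (rk c.X i) = rk c.Y i) (h : ℕ → ℕ) (k : ℕ) :
    c.up h k = ((Finset.Ico k n).filter fun i => h i ≤ yr i).card := by
  classical
  unfold up Above
  simp only [← hyr]
  rw [card_rk c.X_inj fun i => k ≤ i ∧ h i ≤ yr i]
  congr 1
  ext i
  simp only [Finset.mem_filter, Finset.mem_range, Finset.mem_Ico]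
  tauto

theorem box_eq (hyr : ∀ i, yr (rk c.X i) = rk c.Y i) {j k : ℕ} (hk : k ≤ n) (y : ℕ) :
    c.box j k y = Nat.count (fun i => j ≤ i ∧ y ≤ yr i) k := by
  classical
  unfold box
  simp only [← hyr]
  rw [card_rk c.X_inj fun i => j ≤ i ∧ i < k ∧ y ≤ yr i, Nat.count_eq_card_filter_range]
  congr 1
  ext i
  simp only [Finset.mem_filter, Finset.mem_range]
  constructor
  · tauto
  · rintro ⟨h1, h2, h3⟩
    exact ⟨by omega, h2, h1, h3⟩

theorem up_succ (hyr : ∀ i, yr (rk c.X i) = rk c.Y i) (h : ℕ → ℕ) {k : ℕ} (hk : k < n) :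
    c.up h k = c.up h (k + 1) + DP.δ yr (h k) k := by
  rw [up_eq hyr, up_eq hyr, ← Finset.insert_Ico_add_one_left_eq_Ico hk, Finset.filter_insert, DP.δ]
  split_ifs with h1
  · rw [Finset.card_insert_of_notMem (by simp)]
  · rfl

theorem up_self (hyr : ∀ i, yr (rk c.X i) = rk c.Y i) (h : ℕ → ℕ) : c.up h n = 0 := by
  rw [up_eq hyr]; simp

/-- The table dominates every curve.  Keeping the largest height is enough, because a height
restricts the columns to its left only by being an upper bound for the heights there. -/
theorem Curve.lt_row (hyr : ∀ i, yr (rk c.X i) = rk c.Y i) {h : ℕ → ℕ} (hc : c.Curve h) (d : ℕ)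
    (hd : d + 1 ≤ n) : h (n - 1 - d) < DP.row n yr c.tc c.rc (d + 1) (c.up h (n - 1 - d)) := by
  have step : ∀ k < n, ∀ prev : ℕ → ℕ, h k < prev (c.up h (k + 1)) →
      h k < DP.cell n yr c.tc c.rc prev k (c.up h k) (n + 1) := by
    intro k hk prev hp
    refine DP.lt_cell ?_ (by have := hc.le k hk; omega)
    have e := up_succ hyr h hk
    have e' : c.up h k - DP.δ yr (h k) k = c.up h (k + 1) := by omega
    have e'' : c.up h (k + 1) < n := by
      rw [up_eq hyr]
      refine (Finset.card_filter_le _ _).trans_lt ?_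
      simp only [Nat.card_Ico]; omega
    refine ⟨by omega, by omega, ?_, ?_, by rwa [e']⟩
    · rw [DP.accA_le_iff]
      obtain ⟨j, h1, h2⟩ := hc.a k hk
      exact ⟨j, h1, by rwa [box_eq hyr hk.le] at h2⟩
    · rw [DP.lt_accB_iff, e']
      obtain ⟨y, h1, h2⟩ := hc.b k hk
      exact ⟨y, h1, by rwa [box_eq hyr le_rfl] at h2⟩
  induction d with
  | zero =>
    rw [DP.row]
    refine step _ (by omega) _ ?_
    rw [show n - 1 - 0 + 1 = n by omega, up_self hyr]
    have := hc.le (n - 1 - 0) (by omega)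
    simp only [DP.row, if_true]; omega
  | succ d ih =>
    rw [DP.row]
    refine step _ (by omega) _ ?_
    rw [show n - 1 - (d + 1) + 1 = n - 1 - d by omega]
    refine lt_of_le_of_lt ?_ (ih (by omega))
    exact hc.mono _ _ (by omega) (by omega)

end Cfg

namespace DP

variable (n : ℕ) (yr tc rc : ℕ → ℕ)

/-- Reading off a curve from the table: the number of sites above the curve from `x`-rank `k`
on, if it is `u` in total. -/
noncomputable def trace (u : ℕ) : ℕ → ℕ
  | 0 => u
  | k + 1 => trace u k - δ yr (row n yr tc rc (n - k) (trace u k) - 1) k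

/-- The heights of the curve read off from the table. -/
noncomputable def height (u k : ℕ) : ℕ := row n yr tc rc (n - k) (trace n yr tc rc u k) - 1

end DP

namespace Cfg

variable {n m : ℕ} {c : Cfg n m} {yr : ℕ → ℕ}

/-- The curve that is read off from a positive final entry of the table. -/
theorem curve_height (hyr : ∀ i, yr (rk c.X i) = rk c.Y i) {u : ℕ}
    (hu : 0 < DP.row n yr c.tc c.rc n u) (h1 : c.nT ≤ u) (h2 : m + u ≤ n + c.nT) :
    c.Curve (DP.height n yr c.tc c.rc u) := by
  set h := DP.height n yr c.tc c.rc u with hh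
  set w := DP.trace n yr c.tc c.rc u with hw
  have cond : ∀ k < n, 0 < DP.row n yr c.tc c.rc (n - k) (w k) →
      DP.Cond n yr c.tc c.rc (DP.row n yr c.tc c.rc (n - k - 1)) k (w k) (h k) ∧ h k ≤ n := by
    intro k hk hpos
    obtain ⟨d, hd⟩ : ∃ d, n - k = d + 1 := ⟨n - k - 1, by omega⟩
    have e : h k + 1 = DP.row n yr c.tc c.rc (n - k) (w k) := by
      simp only [hh, DP.height, ← hw]; omega
    rw [hd] at e ⊢
    rw [DP.row, show n - 1 - d = k by omega] at e
    beta_reduce at e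
    have := DP.cell_le (n := n) (yr := yr) (tc := c.tc) (rc := c.rc)
      (DP.row n yr c.tc c.rc d) k (w k) (n + 1)
    exact ⟨DP.cond_of_cell e.symm, by omega⟩
  have ws : ∀ k, w (k + 1) = w k - DP.δ yr (h k) k := fun k => rfl
  have pos : ∀ k ≤ n, 0 < DP.row n yr c.tc c.rc (n - k) (w k) := by
    intro k
    induction k with
    | zero => intro _; exact hu
    | succ k ih =>
      intro hk
      have := (cond k (by omega) (ih (by omega))).1.2.2.2.2
      rw [← ws, show n - k - 1 = n - (k + 1) by omega] at this
      omega
  have wn : w n = 0 := by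
    have := pos n le_rfl
    simp only [Nat.sub_self, DP.row] at this
    by_contra h0
    simp [h0] at this
  have up : ∀ d ≤ n, c.up h (n - d) = w (n - d) := by
    intro d
    induction d with
    | zero => intro _; rw [Nat.sub_zero, up_self hyr, wn]
    | succ d ih =>
      intro hd
      have h3 := (cond (n - (d + 1)) (by omega) (pos _ (by omega))).1.1
      rw [up_succ hyr h (k := n - (d + 1)) (by omega), show n - (d + 1) + 1 = n - d by omega,
        ih (by omega), show n - d = n - (d + 1) + 1 by omega, ws]
      omega
  have up' : ∀ k ≤ n, c.up h k = w k := fun k hk => by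
    have := up (n - k) (by omega)
    rwa [show n - (n - k) = k by omega] at this
  refine ⟨fun k hk => (cond k hk (pos k hk.le)).2, ?_, ?_, ?_, ?_, ?_⟩
  · intro k l hkl
    induction l, hkl using Nat.le_induction with
    | base => intro _; exact le_rfl
    | succ l hkl ih =>
      intro hl
      refine (ih (by omega)).trans ?_
      have h3 := (cond l (by omega) (pos l (by omega))).1.2.2.2.2
      rw [← ws, show n - l - 1 = n - (l + 1) by omega] at h3
      simp only [hh, DP.height] at h3 ⊢
      rw [← hw] at h3 ⊢
      omega
  · intro k hk
    have h3 := (cond k hk (pos k hk.le)).1.2.2.1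
    rw [DP.accA_le_iff] at h3
    obtain ⟨j, h4, h5⟩ := h3
    exact ⟨j, h4, by rwa [up' k hk.le, box_eq hyr hk.le]⟩
  · intro k hk
    have h3 := (cond k hk (pos k hk.le)).1.2.2.2.1
    rw [DP.lt_accB_iff, ← ws] at h3
    obtain ⟨y, h4, h5⟩ := h3
    exact ⟨y, h4, by rwa [up' (k + 1) hk, box_eq hyr le_rfl]⟩
  · rw [up' 0 (Nat.zero_le _)]; exact h1
  · rw [up' 0 (Nat.zero_le _)]; exact h2

/-- The table decides whether there is a curve. -/
theorem Curve.exists_row_pos (hyr : ∀ i, yr (rk c.X i) = rk c.Y i) {h : ℕ → ℕ} (hc : c.Curve h) :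
    ∃ u ≤ n, 0 < DP.row n yr c.tc c.rc n u ∧ c.nT ≤ u ∧ m + u ≤ n + c.nT := by
  refine ⟨c.up h 0, ?_, ?_, hc.t, hc.r⟩
  · rw [up_eq hyr]
    exact (Finset.card_filter_le _ _).trans (by simp)
  · rcases Nat.eq_zero_or_pos n with rfl | hn
    · rw [up_self hyr]; simp [DP.row]
    · have := hc.lt_row hyr (n - 1) (by omega)
      rw [show n - 1 - (n - 1) = 0 by omega, show n - 1 + 1 = n by omega] at this
      omega

end Cfg

end BoundaryLabeling

/-! ### Building blocks of the algorithm -/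

namespace WordRAM

theorem mem_mods_forP {a v b : ℕ} {p : Prog} : a ∈ (forP v b p).mods ↔ a = v ∨ a ∈ p.mods := by
  simp [forP, Prog.mods]
  tauto

/-- The test `a ≤ b`. -/
abbrev leT (a b : Expr) : Test := .not (.lt b a)

/-- The test `a = b`. -/
abbrev eqT (a b : Expr) : Test := .and (leT a b) (leT b a)

/-- Disjunction of tests. -/
abbrev orT (c d : Test) : Test := .not (.and (.not c) (.not d))

/-- Counts in `cnt` the values of `v` below the variable `b` that pass the test `c`. -/
def countP (v b cnt : ℕ) (c : Test) : Prog :=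
  .seq (.store cnt (.const 0) (.const 0))
    (forP v b (.ite c (.store cnt (.const 0) (.add (V cnt) (.const 1))) .skip))

theorem WP.count {E : Env} {σ : Store} {Q : Store → Prop} {v b cnt N : ℕ} {c : Test}
    (p : ℕ → Prop) [DecidablePred p] (hS : 0 < E.L.size) (hvc : v ≠ cnt) (hbv : b ≠ v)
    (hbc : b ≠ cnt) (hN : σ b 0 = N) (hNB : N ≤ E.B)
    (hc : ∀ i < N, ∀ σ', (∀ a, a ≠ v → a ≠ cnt → σ' a = σ a) → σ' v 0 = i →
      c.Inb E.L.size σ' ∧ (c.Holds E.x σ' ↔ p i))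
    (hQ : ∀ σ', (∀ a, a ≠ v → a ≠ cnt → σ' a = σ a) → σ' cnt 0 = Nat.count p N → Q σ') :
    WP E (countP v b cnt c) Q σ := by
  unfold countP
  refine WP.seq (WP.store (by simp [Expr.Inb]) (by simp [Expr.Inb])
    (by simpa [Expr.eval] using hS) ?_)
  simp only [Expr.eval]
  have hf : ∀ σ' : Store, (∀ a, a ≠ v → a ∉ (Prog.ite c (.store cnt (.const 0)
      (.add (V cnt) (.const 1))) .skip).mods → σ' a = write σ cnt 0 0 a) →
      ∀ a, a ≠ v → a ≠ cnt → σ' a = σ a := by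
    intro σ' h a h1 h2
    rw [h a h1 (by simpa [Prog.mods] using h2)]
    funext j; simp [write, h2]
  refine WP.for (fun i σ' => σ' cnt 0 = Nat.count p i) N hS (by simpa [Prog.mods] using hvc)
    (by simpa [Prog.mods] using hbc) hbv (by simpa [write, hbc] using hN) hNB ?_ ?_ ?_
  · simp [write, hvc.symm]
  · intro i hi σ' hf' hv hJ
    obtain ⟨h1, h2⟩ := hc i hi σ' (hf σ' hf') hv
    refine WP.ite h1 (fun h => ?_) (fun h => ?_)
    · refine WP.store (by simp [Expr.Inb]) (by simp [Expr.Inb, Expr.eval, hS])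
        (by simpa [Expr.eval] using hS) ?_
      simp [write, Expr.eval, hvc.symm, Nat.count_succ, h2.1 h, hJ]
    · refine WP.skip ?_
      simp [write, hvc.symm, Nat.count_succ, mt h2.2 h, hJ]
  · intro σ' hf' hJ
    exact hQ σ' (hf σ' hf') hJ

end WordRAM

namespace BoundaryLabeling

open WordRAM

theorem card_fin_eq_count {n : ℕ} (p : Fin n → Prop) [DecidablePred p] (q : ℕ → Prop)
    [DecidablePred q] (h : ∀ i, p i ↔ q i) :
    (Finset.univ.filter p).card = Nat.count q n := by
  rw [Nat.count_eq_card_filter_range, ← Finset.card_map Fin.valEmbedding]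
  congr 1
  ext k
  simp only [Finset.mem_map, Finset.mem_filter, Finset.mem_univ, true_and, Fin.valEmbedding_apply,
    Finset.mem_range]
  constructor
  · rintro ⟨i, h1, rfl⟩
    exact ⟨i.2, (h i).1 h1⟩
  · rintro ⟨h1, h2⟩
    exact ⟨⟨k, h1⟩, (h ⟨k, h1⟩).2 h2, rfl⟩

namespace Algo

/-- The setting of an instance with `n` sites and `m` labels: every bank has room for an array with
`(n + 1) * (n + 1)` entries, and the loops may make `n + 1` iterations. -/
structure Setting (E : Env) (n m : ℕ) : Prop where
  size : (n + 1) * (n + 1) ≤ E.L.size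
  B : E.B = n + 1
  le : m ≤ n

/-- The scalar variables `2`, `3`, `4` hold `n`, `m`, and `n + 1`. -/
def Base (n m : ℕ) (σ : Store) : Prop := σ 2 0 = n ∧ σ 3 0 = m ∧ σ 4 0 = n + 1

variable {E : Env} {n m : ℕ} {σ : Store} {Q : Store → Prop}

theorem Setting.pos (hE : Setting E n m) : 0 < E.L.size := by
  have := hE.size; nlinarith

theorem Setting.lt (hE : Setting E n m) {i : ℕ} (hi : i ≤ n) : i < E.L.size := by
  have := hE.size; nlinarith

theorem Setting.lt₂ (hE : Setting E n m) {i j : ℕ} (hi : i ≤ n) (hj : j ≤ n) :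
    i * (n + 1) + j < E.L.size := by
  have := hE.size; nlinarith

/-- Computes in bank `R` the ranks of the sites with respect to the real array `a`, and in bank `S`
the sites in the order of their ranks. -/
def rankP (a R S : ℕ) : Prog :=
  forP 5 2 (.seq (countP 7 2 6 (.realLt a (V 7) a (V 5)))
    (.seq (.store R (V 5) (V 6)) (.store S (V 6) (V 5))))

theorem wp_rankP (hE : Setting E n m) (hσ : Base n m σ) {a R S : ℕ} (hR : 7 < R) (hS : 7 < S)
    (hRS : R ≠ S) {v : Fin n → ℝ} (hv : Function.Injective v) (hx : ∀ i : Fin n, E.x a i = v i)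
    (hQ : ∀ σ', (∀ b, b ∉ [5, 6, 7, R, S] → σ' b = σ b) →
      (∀ i : Fin n, σ' R i = rk v i ∧ σ' S (rk v i) = i.val) → Q σ') :
    WP E (rankP a R S) Q σ := by
  classical
  have hmods : ∀ b, b ∈ (Prog.seq (countP 7 2 6 (.realLt a (V 7) a (V 5)))
      (.seq (.store R (V 5) (V 6)) (.store S (V 6) (V 5)))).mods → b = 6 ∨ b = 7 ∨ b = R ∨ b = S := by
    intro b hb
    simp only [countP, Prog.mods, List.mem_append, mem_mods_forP, List.mem_singleton,
      List.not_mem_nil] at hb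
    tauto
  refine WP.for (fun i σ' => ∀ s : Fin n, s < i → σ' R s = rk v s ∧ σ' S (rk v s) = s.val) n
    hE.pos (fun h => ?_) (fun h => ?_) (by omega) hσ.1 (by rw [hE.B]; omega) ?_ ?_ ?_
  · have := hmods _ h; omega
  · have := hmods _ h; omega
  · intro s hs; omega
  · intro i hi σ' hf h5 hJ
    have h2 : σ' 2 0 = n := by
      rw [hf 2 (by omega) (fun h => by have := hmods _ h; omega), hσ.1]
    refine WP.seq (WP.count (fun k => ∃ h : k < n, v ⟨k, h⟩ < v ⟨i, hi⟩) (N := n) hE.pos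
      (by omega) (by omega) (by omega) h2 (by rw [hE.B]; omega) ?_ ?_)
    · intro k hk σ1 hf1 h7
      have h5' : σ1 5 0 = i := by rw [hf1 5 (by omega) (by omega), h5]
      refine ⟨by simp [Test.Inb, Expr.Inb, Expr.eval, hE.pos], ?_⟩
      simp only [Test.Holds, Expr.eval, h5', h7]
      rw [hx ⟨k, hk⟩, hx ⟨i, hi⟩]
      simp [hk]
    · intro σ1 hf1 h6
      have h5' : σ1 5 0 = i := by rw [hf1 5 (by omega) (by omega), h5]
      have h6' : σ1 6 0 = rk v ⟨i, hi⟩ := by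
        rw [h6, rk, gap]
        exact (card_fin_eq_count _ _ (fun s => by simp)).symm
      have hlt := rk_lt v ⟨i, hi⟩
      refine WP.seq (WP.store (by simp [Expr.Inb, Expr.eval, hE.pos])
        (by simp [Expr.Inb, Expr.eval, hE.pos]) (by simpa [Expr.eval, h5'] using hE.lt hi.le) ?_)
      refine WP.store (by simp [Expr.Inb, Expr.eval, hE.pos])
        (by simp [Expr.Inb, Expr.eval, hE.pos]) ?_ ?_
      · have : 6 ≠ R := by omega
        simpa [Expr.eval, write, this, h6'] using hE.lt hlt.le
      · have e1 : 6 ≠ R := by omega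
        have e2 : 5 ≠ R := by omega
        have e3 : R ≠ 5 := by omega
        have e4 : S ≠ 5 := by omega
        intro s hs
        simp only [Expr.eval, h5', h6', write, e1, e2, e3, e4, hRS, hRS.symm, false_and, if_false,
          true_and]
        by_cases hsi : s = ⟨i, hi⟩
        · subst hsi; simp
        · have hs' : s.val ≠ i := fun h => hsi (Fin.ext h)
          have hr : rk v s ≠ rk v ⟨i, hi⟩ := fun h => hsi (rk_injective hv h)
          obtain ⟨g1, g2⟩ := hJ s (by omega)
          rw [if_neg hs', if_neg hr, hf1 R (by omega) (by omega), hf1 S (by omega) (by omega)]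
          exact ⟨g1, g2⟩
  · intro σ' hf hJ
    refine hQ σ' (fun b hb => ?_) (fun s => hJ s s.2)
    simp only [List.mem_cons, List.not_mem_nil, or_false, not_or] at hb
    exact hf b (by tauto) (fun h => by have := hmods _ h; tauto)

/-- Computes in bank `14` the `y`-ranks of the sites in the order of their `x`-ranks. -/
def yrP : Prog := forP 5 2 (.store 14 (.load 10 (V 5)) (.load 12 (V 5)))

theorem wp_yrP (hE : Setting E n m) (hσ : Base n m σ) {v w : Fin n → ℝ}
    (hv : Function.Injective v) (h10 : ∀ i : Fin n, σ 10 i = rk v i)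
    (h12 : ∀ i : Fin n, σ 12 i = rk w i)
    (hQ : ∀ σ', (∀ b, b ∉ [5, 14] → σ' b = σ b) →
      (∀ i : Fin n, σ' 14 (rk v i) = rk w i) → Q σ') : WP E yrP Q σ := by
  refine WP.for (fun i σ' => ∀ s : Fin n, s < i → σ' 14 (rk v s) = rk w s) n
    hE.pos (by simp [Prog.mods]) (by simp [Prog.mods]) (by omega) hσ.1 (by rw [hE.B]; omega)
    (by intro s hs; omega) ?_ ?_
  · intro i hi σ' hf h5 hJ
    have h10' : σ' 10 i = rk v ⟨i, hi⟩ := by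
      rw [hf 10 (by omega) (by simp [Prog.mods]), ← h10]
    have h12' : σ' 12 i = rk w ⟨i, hi⟩ := by
      rw [hf 12 (by omega) (by simp [Prog.mods]), ← h12]
    have hlt := rk_lt v ⟨i, hi⟩
    refine WP.store (by simp [Expr.Inb, Expr.eval, hE.pos, h5, hE.lt hi.le])
      (by simp [Expr.Inb, Expr.eval, hE.pos, h5, hE.lt hi.le])
      (by simpa [Expr.eval, h5, h10'] using hE.lt hlt.le) ?_
    intro s hs
    simp only [Expr.eval, h5, h10', h12', write, true_and]
    by_cases hsi : s = ⟨i, hi⟩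
    · subst hsi; simp
    · have hs' : s.val ≠ i := fun h => hsi (Fin.ext h)
      have hr : rk v s ≠ rk v ⟨i, hi⟩ := fun h => hsi (rk_injective hv h)
      simpa [hr] using hJ s (by omega)
  · intro σ' hf hJ
    refine hQ σ' (fun b hb => ?_) (fun s => hJ s s.2)
    simp only [List.mem_cons, List.not_mem_nil, or_false, not_or] at hb
    exact hf b hb.1 (by simpa [Prog.mods] using hb.2)

/-- The test that label `j` (variable `7`) lies on side `s`. -/
def sideT (s : ℕ) : Test := eqT (.load 1 (V 7)) (.const s)

/-- Computes in bank `out` the number of ports on side `s` that lie beyond the `k`-th site in the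
order of bank `S`, where positions along the side are given by the real arrays `a` for the sites
and `pa` for the ports. -/
def portsP (a pa S s out : ℕ) : Prog :=
  forP 5 2 (.seq (countP 7 3 6 (.and (sideT s) (.realLt a (.load S (V 5)) pa (V 7))))
    (.store out (V 5) (V 6)))

theorem wp_portsP (hE : Setting E n m) (hσ : Base n m σ) {a pa S s out : ℕ} (hS : 7 < S)
    (ho : 7 < out) (hSo : S ≠ out) {v : Fin n → ℝ} (hv : Function.Injective v)
    (hx : ∀ i : Fin n, E.x a i = v i) {P : Fin m → Prop} {τ : Fin m → ℝ}
    (hP : ∀ j, σ 1 j.val = s ↔ P j) (hp : ∀ j : Fin m, P j → E.x pa j = τ j)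
    (hs : ∀ i, σ S (rk v i) = i.val)
    (hQ : ∀ σ', (∀ b, b ∉ [5, 6, 7, out] → σ' b = σ b) → (∀ k, n ≤ k → σ' out k = σ out k) →
      (∀ i : Fin n, σ' out (rk v i) = Nat.card {j // P j ∧ v i < τ j}) → Q σ') :
    WP E (portsP a pa S s out) Q σ := by
  classical
  have hmods : ∀ b, b ∈ (Prog.seq (countP 7 3 6 (.and (sideT s)
      (.realLt a (.load S (V 5)) pa (V 7)))) (.store out (V 5) (V 6))).mods →
      b = 6 ∨ b = 7 ∨ b = out := by
    intro b hb
    simp only [countP, Prog.mods, List.mem_append, mem_mods_forP, List.mem_singleton,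
      List.not_mem_nil] at hb
    tauto
  refine WP.for (fun i σ' => (∀ k, n ≤ k → σ' out k = σ out k) ∧
    ∀ s : Fin n, rk v s < i → σ' out (rk v s) = Nat.card {j // P j ∧ v s < τ j}) n
    hE.pos (fun h => ?_) (fun h => ?_) (by omega) hσ.1 (by rw [hE.B]; omega) ?_ ?_ ?_
  · have := hmods _ h; omega
  · have := hmods _ h; omega
  · have : out ≠ 5 := by omega
    exact ⟨fun k _ => by simp [write, this], fun s hs => by omega⟩
  · intro i hi σ' hf h5 ⟨hJ1, hJ⟩
    have hfr : ∀ b, b ≠ 5 → b ≠ 6 → b ≠ 7 → b ≠ out → σ' b = σ b := fun b h1 h2 h3 h4 =>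
      hf b h1 (fun h => by have := hmods _ h; omega)
    obtain ⟨r, hr⟩ := exists_rk_eq hv hi
    refine WP.seq (WP.count (fun k => ∃ h : k < m, P ⟨k, h⟩ ∧ v r < τ ⟨k, h⟩) (N := m) hE.pos
      (by omega) (by omega) (by omega) ?_ (by rw [hE.B]; have := hE.le; omega) ?_ ?_)
    · rw [hfr 3 (by omega) (by omega) (by omega) (by omega), hσ.2.1]
    · intro k hk σ1 hf1 h7
      have h5' : σ1 5 0 = i := by rw [hf1 5 (by omega) (by omega), h5]
      have hS' : σ1 S i = r.val := by
        rw [hf1 S (by omega) (by omega), hfr S (by omega) (by omega) (by omega) hSo, ← hr, hs]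
      have h1 : σ1 1 = σ 1 := by
        rw [hf1 1 (by omega) (by omega), hfr 1 (by omega) (by omega) (by omega) (by omega)]
      refine ⟨by simp [sideT, Test.Inb, Expr.Inb, Expr.eval, hE.pos, h5', h7, hE.lt hi.le,
        hE.lt (hk.le.trans hE.le)], ?_⟩
      simp only [sideT, Test.Holds, Expr.eval, h5', h7, hS', h1, hx, ← hP]
      constructor
      · rintro ⟨⟨g1, g2⟩, g3⟩
        have g : P ⟨k, hk⟩ := (hP _).1 (by simp only; omega)
        exact ⟨hk, (hP _).2 g, by rw [← hp _ g]; exact g3⟩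
      · rintro ⟨_, g1, g2⟩
        refine ⟨⟨by omega, by omega⟩, ?_⟩
        have := hp ⟨k, hk⟩ ((hP _).1 g1)
        simp only at this
        rw [this]; exact g2
    · intro σ1 hf1 h6
      have h5' : σ1 5 0 = i := by rw [hf1 5 (by omega) (by omega), h5]
      refine WP.store (by simp [Expr.Inb, Expr.eval, hE.pos])
        (by simp [Expr.Inb, Expr.eval, hE.pos]) (by simpa [Expr.eval, h5'] using hE.lt hi.le) ?_
      have e1 : out ≠ 5 := by omega
      have e2 : σ1 out = σ' out := hf1 out (by omega) (by omega)
      simp only [Expr.eval, h5', write, e1, e2, false_and, if_false, true_and]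
      refine ⟨fun k hk => ?_, fun s hs => ?_⟩
      · rw [if_neg (by omega)]; exact hJ1 k hk
      · by_cases hsi : rk v s = i
        · obtain rfl : s = r := rk_injective hv (by rw [hsi, hr])
          rw [if_pos hsi, h6, Nat.card_eq_fintype_card, Fintype.card_subtype]
          exact (card_fin_eq_count _ _ (fun s => by simp)).symm
        · rw [if_neg hsi]
          exact hJ s (by omega)
  · intro σ' hf hJ
    refine hQ σ' (fun b hb => ?_) hJ.1 (fun s => hJ.2 s (rk_lt v s))
    simp only [List.mem_cons, List.not_mem_nil, or_false, not_or] at hb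
    exact hf b (by tauto) (fun h => by have := hmods _ h; tauto)

end Algo

end BoundaryLabeling

/-! ### The dynamic program on the machine -/

namespace BoundaryLabeling

open WordRAM

namespace Algo

variable {E : Env} {n m : ℕ} {σ : Store} {Q : Store → Prop}

/-- Computes in variable `23` the bound `DP.accA` for column `k` (variable `21`) and height `h`
(variable `22`). -/
def accP : Prog :=
  .seq (.store 23 (.const 0) (.load 15 (.const 0)))
    (forP 7 21 (.seq
      (.ite (leT (V 22) (.load 14 (V 7))) (.store 23 (.const 0) (.sub (V 23) (.const 1))) .skip)
      (.ite (.lt (.load 15 (.add (V 7) (.const 1))) (V 23))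
        (.store 23 (.const 0) (.load 15 (.add (V 7) (.const 1)))) .skip)))

theorem wp_accP (hE : Setting E n m) {k h : ℕ} (hk : σ 21 0 = k) (hkn : k < n) (hh : σ 22 0 = h)
    {tc : ℕ → ℕ} (ht : ∀ j ≤ n, σ 15 j = tc j)
    (hQ : ∀ σ', (∀ b, b ∉ [7, 23] → σ' b = σ b) → σ' 23 0 = DP.accA (σ 14) tc h k → Q σ') :
    WP E accP Q σ := by
  unfold accP
  refine WP.seq (WP.store (by simp [Expr.Inb]) (by simp [Expr.Inb, Expr.eval, hE.pos])
    (by simpa [Expr.eval] using hE.pos) ?_)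
  refine WP.for (fun i σ' => σ' 23 0 = DP.accA (σ 14) tc h i) k hE.pos (by simp [Prog.mods])
    (by simp [Prog.mods]) (by omega) (by simpa [write] using hk) (by rw [hE.B]; omega) ?_ ?_ ?_
  · simp [write, Expr.eval, DP.accA, ht]
  · intro i hi σ1 hf h7 hJ
    have hf' : ∀ a, a ∉ [7, 23] → σ1 a = σ a := by
      intro a ha
      simp only [List.mem_cons, List.not_mem_nil, or_false, not_or] at ha
      rw [hf a ha.1 (by simp [Prog.mods, ha.2])]
      funext j; simp [write, ha.2]
    have h14 := hf' 14 (by simp)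
    have h15 := hf' 15 (by simp)
    have h22 := hf' 22 (by simp)
    have ht' : σ 15 (i + 1) = tc (i + 1) := ht _ (by omega)
    have l1 := hE.lt (i := i) (by omega)
    have l2 := hE.lt (i := i + 1) (by omega)
    have hrec : DP.accA (σ 14) tc h (i + 1) =
      min (DP.accA (σ 14) tc h i - DP.δ (σ 14) h i) (tc (i + 1)) := rfl
    rw [hrec, ← hJ]
    refine WP.seq (Q := fun σ2 => (write σ2 7 0 (i + 1)) 23 0 = _) ?_
    have main : ∀ σ2 : Store, σ2 7 0 = i → σ2 15 = σ 15 →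
        σ2 23 0 = σ1 23 0 - DP.δ (σ 14) h i →
        WP E (.ite (.lt (.load 15 (.add (V 7) (.const 1))) (V 23))
        (.store 23 (.const 0) (.load 15 (.add (V 7) (.const 1)))) .skip)
        (fun σ2 => (write σ2 7 0 (i + 1)) 23 0 =
          min (σ1 23 0 - DP.δ (σ 14) h i) (tc (i + 1))) σ2 := by
      intro σ2 g7 g15 g23
      refine WP.ite (by simp [Test.Inb, Expr.Inb, Expr.eval, hE.pos, g7, l2]) (fun ht => ?_)
        (fun ht => ?_)
      · simp only [Test.Holds, Expr.eval, g7, g15, ht', g23] at ht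
        refine WP.store (by simp [Expr.Inb]) (by simp [Expr.Inb, Expr.eval, hE.pos, g7, l2])
          (by simpa [Expr.eval] using hE.pos) ?_
        simp [write, Expr.eval, g7, g15, ht']
        omega
      · simp only [Test.Holds, Expr.eval, g7, g15, ht', g23] at ht
        refine WP.skip ?_
        simp [write, g23]
        omega
    refine WP.ite (by simp [Test.Inb, Expr.Inb, Expr.eval, hE.pos, h7, l1]) (fun ht => ?_)
        (fun ht => ?_)
    · simp only [Test.Holds, Expr.eval, h7, h14, h22, hh, not_lt] at ht
      refine WP.store (by simp [Expr.Inb]) (by simp [Expr.Inb, Expr.eval, hE.pos])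
          (by simpa [Expr.eval] using hE.pos) (main _ ?_ ?_ ?_)
      · simpa [write] using h7
      · funext j; simp [write, h15]
      · simp [write, Expr.eval, DP.δ, ht]
    · simp only [Test.Holds, Expr.eval, h7, h14, h22, hh, not_lt] at ht
      exact WP.skip (main _ h7 h15 (by simp [DP.δ, ht]))
  · intro σ' hf hJ
    refine hQ σ' (fun b hb => ?_) hJ
    simp only [List.mem_cons, List.not_mem_nil, or_false, not_or] at hb
    rw [hf b hb.1 (by simp [Prog.mods, hb.2])]
    funext j; simp [write, hb.2]

/-- Updates in variable `25` the bound `DP.accB` for column `k` (variable `21`) to include the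
height `h` (variable `22`), and puts the number `DP.δ` into variable `26`. -/
def baccP : Prog :=
  .seq (countP 7 2 24 (.and (.lt (V 21) (V 7)) (leT (V 22) (.load 14 (V 7)))))
    (.seq (.ite (.lt (V 25) (.sub (.add (V 24) (.const 1)) (.load 16 (V 22))))
        (.store 25 (.const 0) (.sub (.add (V 24) (.const 1)) (.load 16 (V 22)))) .skip)
      (.ite (leT (V 22) (.load 14 (V 21))) (.store 26 (.const 0) (.const 1))
        (.store 26 (.const 0) (.const 0))))

theorem wp_baccP (hE : Setting E n m) (hσ : Base n m σ) {k h : ℕ} (hk : σ 21 0 = k) (hkn : k < n)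
    (hh : σ 22 0 = h) (hhn : h ≤ n) {rc : ℕ → ℕ} (hr : σ 16 h = rc h)
    (hb : σ 25 0 = DP.accB n (σ 14) rc k h)
    (hQ : ∀ σ', (∀ b, b ∉ [7, 24, 25, 26] → σ' b = σ b) →
      σ' 25 0 = DP.accB n (σ 14) rc k (h + 1) → σ' 26 0 = DP.δ (σ 14) h k → Q σ') :
    WP E baccP Q σ := by
  have l1 := hE.lt hhn
  have l2 := hE.lt hkn.le
  refine WP.seq (WP.count (fun j => k < j ∧ h ≤ σ 14 j) (N := n) hE.pos (by omega) (by omega)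
    (by omega) hσ.1 (by rw [hE.B]; omega) ?_ ?_)
  · intro i hi σ1 hf h7
    have l3 := hE.lt hi.le
    have h14 := hf 14 (by omega) (by omega)
    have h21 := hf 21 (by omega) (by omega)
    have h22 := hf 22 (by omega) (by omega)
    refine ⟨by simp [Test.Inb, Expr.Inb, Expr.eval, hE.pos, h7, l3], ?_⟩
    simp [Test.Holds, Expr.eval, h7, h14, h21, h22, hh, hk]
  · intro σ1 hf h24
    have h14 := hf 14 (by omega) (by omega)
    have h16 := hf 16 (by omega) (by omega)
    have h21 := hf 21 (by omega) (by omega)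
    have h22 := hf 22 (by omega) (by omega)
    have h25 := hf 25 (by omega) (by omega)
    have hrec : DP.accB n (σ 14) rc k (h + 1) =
      max (σ1 25 0) (σ1 24 0 + 1 - rc h) := by rw [h25, h24, hb]; rfl
    rw [hrec] at hQ
    have main : ∀ σ2 : Store, (∀ b, b ≠ 25 → σ2 b = σ1 b) →
        σ2 25 0 = max (σ1 25 0) (σ1 24 0 + 1 - rc h) →
        WP E (.ite (leT (V 22) (.load 14 (V 21))) (.store 26 (.const 0) (.const 1))
          (.store 26 (.const 0) (.const 0))) Q σ2 := by
      intro σ2 hg g25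
      have g14 := hg 14 (by omega)
      have g21 := hg 21 (by omega)
      have g22 := hg 22 (by omega)
      refine WP.ite (by simp [Test.Inb, Expr.Inb, Expr.eval, hE.pos, g21, h21, hk, l2])
        (fun ht => ?_) (fun ht => ?_)
      all_goals
        simp only [Test.Holds, Expr.eval, g21, g14, g22, h21, h14, h22, hh, hk, not_lt] at ht
        refine WP.store (by simp [Expr.Inb]) (by simp [Expr.Inb])
          (by simpa [Expr.eval] using hE.pos) (hQ _ ?_ ?_ ?_)
        · intro b hb
          simp only [List.mem_cons, List.not_mem_nil, or_false, not_or] at hb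
          funext j
          simp only [write, hb, false_and, if_false]
          rw [hg b hb.2.2.1, hf b hb.1 hb.2.1]
        · simpa [write] using g25
        · simp [write, Expr.eval, DP.δ, ht]
    refine WP.seq (WP.ite (by simp [Test.Inb, Expr.Inb, Expr.eval, hE.pos, h22, hh, l1])
        (fun ht => ?_) (fun ht => ?_))
    · simp only [Test.Holds, Expr.eval, h22, h16, hh, hr] at ht
      refine WP.store (by simp [Expr.Inb]) (by simp [Expr.Inb, Expr.eval, hE.pos, h22, hh, l1])
        (by simpa [Expr.eval] using hE.pos) (main _ ?_ ?_)
      · intro b hb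
        funext j; simp [write, hb]
      · simp [write, Expr.eval, h22, h16, hh, hr]
        omega
    · simp only [Test.Holds, Expr.eval, h22, h16, hh, hr] at ht
      exact WP.skip (main _ (fun _ _ => rfl) (by omega))

/-- Updates the entries of the table for column `k` (variable `21`) with the height `h`
(variable `22`). -/
def updP : Prog :=
  forP 27 2 (.ite (.and (leT (V 23) (.add (V 27) (V 26))) (.and (.lt (V 27) (V 25))
      (.lt (V 22) (.load 18 (.add (.mul (.add (V 21) (.const 1)) (V 4)) (V 27))))))
    (.store 18 (.add (.mul (V 21) (V 4)) (.add (V 27) (V 26))) (.add (V 22) (.const 1))) .skip)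

theorem wp_updP (hE : Setting E n m) (hσ : Base n m σ) {k h acc bacc δ : ℕ} (hk : σ 21 0 = k)
    (hkn : k < n) (hh : σ 22 0 = h) (ha : σ 23 0 = acc) (hb : σ 25 0 = bacc) (hδ : σ 26 0 = δ)
    (hδ1 : δ ≤ 1)
    (hQ : ∀ σ', (∀ b, b ∉ [18, 27] → σ' b = σ b) →
      (∀ r ≤ n, ∀ u ≤ n, r ≠ k → σ' 18 (r * (n + 1) + u) = σ 18 (r * (n + 1) + u)) →
      (∀ u ≤ n, σ' 18 (k * (n + 1) + u) = if δ ≤ u ∧ u - δ < n ∧ acc ≤ u ∧ u - δ < bacc ∧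
        h < σ 18 ((k + 1) * (n + 1) + (u - δ)) then h + 1 else σ 18 (k * (n + 1) + u)) → Q σ') :
    WP E updP Q σ := by
  -- An index determines the row and the column of the table.
  have inj : ∀ r u k v : ℕ, u ≤ n → v ≤ n → r * (n + 1) + u = k * (n + 1) + v → r = k ∧ u = v := by
    intro r u k v hu hv he
    have h1 : r = k := by
      have := congrArg (· / (n + 1)) he
      simpa [Nat.add_comm, Nat.add_mul_div_right, Nat.div_eq_of_lt (Nat.lt_succ_of_le hu),
        Nat.div_eq_of_lt (Nat.lt_succ_of_le hv)] using this
    subst h1; omega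
  refine WP.for (fun i σ' =>
    (∀ r ≤ n, ∀ u ≤ n, r ≠ k → σ' 18 (r * (n + 1) + u) = σ 18 (r * (n + 1) + u)) ∧
      ∀ u ≤ n, σ' 18 (k * (n + 1) + u) = if δ ≤ u ∧ u - δ < i ∧ acc ≤ u ∧ u - δ < bacc ∧
        h < σ 18 ((k + 1) * (n + 1) + (u - δ)) then h + 1 else σ 18 (k * (n + 1) + u)) n hE.pos
    (by simp [Prog.mods]) (by simp [Prog.mods]) (by omega) hσ.1 (by rw [hE.B]; omega) ?_ ?_ ?_
  · simp [write]
  · intro i hi σ1 hf h27 ⟨hJ1, hJ2⟩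
    have f : ∀ b, b ∉ [18, 27] → σ1 b = σ b := by
      intro b hb
      simp only [List.mem_cons, List.not_mem_nil, or_false, not_or] at hb
      exact hf b hb.2 (by simp [Prog.mods, hb.1])
    have h21 : σ1 21 0 = k := by rw [f 21 (by simp), hk]
    have h22 : σ1 22 0 = h := by rw [f 22 (by simp), hh]
    have h23 : σ1 23 0 = acc := by rw [f 23 (by simp), ha]
    have h25 : σ1 25 0 = bacc := by rw [f 25 (by simp), hb]
    have h26 : σ1 26 0 = δ := by rw [f 26 (by simp), hδ]
    have h4 : σ1 4 0 = n + 1 := by rw [f 4 (by simp), hσ.2.2]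
    have l1 := hE.lt₂ (i := k + 1) (j := i) (by omega) (by omega)
    have l2 := hE.lt₂ (i := k) (j := i + δ) (by omega) (by omega)
    have hprev := hJ1 (k + 1) (by omega) i (by omega) (by omega)
    refine WP.ite (by simp [Test.Inb, Expr.Inb, Expr.eval, hE.pos, h21, h4, h27, l1])
      (fun ht => ?_) (fun ht => ?_)
    all_goals
      simp only [Test.Holds, Expr.eval, h21, h22, h23, h25, h26, h27, h4, not_lt, hprev] at ht
    · refine WP.store (by simp [Expr.Inb, Expr.eval, hE.pos])
        (by simp [Expr.Inb, Expr.eval, hE.pos])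
        (by simpa [Expr.eval, h21, h4, h27, h26] using l2) ?_
      simp only [Expr.eval, h21, h22, h26, h27, h4]
      refine ⟨fun r hr u hu hrk => ?_, fun u hu => ?_⟩
      · have : r * (n + 1) + u ≠ k * (n + 1) + (i + δ) := fun he =>
          hrk (inj _ _ _ _ hu (by omega) he).1
        simp [write, this, hJ1 r hr u hu hrk]
      · by_cases hui : u = i + δ
        · subst hui
          simp [write, ht]
        · have : k * (n + 1) + u ≠ k * (n + 1) + (i + δ) := by omega
          simp only [write, this, and_false, if_false, hJ2 u hu,
            show (18 : ℕ) ≠ 27 by omega, false_and]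
          have e : (δ ≤ u ∧ u - δ < i) ↔ (δ ≤ u ∧ u - δ < i + 1) := by omega
          simp only [← and_assoc, e]
    · refine WP.skip ⟨fun r hr u hu hrk => by simp [write, hJ1 r hr u hu hrk], fun u hu => ?_⟩
      simp only [write, hJ2 u hu, show (18 : ℕ) ≠ 27 by omega, false_and, if_false]
      by_cases hui : u = i + δ
      · subst hui
        simp only [Nat.add_sub_cancel]
        rw [if_neg (by omega), if_neg]
        rintro ⟨-, -, h3, h4, h5⟩
        exact ht ⟨h3, h4, h5⟩
      · have e : (δ ≤ u ∧ u - δ < i) ↔ (δ ≤ u ∧ u - δ < i + 1) := by omega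
        simp only [← and_assoc, e]
  · intro σ' hf hJ
    refine hQ σ' (fun b hb => ?_) hJ.1 hJ.2
    simp only [List.mem_cons, List.not_mem_nil, or_false, not_or] at hb
    exact hf b hb.2 (by simp [Prog.mods, hb.1])

/-- Fills the table of the dynamic program: cell `k * (n + 1) + u` of bank `18` becomes
`DP.row (n - k) u`. -/
def dpP : Prog :=
  .seq (.store 18 (.mul (V 2) (V 4)) (V 4))
    (forP 32 2 (.seq (.store 21 (.const 0) (.sub (V 2) (.add (V 32) (.const 1))))
      (.seq (.store 25 (.const 0) (.const 0))
        (forP 22 4 (.seq accP (.seq baccP updP))))))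

theorem wp_dpP (hE : Setting E n m) (hσ : Base n m σ) {tc rc : ℕ → ℕ}
    (ht : ∀ j ≤ n, σ 15 j = tc j) (hr : ∀ j ≤ n, σ 16 j = rc j) (h18 : ∀ i, σ 18 i = 0)
    (hQ : ∀ σ', (∀ b, b ∉ [7, 18, 21, 22, 23, 24, 25, 26, 27, 32] → σ' b = σ b) →
      (∀ k ≤ n, ∀ u ≤ n, σ' 18 (k * (n + 1) + u) = DP.row n (σ 14) tc rc (n - k) u) → Q σ') :
    WP E dpP Q σ := by
  classical
  have hmods : ∀ b, b ∈ (Prog.seq accP (.seq baccP updP)).mods →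
      b ∈ [7, 18, 23, 24, 25, 26, 27] := by
    intro b hb
    simp only [accP, baccP, updP, countP, Prog.mods, List.mem_append, mem_mods_forP,
      List.not_mem_nil, List.mem_cons] at hb ⊢
    tauto
  have hmods' : ∀ b, b ∈ (Prog.seq (.store 21 (.const 0) (.sub (V 2) (.add (V 32) (.const 1))))
      (.seq (.store 25 (.const 0) (.const 0))
        (forP 22 4 (.seq accP (.seq baccP updP))))).mods →
      b ∈ [7, 18, 21, 22, 23, 24, 25, 26, 27] := by
    intro b hb
    simp only [accP, baccP, updP, countP, Prog.mods, List.mem_append, mem_mods_forP,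
      List.not_mem_nil, List.mem_cons] at hb ⊢
    tauto
  have l0 := hE.lt₂ (i := n) (j := 0) le_rfl (by omega)
  refine WP.seq (WP.store (by simp [Expr.Inb, Expr.eval, hE.pos])
    (by simp [Expr.Inb, Expr.eval, hE.pos])
    (by simpa [Expr.eval, hσ.1, hσ.2.2] using l0) ?_)
  simp only [Expr.eval, hσ.1, hσ.2.2]
  have fr : ∀ σ' : Store, (∀ a, a ≠ 32 → a ∉ (Prog.seq (.store 21 (.const 0)
      (.sub (V 2) (.add (V 32) (.const 1)))) (.seq (.store 25 (.const 0) (.const 0))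
        (forP 22 4 (.seq accP (.seq baccP updP))))).mods →
        σ' a = write σ 18 (n * (n + 1)) (n + 1) a) →
      ∀ b, b ∉ [7, 18, 21, 22, 23, 24, 25, 26, 27, 32] → σ' b = σ b := by
    intro σ' hf b hb
    have hb' : b ∉ [7, 18, 21, 22, 23, 24, 25, 26, 27] := by
      simp only [List.mem_cons, List.not_mem_nil, or_false, not_or] at hb ⊢
      tauto
    rw [hf b (fun h => hb (by simp [h])) (fun h => hb' (hmods' b h))]
    funext j
    have : b ≠ 18 := fun h => hb (by simp [h])
    simp [write, this]
  refine WP.for (fun d σ' => ∀ r ≤ n, ∀ u ≤ n, σ' 18 (r * (n + 1) + u) =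
      if n - r ≤ d then DP.row n (σ 14) tc rc (n - r) u else 0) n hE.pos
    (fun h => by simpa using hmods' _ h) (fun h => by simpa using hmods' _ h) (by omega)
    (by simpa [write] using hσ.1) (by rw [hE.B]; omega) ?_ ?_ ?_
  · intro r hrn u hu
    simp only [write, show (18 : ℕ) ≠ 32 by omega, false_and, if_false, true_and, h18]
    by_cases h1 : r = n
    · subst h1
      simp [DP.row]
    · have : r * (n + 1) + u ≠ n * (n + 1) := by
        obtain ⟨s, rfl⟩ := Nat.exists_eq_add_of_lt (lt_of_le_of_ne hrn h1)
        nlinarith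
      rw [if_neg this, if_neg (by omega)]
  · intro d hd σ1 hf h32 hJ
    have f := fr σ1 hf
    have h2 : σ1 2 0 = n := by rw [f 2 (by simp), hσ.1]
    have h4 : σ1 4 0 = n + 1 := by rw [f 4 (by simp), hσ.2.2]
    refine WP.seq (WP.store (by simp [Expr.Inb]) (by simp [Expr.Inb, Expr.eval, hE.pos])
      (by simpa [Expr.eval] using hE.pos) ?_)
    simp only [Expr.eval, h2, h32]
    refine WP.seq (WP.store (by simp [Expr.Inb]) (by simp [Expr.Inb])
      (by simpa [Expr.eval] using hE.pos) ?_)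
    simp only [Expr.eval]
    set k := n - (d + 1) with hkdef
    have hk1 : k + 1 = n - d := by omega
    have hkd : n - (k + 1) = d := by omega
    have hkd' : n - 1 - d = k := by omega
    have hrow : ∀ u, DP.row n (σ 14) tc rc (d + 1) u =
        DP.cell n (σ 14) tc rc (DP.row n (σ 14) tc rc d) k u (n + 1) := by
      intro u; simp only [DP.row, hkd']
    refine WP.for (fun h σ' => σ' 25 0 = DP.accB n (σ 14) rc k h ∧
      (∀ r ≤ n, ∀ u ≤ n, r ≠ k → σ' 18 (r * (n + 1) + u) = σ1 18 (r * (n + 1) + u)) ∧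
      ∀ u ≤ n, σ' 18 (k * (n + 1) + u) =
        DP.cell n (σ 14) tc rc (DP.row n (σ 14) tc rc d) k u h) (n + 1) hE.pos
      (fun h => by simpa using hmods _ h) (fun h => by simpa using hmods _ h) (by omega)
      (by simpa [write] using h4) (by rw [hE.B]) ?_ ?_ ?_
    · refine ⟨by simp [write, DP.accB], fun r _ u _ _ => by simp [write], fun u hu => ?_⟩
      simp only [write, show (18 : ℕ) ≠ 22 by omega, show (18 : ℕ) ≠ 25 by omega,
        show (18 : ℕ) ≠ 21 by omega, false_and, if_false, DP.cell]
      rw [hJ k (by omega) u hu, if_neg (by omega)]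
    · intro h hh σ2 hf2 h22 ⟨hb, hM1, hM2⟩
      have f2 : ∀ b, b ∉ [7, 18, 21, 22, 23, 24, 25, 26, 27, 32] → σ2 b = σ b := by
        intro b hb
        have hb' : b ∉ [7, 18, 23, 24, 25, 26, 27] := by
          simp only [List.mem_cons, List.not_mem_nil, or_false, not_or] at hb ⊢
          tauto
        rw [hf2 b (fun h => hb (by simp [h])) (fun h => hb' (hmods b h)), ← f b hb]
        have b21 : b ≠ 21 := fun h => hb (by simp [h])
        have b25 : b ≠ 25 := fun h => hb (by simp [h])
        funext j
        simp [write, b21, b25]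
      have g21 : σ2 21 0 = k := by
        rw [hf2 21 (by omega) (fun h => by simpa using hmods _ h)]; simp [write]
      have g14 := f2 14 (by simp)
      have gB : Base n m σ2 := by
        refine ⟨?_, ?_, ?_⟩
        · rw [f2 2 (by simp), hσ.1]
        · rw [f2 3 (by simp), hσ.2.1]
        · rw [f2 4 (by simp), hσ.2.2]
      refine WP.seq (wp_accP hE g21 (by omega) h22 (tc := tc)
        (fun j hj => by rw [f2 15 (by simp), ht j hj]) ?_)
      intro σ3 f3 h23
      have B3 : Base n m σ3 := by
        simpa only [Base, f3 2 (by simp), f3 3 (by simp), f3 4 (by simp)] using gB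
      refine WP.seq (wp_baccP hE B3 (k := k) (h := h) (rc := rc)
        (by rw [f3 21 (by simp), g21]) (by omega)
        (by rw [f3 22 (by simp), h22]) (by omega)
        (by rw [f3 16 (by simp), f2 16 (by simp), hr _ (by omega)])
        (by rw [f3 25 (by simp), f3 14 (by simp), g14, hb]) ?_)
      intro σ4 f4 h25 h26
      rw [f3 14 (by simp), g14] at h25 h26
      rw [g14] at h23
      have B4 : Base n m σ4 := by
        simpa only [Base, f4 2 (by simp), f4 3 (by simp), f4 4 (by simp)] using B3
      have e18 : σ4 18 = σ2 18 := by rw [f4 18 (by simp), f3 18 (by simp)]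
      refine wp_updP hE B4 (k := k) (h := h)
        (by rw [f4 21 (by simp), f3 21 (by simp), g21]) (by omega)
        (by rw [f4 22 (by simp), f3 22 (by simp), h22])
        (by rw [f4 23 (by simp), h23]) h25 h26 (by simp only [DP.δ]; split_ifs <;> omega) ?_
      intro σ5 f5 hN1 hN2
      refine ⟨?_, fun r hr u hu hrk => ?_, fun u hu => ?_⟩
      · simp only [write, show (25 : ℕ) ≠ 22 by omega, false_and, if_false]
        rw [f5 25 (by simp), h25]
      · simp only [write, show (18 : ℕ) ≠ 22 by omega, false_and, if_false]
        rw [hN1 r hr u hu hrk, e18, hM1 r hr u hu hrk]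
      · simp only [write, show (18 : ℕ) ≠ 22 by omega, false_and, if_false]
        rw [hN2 u hu, e18, hM2 u hu]
        simp only [DP.cell]
        refine if_congr ?_ rfl rfl
        simp only [DP.Cond]
        refine and_congr_right fun _ => and_congr_right fun hun => and_congr_right fun _ =>
          and_congr_right fun _ => ?_
        rw [hM1 (k + 1) (by omega) _ (by omega) (by omega), hJ (k + 1) (by omega) _ (by omega),
          hkd, if_pos le_rfl]
    · intro σ2 hf2 ⟨_, hM1, hM2⟩ r hrn u hu
      simp only [write, show (18 : ℕ) ≠ 32 by omega, false_and, if_false]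
      by_cases hrk : r = k
      · subst hrk
        rw [hM2 u hu, if_pos (by omega), show n - k = d + 1 by omega, hrow]
      · rw [hM1 r hrn u hu hrk, hJ r hrn u hu]
        refine if_congr ?_ rfl rfl
        omega
  · intro σ' hf hJ
    refine hQ σ' (fr σ' hf) (fun k hk u hu => ?_)
    rw [hJ k hk u hu, if_pos (by omega)]

end Algo

end BoundaryLabeling

/-! ### Extraction of a solution on the machine -/

namespace BoundaryLabeling

open WordRAM

namespace Algo

variable {E : Env} {n m : ℕ} {σ : Store} {Q : Store → Prop}

/-- Searches the first row of the table for an entry that describes a curve.  Variable `28` tells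
whether there is one, and variable `29` is its index. -/
def searchP : Prog :=
  forP 27 4 (.ite (.and (.lt (.const 0) (.load 18 (V 27))) (.and (leT (V 17) (V 27))
      (leT (.add (V 3) (V 27)) (.add (V 2) (V 17)))))
    (.seq (.store 28 (.const 0) (.const 1)) (.store 29 (.const 0) (V 27))) .skip)

theorem wp_searchP (hE : Setting E n m) (hσ : Base n m σ) (h28 : σ 28 0 = 0) {t : ℕ}
    (ht : σ 17 0 = t)
    (hQ : ∀ σ', (∀ b, b ∉ [27, 28, 29] → σ' b = σ b) →
      (σ' 28 0 = 0 ∧ ∀ u ≤ n, ¬ (0 < σ 18 u ∧ t ≤ u ∧ m + u ≤ n + t)) ∨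
      (σ' 28 0 = 1 ∧ σ' 29 0 ≤ n ∧ 0 < σ 18 (σ' 29 0) ∧ t ≤ σ' 29 0 ∧ m + σ' 29 0 ≤ n + t) →
      Q σ') : WP E searchP Q σ := by
  refine WP.for (fun i σ' =>
      (σ' 28 0 = 0 ∧ ∀ u < i, ¬ (0 < σ 18 u ∧ t ≤ u ∧ m + u ≤ n + t)) ∨
      (σ' 28 0 = 1 ∧ σ' 29 0 ≤ n ∧ 0 < σ 18 (σ' 29 0) ∧ t ≤ σ' 29 0 ∧ m + σ' 29 0 ≤ n + t)) (n + 1)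
    hE.pos (by simp [Prog.mods]) (by simp [Prog.mods]) (by omega) hσ.2.2 (by rw [hE.B]) ?_ ?_ ?_
  · simp [write, h28]
  · intro i hi σ1 hf h27 hJ
    have h2 : σ1 2 0 = n := by rw [hf 2 (by omega) (by simp [Prog.mods]), hσ.1]
    have h3 : σ1 3 0 = m := by rw [hf 3 (by omega) (by simp [Prog.mods]), hσ.2.1]
    have h17 : σ1 17 0 = t := by rw [hf 17 (by omega) (by simp [Prog.mods]), ht]
    have h18 : σ1 18 = σ 18 := hf 18 (by omega) (by simp [Prog.mods])
    have l := hE.lt (i := i) (by omega)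
    refine WP.ite (by simp [Test.Inb, Expr.Inb, Expr.eval, hE.pos, h27, l]) (fun hc => ?_)
      (fun hc => ?_)
    all_goals simp only [Test.Holds, Expr.eval, h2, h3, h17, h18, h27, not_lt] at hc
    · refine WP.seq (WP.store (by simp [Expr.Inb]) (by simp [Expr.Inb])
        (by simpa [Expr.eval] using hE.pos) ?_)
      refine WP.store (by simp [Expr.Inb]) (by simp [Expr.Inb, Expr.eval, hE.pos])
        (by simpa [Expr.eval] using hE.pos) (.inr ?_)
      simp [write, Expr.eval, h27, hc]
      omega
    · refine WP.skip ?_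
      simp only [write, show (28 : ℕ) ≠ 27 by omega, show (29 : ℕ) ≠ 27 by omega, false_and,
        if_false]
      refine hJ.imp (fun ⟨g1, g2⟩ => ⟨g1, fun u hu => ?_⟩) id
      rcases Nat.lt_succ_iff_lt_or_eq.1 hu with h | rfl
      · exact g2 u h
      · exact hc
  · intro σ' hf hJ
    refine hQ σ' (fun b hb => ?_) (hJ.imp (fun ⟨g1, g2⟩ => ⟨g1, fun u hu => g2 u (by omega)⟩) id)
    simp only [List.mem_cons, List.not_mem_nil, or_false, not_or] at hb
    exact hf b hb.1 (by simp [Prog.mods, hb.2])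

/-- Marks in bank `19` the sites above the curve that is described by the table and the variable
`29`. -/
def traceP : Prog :=
  forP 21 2 (.seq (.store 22 (.const 0)
      (.sub (.load 18 (.add (.mul (V 21) (V 4)) (V 29))) (.const 1)))
    (.ite (leT (V 22) (.load 14 (V 21)))
      (.seq (.store 19 (.load 11 (V 21)) (.const 1))
        (.store 29 (.const 0) (.sub (V 29) (.const 1)))) .skip))

theorem wp_traceP (hE : Setting E n m) (hσ : Base n m σ) {u : ℕ} (hu : u ≤ n) (h29 : σ 29 0 = u)
    {v : Fin n → ℝ} (hv : Function.Injective v) (h11 : ∀ i, σ 11 (rk v i) = i.val)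
    {tc rc : ℕ → ℕ}
    (h18 : ∀ k ≤ n, ∀ u ≤ n, σ 18 (k * (n + 1) + u) = DP.row n (σ 14) tc rc (n - k) u)
    (h19 : ∀ i, σ 19 i = 0)
    (hQ : ∀ σ', (∀ b, b ∉ [19, 21, 22, 29] → σ' b = σ b) →
      (∀ i : Fin n, σ' 19 i =
        if DP.height n (σ 14) tc rc u (rk v i) ≤ σ 14 (rk v i) then 1 else 0) → Q σ') :
    WP E traceP Q σ := by
  refine WP.for (fun k σ' => σ' 29 0 = DP.trace n (σ 14) tc rc u k ∧ ∀ i : Fin n, σ' 19 i =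
      if rk v i < k ∧ DP.height n (σ 14) tc rc u (rk v i) ≤ σ 14 (rk v i) then 1 else 0) n hE.pos
    (by simp [Prog.mods]) (by simp [Prog.mods]) (by omega) hσ.1 (by rw [hE.B]; omega) ?_ ?_ ?_
  · simp [write, h29, DP.trace, h19]
  · intro k hk σ1 hf h21 ⟨hJ1, hJ2⟩
    have f : ∀ b, b ∉ [19, 21, 22, 29] → σ1 b = σ b := by
      intro b hb
      simp only [List.mem_cons, List.not_mem_nil, or_false, not_or] at hb
      exact hf b hb.2.1 (by simp [Prog.mods, hb])
    have h4 : σ1 4 0 = n + 1 := by rw [f 4 (by simp), hσ.2.2]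
    have h11' := f 11 (by simp)
    have h14 := f 14 (by simp)
    have hle : DP.trace n (σ 14) tc rc u k ≤ n := by
      refine le_trans ?_ hu
      clear * -
      induction k with
      | zero => exact le_rfl
      | succ k ih => exact (Nat.sub_le _ _).trans ih
    have l := hE.lt₂ hk.le hle
    have l1 := hE.lt hk.le
    obtain ⟨r, hr⟩ := exists_rk_eq hv hk
    have l2 := hE.lt r.2.le
    have hr' : σ 11 k = r.val := by rw [← hr, h11]
    have hh : σ1 18 (k * (n + 1) + DP.trace n (σ 14) tc rc u k) - 1 =
        DP.height n (σ 14) tc rc u k := by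
      rw [f 18 (by simp), h18 k hk.le _ hle]; rfl
    have htr : DP.trace n (σ 14) tc rc u (k + 1) = DP.trace n (σ 14) tc rc u k -
        DP.δ (σ 14) (DP.height n (σ 14) tc rc u k) k := rfl
    refine WP.seq (WP.store (by simp [Expr.Inb])
      (by simp [Expr.Inb, Expr.eval, hE.pos, h21, h4, hJ1, l])
      (by simpa [Expr.eval] using hE.pos) ?_)
    simp only [Expr.eval, h21, h4, hJ1, hh]
    refine WP.ite (by simp [Test.Inb, Expr.Inb, Expr.eval, hE.pos, write, h21, l1]) (fun hc => ?_)
      (fun hc => ?_)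
    all_goals
      simp only [Test.Holds, Expr.eval, write, show (14 : ℕ) ≠ 22 by omega,
        show (21 : ℕ) ≠ 22 by omega, false_and, if_false, and_self, if_true, h21, h14,
        not_lt] at hc
    · refine WP.seq (WP.store (by simp [Expr.Inb, Expr.eval, hE.pos, write, h21, l1])
        (by simp [Expr.Inb])
        (by simpa [Expr.eval, write, h21, h11', hr'] using l2) ?_)
      refine WP.store (by simp [Expr.Inb]) (by simp [Expr.Inb, Expr.eval, hE.pos])
        (by simpa [Expr.eval] using hE.pos) ⟨?_, fun i => ?_⟩
      · simp [write, Expr.eval, hJ1, htr, DP.δ, hc]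
      · simp only [write, Expr.eval, h21, h11', hr', show (19 : ℕ) ≠ 21 by omega,
          show (19 : ℕ) ≠ 29 by omega, show (19 : ℕ) ≠ 22 by omega, show (11 : ℕ) ≠ 22 by omega,
          show (21 : ℕ) ≠ 22 by omega, false_and, if_false, true_and, hJ2 i]
        by_cases hi : i = r
        · subst hi
          simp [hr, hc]
        · have h1 : rk v i ≠ k := fun h => hi (rk_injective hv (h.trans hr.symm))
          have h2 : i.val ≠ r.val := fun h => hi (Fin.ext h)
          rw [if_neg h2]
          refine if_congr ?_ rfl rfl
          rw [show rk v i < k ↔ rk v i < k + 1 by omega]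
    · refine WP.skip ⟨?_, fun i => ?_⟩
      · simp [write, hJ1, htr, DP.δ, hc]
      · simp only [write, show (19 : ℕ) ≠ 21 by omega, show (19 : ℕ) ≠ 22 by omega, false_and,
          if_false, hJ2 i]
        refine if_congr ?_ rfl rfl
        by_cases hi : rk v i = k
        · rw [hi]; simp [hc]
        · rw [show rk v i < k ↔ rk v i < k + 1 by omega]
  · intro σ' hf hJ
    refine hQ σ' (fun b hb => ?_) (fun i => by simp [hJ.2 i, rk_lt])
    simp only [List.mem_cons, List.not_mem_nil, or_false, not_or] at hb
    exact hf b hb.2.1 (by simp [Prog.mods, hb])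

/-- The test that label `j` (variable `7`) suits the site in variable `31` better than the label
`b` with `b + 1` in variable `30`. -/
def betterT (a pa : ℕ) : Test :=
  orT (.and (.realLt a (V 31) pa (V 7)) (orT (.not (.realLt a (V 31) pa (.sub (V 30) (.const 1))))
      (.realLt pa (V 7) pa (.sub (V 30) (.const 1)))))
    (.and (.not (.realLt a (V 31) pa (.sub (V 30) (.const 1))))
      (.realLt pa (.sub (V 30) (.const 1)) pa (V 7)))

/-- Puts into variable `30` one more than the best free label on side `s` for the site in
variable `31`, and `0` if no label on this side is free. -/
def bestP (a pa s : ℕ) : Prog :=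
  .seq (.store 30 (.const 0) (.const 0))
    (forP 7 3 (.ite (.and (sideT s) (.and (eqT (.load 20 (V 7)) (.const 0))
        (orT (eqT (V 30) (.const 0)) (betterT a pa))))
      (.store 30 (.const 0) (.add (V 7) (.const 1))) .skip))

theorem wp_bestP (hE : Setting E n m) (hσ : Base n m σ) {a pa s : ℕ} {P : Fin m → Prop}
    {τ : Fin m → ℝ} {o : Fin m → Option (Fin n)} {x : ℝ} (hP : ∀ j, σ 1 j.val = s ↔ P j)
    (hp : ∀ j : Fin m, P j → E.x pa j = τ j) (hx : E.x a (σ 31 0) = x)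
    (ho : ∀ j, P j → (σ 20 j.val = 0 ↔ o j = none))
    (hQ : ∀ σ', (∀ b, b ∉ [7, 30] → σ' b = σ b) →
      (σ' 30 0 = 0 ∧ ∀ j, P j → o j ≠ none) ∨ (∃ b, σ' 30 0 = b.val + 1 ∧ Best τ P o x b) → Q σ') :
    WP E (bestP a pa s) Q σ := by
  have hmn := hE.le
  unfold bestP
  refine WP.seq (WP.store (by simp [Expr.Inb]) (by simp [Expr.Inb])
    (by simpa [Expr.eval] using hE.pos) ?_)
  refine WP.for (fun i σ' => (σ' 30 0 = 0 ∧ ∀ j : Fin m, j < i → P j → o j ≠ none) ∨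
      ∃ b : Fin m, σ' 30 0 = b.val + 1 ∧ P b ∧ o b = none ∧ ∀ k : Fin m, k < i → P k → o k = none →
        (x < τ b ∧ (x < τ k → τ b ≤ τ k)) ∨ (τ b ≤ x ∧ τ k ≤ τ b)) m hE.pos
    (by simp [Prog.mods]) (by simp [Prog.mods]) (by omega) (by simpa [write] using hσ.2.1)
    (by rw [hE.B]; omega) ?_ ?_ ?_
  · exact .inl ⟨by simp [write, Expr.eval], fun j hj => by omega⟩
  · intro i hi σ1 hf h7 hJ
    have f : ∀ b, b ∉ [7, 30] → σ1 b = σ b := by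
      intro b hb
      simp only [List.mem_cons, List.not_mem_nil, or_false, not_or] at hb
      rw [hf b hb.1 (by simp [Prog.mods, hb])]
      funext j; simp [write, hb]
    have h1 := f 1 (by simp)
    have h20 := f 20 (by simp)
    have h31 := f 31 (by simp)
    have l := hE.lt (i := i) (by omega)
    have key : (Test.and (sideT s) (.and (eqT (.load 20 (V 7)) (.const 0))
        (orT (eqT (V 30) (.const 0)) (betterT a pa)))).Holds E.x σ1 ↔
        P ⟨i, hi⟩ ∧ o ⟨i, hi⟩ = none ∧ (σ1 30 0 = 0 ∨ ∃ b, σ1 30 0 = b.val + 1 ∧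
          ((x < τ ⟨i, hi⟩ ∧ (¬ x < τ b ∨ τ ⟨i, hi⟩ < τ b)) ∨ (¬ x < τ b ∧ τ b < τ ⟨i, hi⟩))) := by
      have e1 : (¬ s < σ 1 i ∧ ¬ σ 1 i < s) ↔ P ⟨i, hi⟩ := by
        rw [← hP]; simp only; omega
      have e2 : ∀ k, (¬ 0 < k ∧ ¬ k < 0) ↔ k = 0 := by omega
      simp only [sideT, betterT, Test.Holds, Expr.eval, h7, h1, h20, h31, hx, e1, e2]
      refine and_congr_right fun hPi => ?_
      rw [ho _ hPi, hp _ hPi]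
      refine and_congr_right fun _ => ?_
      rcases hJ with ⟨h30, -⟩ | ⟨b, h30, hPb, -⟩
      · simp [h30]
      · have e3 : ∀ b', b.val + 1 = b'.val + 1 ↔ b = b' := fun b' => by
          rw [Nat.add_right_cancel_iff, Fin.ext_iff]
        simp only [h30, Nat.add_sub_cancel, hp b hPb, e3, exists_eq_left']
        simp only [Nat.succ_ne_zero, not_false_eq_true, true_and, false_or, not_and_or, not_not]
        tauto
    refine WP.ite (by simp [sideT, betterT, Test.Inb, Expr.Inb, Expr.eval, hE.pos, h7, l])
      (fun hc => ?_) (fun hc => ?_)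
    all_goals rw [key] at hc
    · obtain ⟨hPi, hoi, hc⟩ := hc
      refine WP.store (by simp [Expr.Inb]) (by simp [Expr.Inb, Expr.eval, hE.pos])
        (by simpa [Expr.eval] using hE.pos) (.inr ⟨⟨i, hi⟩, ?_, hPi, hoi, fun k hk hPk hok => ?_⟩)
      · simp [write, Expr.eval, h7]
      rcases Nat.lt_succ_iff_lt_or_eq.1 hk with hk | hk
      · rcases hJ with ⟨_, g⟩ | ⟨b, h30, _, _, g⟩
        · exact absurd hok (g k hk hPk)
        · have hc : (x < τ ⟨i, hi⟩ ∧ (¬ x < τ b ∨ τ ⟨i, hi⟩ < τ b)) ∨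
              (¬ x < τ b ∧ τ b < τ ⟨i, hi⟩) := by
            rcases hc with hc | ⟨b', hb', hc⟩
            · omega
            · obtain rfl : b = b' := Fin.ext (by omega)
              exact hc
          rcases lt_or_ge x (τ ⟨i, hi⟩) with hxi | hxi
          · refine .inl ⟨hxi, fun hxk => ?_⟩
            rcases g k hk hPk hok with ⟨g1, g2⟩ | ⟨g1, g2⟩
            · rcases hc with ⟨_, hc | hc⟩ | ⟨hc, _⟩
              · exact absurd g1 hc
              · exact hc.le.trans (g2 hxk)
              · exact absurd g1 hc
            · linarith
          · refine .inr ⟨hxi, ?_⟩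
            rcases hc with ⟨hc, _⟩ | ⟨hc, hc'⟩
            · linarith
            · rcases g k hk hPk hok with ⟨g1, _⟩ | ⟨_, g2⟩
              · exact absurd g1 hc
              · linarith
      · obtain rfl : k = ⟨i, hi⟩ := Fin.ext hk
        rcases lt_or_ge x (τ ⟨i, hi⟩) with hxi | hxi
        · exact .inl ⟨hxi, fun _ => le_rfl⟩
        · exact .inr ⟨hxi, le_rfl⟩
    · refine WP.skip ?_
      simp only [write, show (30 : ℕ) ≠ 7 by omega, false_and, if_false]
      refine hJ.imp (fun ⟨h30, g⟩ => ⟨h30, fun j hj hPj hoj => ?_⟩)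
        (fun ⟨b, h30, hPb, hob, g⟩ => ⟨b, h30, hPb, hob, fun k hk hPk hok => ?_⟩)
      · rcases Nat.lt_succ_iff_lt_or_eq.1 hj with hj | hj
        · exact g j hj hPj hoj
        · obtain rfl : j = ⟨i, hi⟩ := Fin.ext hj
          exact hc ⟨hPj, hoj, .inl h30⟩
      · rcases Nat.lt_succ_iff_lt_or_eq.1 hk with hk | hk
        · exact g k hk hPk hok
        · obtain rfl : k = ⟨i, hi⟩ := Fin.ext hk
          have hc : ¬ ((x < τ ⟨i, hi⟩ ∧ (¬ x < τ b ∨ τ ⟨i, hi⟩ < τ b)) ∨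
              (¬ x < τ b ∧ τ b < τ ⟨i, hi⟩)) := fun h => hc ⟨hPk, hok, .inr ⟨b, h30, h⟩⟩
          rcases lt_or_ge x (τ b) with hxb | hxb
          · refine .inl ⟨hxb, fun hxk => ?_⟩
            by_contra hlt
            exact hc (.inl ⟨hxk, .inr (not_le.1 hlt)⟩)
          · refine .inr ⟨hxb, ?_⟩
            by_contra hlt
            exact hc (.inr ⟨not_lt.2 hxb, not_le.1 hlt⟩)
  · intro σ' hf hJ
    refine hQ σ' (fun b hb => ?_) (hJ.imp (fun ⟨g1, g2⟩ => ⟨g1, fun j => g2 j j.2⟩)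
      (fun ⟨b, g1, g2, g3, g4⟩ => ⟨b, g1, g2, g3, fun k => g4 k k.2⟩))
    simp only [List.mem_cons, List.not_mem_nil, or_false, not_or] at hb
    rw [hf b hb.1 (by simp [Prog.mods, hb])]
    funext j; simp [write, hb]

/-- The greedy assignment of the sites with flag `fv` to the labels on side `s`, in the reverse
order of bank `S`.  Cell `j` of bank `20` becomes one more than the site of the label `j`. -/
def greedyP (a pa S fv s : ℕ) : Prog :=
  forP 5 2 (.seq (.store 31 (.const 0) (.load S (.sub (V 2) (.add (V 5) (.const 1)))))
    (.ite (eqT (.load 19 (V 31)) (.const fv))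
      (.seq (bestP a pa s) (.ite (.lt (.const 0) (V 30))
        (.store 20 (.sub (V 30) (.const 1)) (.add (V 31) (.const 1))) .skip)) .skip))

theorem wp_greedyP (hE : Setting E n m) (hσ : Base n m σ) {a pa S fv s : ℕ} (hS : S ∈ [11, 13])
    {v w : Fin n → ℝ} (hw : Function.Injective w) (hSw : ∀ i, σ S (rk w i) = i.val)
    (hx : ∀ i : Fin n, E.x a i = v i) {P : Fin m → Prop} {τ : Fin m → ℝ}
    (hP : ∀ j, σ 1 j.val = s ↔ P j) (hp : ∀ j : Fin m, P j → E.x pa j = τ j)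
    {A : Fin n → Prop} (hA : ∀ i, σ 19 i.val = fv ↔ A i) (h20 : ∀ j, P j → σ 20 j.val = 0)
    (hQ : ∀ σ', (∀ b, b ∉ [5, 7, 20, 30, 31] → σ' b = σ b) →
      (∀ j : Fin m, ¬ P j → σ' 20 j = σ 20 j) →
      (∃ o, GreedyInv (rk w) v τ A P 0 o ∧ ∀ j, P j → σ' 20 j = (o j).elim 0 (·.val + 1)) →
      Q σ') : WP E (greedyP a pa S fv s) Q σ := by
  have hS' : S = 11 ∨ S = 13 := by simpa using hS
  have hmods : ∀ b, b ∈ (Prog.seq (.store 31 (.const 0)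
      (.load S (.sub (V 2) (.add (V 5) (.const 1)))))
      (.ite (eqT (.load 19 (V 31)) (.const fv))
      (.seq (bestP a pa s) (.ite (.lt (.const 0) (V 30))
        (.store 20 (.sub (V 30) (.const 1)) (.add (V 31) (.const 1))) .skip)) .skip)).mods →
      b ∈ [7, 20, 30, 31] := by
    intro b hb
    simp only [bestP, Prog.mods, List.mem_append, mem_mods_forP, List.not_mem_nil,
      List.mem_cons] at hb ⊢
    tauto
  refine WP.for (fun r σ' => (∀ j : Fin m, ¬ P j → σ' 20 j = σ 20 j) ∧
      ∃ o, GreedyInv (rk w) v τ A P (n - r) o ∧ ∀ j, P j → σ' 20 j = (o j).elim 0 (·.val + 1)) n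
    hE.pos (fun h => by simpa using hmods _ h) (fun h => by simpa using hmods _ h) (by omega) hσ.1
    (by rw [hE.B]; omega) ?_ ?_ ?_
  · exact ⟨fun j _ => by simp [write], fun _ => none, GreedyInv.start (rk_lt w),
      fun j hj => by simp [write, h20 j hj]⟩
  · intro r hr σ1 hf h5 ⟨hJ1, o, ho, hJ2⟩
    have f : ∀ b, b ∉ [5, 7, 20, 30, 31] → σ1 b = σ b := by
      intro b hb
      have hb' : b ∉ [7, 20, 30, 31] := by
        simp only [List.mem_cons, List.not_mem_nil, or_false, not_or] at hb ⊢
        tauto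
      exact hf b (fun h => hb (by simp [h])) (fun h => hb' (hmods b h))
    have h2 : σ1 2 0 = n := by rw [f 2 (by simp), hσ.1]
    obtain ⟨i, hi⟩ := exists_rk_eq hw (k := n - (r + 1)) (by omega)
    have hSi : σ1 S (n - (r + 1)) = i.val := by
      rw [f S (by simp only [List.mem_cons, List.not_mem_nil, or_false]; omega), ← hi, hSw]
    have l := hE.lt (i := n - (r + 1)) (by omega)
    have li := hE.lt i.2.le
    rw [show n - r = n - (r + 1) + 1 by omega] at ho
    refine WP.seq (WP.store (by simp [Expr.Inb])
      (by simp [Expr.Inb, Expr.eval, hE.pos, h2, h5, l]) (by simpa [Expr.eval] using hE.pos) ?_)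
    simp only [Expr.eval, h2, h5, hSi]
    -- The invariant survives the skipping of the site.
    have skip : ∀ σ2 : Store, σ2 20 = σ1 20 → (¬ A i ∨ ∀ j, P j → o j ≠ none) →
        (fun σ'' => (fun σ' => (∀ j : Fin m, ¬ P j → σ' 20 j = σ 20 j) ∧
          ∃ o, GreedyInv (rk w) v τ A P (n - (r + 1)) o ∧
            ∀ j, P j → σ' 20 j = (o j).elim 0 (·.val + 1)) (write σ'' 5 0 (r + 1))) σ2 := by
      intro σ2 h hs
      simp only [write, show (20 : ℕ) ≠ 5 by omega, false_and, if_false, h]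
      exact ⟨hJ1, o, ho.skip hi (rk_injective hw) hs, hJ2⟩
    refine WP.ite (by simp [Test.Inb, Expr.Inb, Expr.eval, hE.pos, write, li]) (fun hc => ?_)
      (fun hc => ?_)
    all_goals
      have e : (¬ fv < σ 19 i.val ∧ ¬ σ 19 i.val < fv) ↔ A i := by rw [← hA]; omega
      simp only [Test.Holds, Expr.eval, write, show (19 : ℕ) ≠ 31 by omega, false_and, if_false,
        and_self, if_true, f 19 (by simp), e] at hc
    · have f2 : ∀ b, b ≠ 31 → write σ1 31 0 i.val b = σ1 b := by
        intro b hb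
        funext j; simp [write, hb]
      refine WP.seq (wp_bestP hE (P := P) (τ := τ) (o := o) (x := v i) ?_ (fun j => ?_) hp ?_
        (fun j hj => ?_) ?_)
      · rw [Base, f2 2 (by omega), f2 3 (by omega), f2 4 (by omega), f 2 (by simp), f 3 (by simp),
          f 4 (by simp)]
        exact hσ
      · rw [f2 1 (by omega), f 1 (by simp), hP]
      · simp [write, hx]
      · rw [f2 20 (by omega), hJ2 j hj]
        cases o j <;> simp
      · intro σ2 g hb
        have g20 : σ2 20 = σ1 20 := by rw [g 20 (by simp), f2 20 (by omega)]
        have g31 : σ2 31 0 = i.val := by rw [g 31 (by simp)]; simp [write]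
        refine WP.ite (by simp [Test.Inb, Expr.Inb, Expr.eval, hE.pos]) (fun hc' => ?_)
          (fun hc' => ?_)
        all_goals simp only [Test.Holds, Expr.eval] at hc'
        · obtain ⟨b, h30, hbest⟩ := hb.resolve_left (fun h => by omega)
          have lb := hE.lt (b.2.le.trans hE.le)
          refine WP.store (by simp [Expr.Inb, Expr.eval, hE.pos])
            (by simp [Expr.Inb, Expr.eval, hE.pos]) (by simpa [Expr.eval, h30] using lb) ?_
          simp only [Expr.eval, h30, g31, Nat.add_sub_cancel]
          refine ⟨fun j hj => ?_, _, ho.assign hi (rk_injective hw) hc hbest, fun j hj => ?_⟩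
          · have : j.val ≠ b.val := fun h => hj (Fin.ext h ▸ hbest.1)
            simp [write, this, g20, hJ1 j hj]
          · by_cases hjb : j = b
            · subst hjb; simp [write]
            · have : j.val ≠ b.val := fun h => hjb (Fin.ext h)
              simp [write, this, g20, hJ2 j hj, hjb]
        · refine WP.skip (skip σ2 g20 (.inr ?_))
          rcases hb with ⟨_, hb⟩ | ⟨b, h30, _⟩
          · exact hb
          · omega
    · exact WP.skip (skip _ (by funext j; simp [write]) (.inl hc))
  · intro σ' hf hJ
    rw [Nat.sub_self] at hJ
    refine hQ σ' (fun b hb => ?_) hJ.1 hJ.2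
    have hb' : b ∉ [7, 20, 30, 31] := by
      simp only [List.mem_cons, List.not_mem_nil, or_false, not_or] at hb ⊢
      tauto
    exact hf b (fun h => hb (by simp [h])) (fun h => hb' (hmods b h))

/-- Writes the answer, with the solution from bank `20`. -/
def outP : Prog :=
  .seq (forP 7 3 (.store 1 (V 7) (.sub (.load 20 (V 7)) (.const 1))))
    (.store 0 (.const 0) (.const 1))

theorem wp_outP (hE : Setting E n m) (hσ : Base n m σ) {f : Fin m → Fin n}
    (h20 : ∀ j : Fin m, σ 20 j = (f j).val + 1)
    (hQ : ∀ σ', σ' 0 0 = 1 → (∀ j : Fin m, σ' 1 j = (f j).val) → Q σ') : WP E outP Q σ := by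
  have hmn := hE.le
  refine WP.seq (WP.for (fun i σ' => ∀ j : Fin m, j < i → σ' 1 j = (f j).val) m hE.pos
    (by simp [Prog.mods]) (by simp [Prog.mods]) (by omega) hσ.2.1 (by rw [hE.B]; omega)
    (fun j hj => by omega) ?_ ?_)
  · intro i hi σ1 hf h7 hJ
    have g20 : σ1 20 i = (f ⟨i, hi⟩).val + 1 := by
      rw [hf 20 (by omega) (by simp [Prog.mods]), ← h20]
    have l := hE.lt (i := i) (by omega)
    refine WP.store (by simp [Expr.Inb, Expr.eval, hE.pos])
      (by simp [Expr.Inb, Expr.eval, hE.pos, h7, l]) (by simpa [Expr.eval, h7] using l) ?_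
    intro j hj
    simp only [Expr.eval, h7, g20, Nat.add_sub_cancel, write, show (1 : ℕ) ≠ 7 by omega, false_and,
      if_false, true_and]
    by_cases hji : j.val = i
    · subst hji; simp
    · rw [if_neg hji, hJ j (by omega)]
  · intro σ1 hf hJ
    refine WP.store (by simp [Expr.Inb]) (by simp [Expr.Inb]) (by simpa [Expr.eval] using hE.pos)
      (hQ _ ?_ fun j => ?_)
    · simp [write, Expr.eval]
    · simp [write, hJ j j.2]

end Algo

end BoundaryLabeling

/-! ### The complete program -/

namespace BoundaryLabeling

open WordRAM

theorem Cfg.tc_rk {n m : ℕ} (c : Cfg n m) (i : Fin n) :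
    c.tc (rk c.X i) = Nat.card {j // c.top j ∧ c.X i < c.τ j} := by
  classical
  rw [Nat.card_eq_fintype_card, Fintype.card_subtype, tc]
  congr 1
  ext j
  simp only [Finset.mem_filter, Finset.mem_univ, true_and]
  refine and_congr_right fun _ => ⟨?_, fun h => ⟨i, rfl, h⟩⟩
  rintro ⟨i', h, h'⟩
  rwa [← rk_injective c.X_inj h]

namespace Algo

variable {E : Env} {n m : ℕ} {σ : Store} {Q : Store → Prop}

/-- Copies `n` and `m` to the banks `2` and `3`, and puts `n + 1` into bank `4`. -/
def initP : Prog :=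
  .seq (.store 2 (.const 0) (.load 0 (.const 0))) (.seq (.store 3 (.const 0) (.load 0 (.const 1)))
    (.store 4 (.const 0) (.add (V 2) (.const 1))))

theorem wp_initP (hS : 1 < E.L.size) (h0 : σ 0 0 = n) (h1 : σ 0 1 = m)
    (hQ : ∀ σ', (∀ b, b ∉ [2, 3, 4] → σ' b = σ b) → Base n m σ' → Q σ') : WP E initP Q σ := by
  have hS' : 0 < E.L.size := by omega
  refine WP.seq (WP.store (by simp [Expr.Inb]) (by simp [Expr.Inb, Expr.eval, hS'])
    (by simpa [Expr.eval] using hS') ?_)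
  refine WP.seq (WP.store (by simp [Expr.Inb]) (by simp [Expr.Inb, Expr.eval, hS])
    (by simpa [Expr.eval] using hS') ?_)
  refine WP.store (by simp [Expr.Inb]) (by simp [Expr.Inb, Expr.eval, hS'])
    (by simpa [Expr.eval] using hS') (hQ _ (fun b hb => ?_) ?_)
  · simp only [List.mem_cons, List.not_mem_nil, or_false, not_or] at hb
    funext j; simp [write, hb]
  · simp [Base, write, Expr.eval, h0, h1]

/-- The preprocessing: ranks of the sites, and numbers of ports. -/
def prepP : Prog :=
  .seq initP (.seq (rankP 0 10 11) (.seq (rankP 1 12 13) (.seq yrP (.seq (portsP 0 2 11 0 15)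
    (.seq (portsP 1 3 13 1 16) (countP 7 3 17 (sideT 0)))))))

/-- The store after the preprocessing. -/
structure Prep (c : Cfg n m) (σ : Store) : Prop where
  base : Base n m σ
  top : ∀ j : Fin m, σ 1 j = 0 ↔ c.top j
  right : ∀ j : Fin m, σ 1 j = 1 ↔ ¬ c.top j
  x : ∀ i, σ 11 (rk c.X i) = i.val
  y : ∀ i, σ 13 (rk c.Y i) = i.val
  yr : ∀ i, σ 14 (rk c.X i) = rk c.Y i
  tc : ∀ k ≤ n, σ 15 k = c.tc k
  rc : ∀ k ≤ n, σ 16 k = c.rc k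
  nT : σ 17 0 = c.nT
  zero : ∀ b ∈ [18, 19, 20, 28], ∀ i, σ b i = 0

/-- The real input describes the configuration `c`. -/
structure Input (E : Env) (c : Cfg n m) : Prop where
  x : ∀ i : Fin n, E.x 0 i = c.X i
  y : ∀ i : Fin n, E.x 1 i = c.Y i
  top : ∀ j : Fin m, c.top j → E.x 2 j = c.τ j
  right : ∀ j : Fin m, ¬ c.top j → E.x 3 j = c.τ j

theorem wp_prepP (hE : Setting E n m) (hS : 1 < E.L.size) {c : Cfg n m} (hI : Input E c)
    (h00 : σ 0 0 = n) (h01 : σ 0 1 = m) (hs : ∀ j : Fin m, σ 1 j = 0 ↔ c.top j)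
    (hs' : ∀ j : Fin m, σ 1 j = 1 ↔ ¬ c.top j) (hz : ∀ b, 2 ≤ b → ∀ i, σ b i = 0)
    (hQ : ∀ σ', Prep c σ' → Q σ') : WP E prepP Q σ := by
  classical
  have hmn := hE.le
  have stable : ∀ {σ σ' : Store}, Base n m σ → σ' 2 = σ 2 → σ' 3 = σ 3 → σ' 4 = σ 4 →
      Base n m σ' := by
    intro σ σ' h h2 h3 h4
    rw [Base, h2, h3, h4]; exact h
  refine WP.seq (wp_initP hS h00 h01 fun σ1 f1 b1 => ?_)
  refine WP.seq (wp_rankP hE b1 (by omega) (by omega) (by omega) c.X_inj hI.x fun σ2 f2 g2 => ?_)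
  have b2 := stable b1 (f2 2 (by simp)) (f2 3 (by simp)) (f2 4 (by simp))
  refine WP.seq (wp_rankP hE b2 (by omega) (by omega) (by omega) c.Y_inj hI.y fun σ3 f3 g3 => ?_)
  have b3 := stable b2 (f3 2 (by simp)) (f3 3 (by simp)) (f3 4 (by simp))
  refine WP.seq (wp_yrP hE b3 c.X_inj (fun i => by rw [f3 10 (by simp), (g2 i).1])
    (fun i => (g3 i).1) fun σ4 f4 g4 => ?_)
  have b4 := stable b3 (f4 2 (by simp)) (f4 3 (by simp)) (f4 4 (by simp))
  have s4 : σ4 1 = σ 1 := by rw [f4 1 (by simp), f3 1 (by simp), f2 1 (by simp), f1 1 (by simp)]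
  refine WP.seq (wp_portsP hE b4 (by omega) (by omega) (by omega) c.X_inj hI.x (P := c.top)
    (τ := c.τ) (fun j => by rw [s4, hs]) hI.top
    (fun i => by rw [f4 11 (by simp), f3 11 (by simp), (g2 i).2]) fun σ5 f5 z5 g5 => ?_)
  have b5 := stable b4 (f5 2 (by simp)) (f5 3 (by simp)) (f5 4 (by simp))
  have s5 : σ5 1 = σ 1 := by rw [f5 1 (by simp), s4]
  refine WP.seq (wp_portsP hE b5 (by omega) (by omega) (by omega) c.Y_inj hI.y
    (P := fun j => ¬ c.top j) (τ := c.τ) (fun j => by rw [s5, hs']) hI.right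
    (fun i => by rw [f5 13 (by simp), f4 13 (by simp), (g3 i).2]) fun σ6 f6 z6 g6 => ?_)
  have b6 := stable b5 (f6 2 (by simp)) (f6 3 (by simp)) (f6 4 (by simp))
  have s6 : σ6 1 = σ 1 := by rw [f6 1 (by simp), s5]
  refine WP.count (fun k => ∃ h : k < m, c.top ⟨k, h⟩) (N := m) hE.pos (by omega) (by omega)
    (by omega) b6.2.1 (by rw [hE.B]; omega) ?_ fun σ7 f7 g7 => hQ σ7 ?_
  · intro k hk σ' f h7
    refine ⟨by simp [sideT, Test.Inb, Expr.Inb, Expr.eval, hE.pos, h7, hE.lt (hk.le.trans hE.le)],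
      ?_⟩
    have e : ∀ k, (¬ 0 < k ∧ ¬ k < 0) ↔ k = 0 := by omega
    simp only [sideT, Test.Holds, Expr.eval, h7, f 1 (by omega) (by omega), s6, e]
    exact (hs ⟨k, hk⟩).trans ⟨fun h => ⟨hk, h⟩, fun ⟨_, h⟩ => h⟩
  · -- Past the last rank there are no ports to be counted.
    have cases : ∀ {v : Fin n → ℝ}, Function.Injective v → ∀ k ≤ n, k = n ∨ ∃ i, rk v i = k :=
      fun hv k hk => (eq_or_lt_of_le hk).imp id (exists_rk_eq hv)
    have zz : ∀ b, 2 ≤ b → b ∉ [2, 3, 4, 5, 6, 7, 10, 11, 12, 13, 14, 15, 16, 17] →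
        ∀ i, σ7 b i = 0 := by
      intro b hb hb' i
      simp only [List.mem_cons, List.not_mem_nil, or_false, not_or] at hb'
      rw [f7 b (by omega) (by omega), f6 b (by simp; omega), f5 b (by simp; omega),
        f4 b (by simp; omega), f3 b (by simp; omega), f2 b (by simp; omega),
        f1 b (by simp; omega), hz b hb]
    refine ⟨stable b6 (f7 2 (by omega) (by omega)) (f7 3 (by omega) (by omega))
      (f7 4 (by omega) (by omega)), ?_, ?_, ?_, ?_, ?_, ?_, ?_, ?_, ?_⟩
    · intro j; rw [f7 1 (by omega) (by omega), s6, hs]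
    · intro j; rw [f7 1 (by omega) (by omega), s6, hs']
    · intro i
      rw [f7 11 (by omega) (by omega), f6 11 (by simp), f5 11 (by simp), f4 11 (by simp),
        f3 11 (by simp), (g2 i).2]
    · intro i
      rw [f7 13 (by omega) (by omega), f6 13 (by simp), f5 13 (by simp), f4 13 (by simp),
        (g3 i).2]
    · intro i
      rw [f7 14 (by omega) (by omega), f6 14 (by simp), f5 14 (by simp), g4]
    · intro k hk
      rw [f7 15 (by omega) (by omega), f6 15 (by simp)]
      rcases cases c.X_inj k hk with rfl | ⟨i, rfl⟩
      · rw [z5 _ le_rfl, f4 15 (by simp), f3 15 (by simp), f2 15 (by simp), f1 15 (by simp),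
          hz 15 (by omega), c.tc_eq_zero]
      · rw [g5, c.tc_rk]
    · intro k hk
      rw [f7 16 (by omega) (by omega), Cfg.rc]
      rcases cases c.Y_inj k hk with rfl | ⟨i, rfl⟩
      · rw [z6 _ le_rfl, f5 16 (by simp), f4 16 (by simp), f3 16 (by simp), f2 16 (by simp),
          f1 16 (by simp), hz 16 (by omega), c.mirror.tc_eq_zero]
      · rw [g6]; exact (c.mirror.tc_rk i).symm
    · rw [g7, Cfg.nT]
      exact (card_fin_eq_count _ _ fun j => by simp).symm
    · intro b hb i
      refine zz b ?_ ?_ i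
      · simp only [List.mem_cons, List.not_mem_nil, or_false] at hb; omega
      · simp only [List.mem_cons, List.not_mem_nil, or_false] at hb ⊢; omega

/-- The algorithm. -/
def mainP : Prog :=
  .seq prepP (.seq dpP (.seq searchP (.ite (.lt (.const 0) (V 28))
    (.seq traceP (.seq (greedyP 0 2 13 1 0) (.seq (greedyP 1 3 11 0 1) outP)))
    (.store 0 (.const 0) (.const 0)))))

theorem wp_mainP (hE : Setting E n m) (hS : 1 < E.L.size) {c : Cfg n m} (hI : Input E c)
    (h00 : σ 0 0 = n) (h01 : σ 0 1 = m) (hs : ∀ j : Fin m, σ 1 j = 0 ↔ c.top j)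
    (hs' : ∀ j : Fin m, σ 1 j = 1 ↔ ¬ c.top j) (hz : ∀ b, 2 ≤ b → ∀ i, σ b i = 0) :
    WP E mainP (fun σ' => (σ' 0 0 = 1 ∧ ∃ f, c.Planar f ∧ ∀ j : Fin m, σ' 1 j = (f j).val) ∨
      (σ' 0 0 = 0 ∧ ¬ ∃ f, c.Planar f)) σ := by
  classical
  refine WP.seq (wp_prepP hE hS hI h00 h01 hs hs' hz fun σ1 H => ?_)
  have stable : ∀ {σ' : Store}, σ' 2 = σ1 2 → σ' 3 = σ1 3 → σ' 4 = σ1 4 → Base n m σ' := by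
    intro σ' h2 h3 h4
    rw [Base, h2, h3, h4]; exact H.base
  refine WP.seq (wp_dpP hE H.base H.tc H.rc (H.zero 18 (by simp)) fun σ2 f2 hM => ?_)
  have g14 := f2 14 (by simp)
  rw [← g14] at hM
  have hyr : ∀ i, σ2 14 (rk c.X i) = rk c.Y i := fun i => by rw [g14, H.yr]
  have hM0 : ∀ u ≤ n, σ2 18 u = DP.row n (σ2 14) c.tc c.rc n u := by
    intro u hu
    have := hM 0 (Nat.zero_le n) u hu
    simpa using this
  refine WP.seq (wp_searchP hE (stable (f2 2 (by simp)) (f2 3 (by simp)) (f2 4 (by simp)))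
    (by rw [f2 28 (by simp), H.zero 28 (by simp)]) (t := c.nT)
    (by rw [f2 17 (by simp), H.nT]) fun σ3 f3 hfound => ?_)
  refine WP.ite (by simp [Test.Inb, Expr.Inb, Expr.eval, hE.pos]) (fun hc => ?_) (fun hc => ?_)
  all_goals simp only [Test.Holds, Expr.eval] at hc
  · obtain ⟨-, hu, h1, h2, h3⟩ := hfound.resolve_left fun h => by omega
    rw [hM0 _ hu] at h1
    have hcurve := Cfg.curve_height hyr h1 h2 h3
    have g3 := f3 14 (by simp)
    have base : ∀ {σ' : Store}, σ' 2 = σ3 2 → σ' 3 = σ3 3 → σ' 4 = σ3 4 → Base n m σ' := by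
      intro σ' h2 h3 h4
      exact stable (by rw [h2, f3 2 (by simp), f2 2 (by simp)])
        (by rw [h3, f3 3 (by simp), f2 3 (by simp)]) (by rw [h4, f3 4 (by simp), f2 4 (by simp)])
    refine WP.seq (wp_traceP hE (base rfl rfl rfl) hu rfl c.X_inj (tc := c.tc) (rc := c.rc)
      (fun i => by rw [f3 11 (by simp), f2 11 (by simp), H.x])
      (fun k hk u hu => by rw [g3, f3 18 (by simp), hM k hk u hu])
      (fun i => by rw [f3 19 (by simp), f2 19 (by simp), H.zero 19 (by simp)])
      fun σ4 f4 hF => ?_)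
    rw [g3] at hF
    set h := DP.height n (σ2 14) c.tc c.rc (σ3 29 0) with hh
    have hab : ∀ i : Fin n, σ4 19 i = if c.Above h i then 1 else 0 := by
      intro i
      rw [hF]
      refine if_congr ?_ rfl rfl
      rw [Cfg.Above, hyr]
    have s4 : σ4 1 = σ1 1 := by rw [f4 1 (by simp), f3 1 (by simp), f2 1 (by simp)]
    refine WP.seq (wp_greedyP hE (base (f4 2 (by simp)) (f4 3 (by simp)) (f4 4 (by simp)))
      (by simp) c.Y_inj
      (fun i => by rw [f4 13 (by simp), f3 13 (by simp), f2 13 (by simp), H.y]) hI.x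
      (P := c.top) (fun j => by rw [s4, H.top]) hI.top (A := c.Above h)
      (fun i => by rw [hab]; split_ifs with h <;> simp [h])
      (fun j _ => by
        rw [f4 20 (by simp), f3 20 (by simp), f2 20 (by simp), H.zero 20 (by simp)])
      fun σ5 f5 z5 ⟨oT, hT, hT'⟩ => ?_)
    refine WP.seq (wp_greedyP hE (base (by rw [f5 2 (by simp), f4 2 (by simp)])
      (by rw [f5 3 (by simp), f4 3 (by simp)]) (by rw [f5 4 (by simp), f4 4 (by simp)]))
      (by simp) c.X_inj
      (fun i => by rw [f5 11 (by simp), f4 11 (by simp), f3 11 (by simp), f2 11 (by simp), H.x])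
      hI.y (P := fun j => ¬ c.top j) (fun j => by rw [f5 1 (by simp), s4, H.right]) hI.right
      (A := fun i => ¬ c.Above h i)
      (fun i => by rw [f5 19 (by simp), hab]; by_cases h : c.Above h i <;> simp [h])
      (fun j hj => by
        rw [z5 j hj, f4 20 (by simp), f3 20 (by simp), f2 20 (by simp), H.zero 20 (by simp)])
      fun σ6 f6 z6 ⟨oR, hR, hR'⟩ => ?_)
    obtain ⟨f, hf, hf'⟩ := hcurve.exists_planar hT hR
    refine wp_outP hE (f := f) (base (by rw [f6 2 (by simp), f5 2 (by simp), f4 2 (by simp)])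
      (by rw [f6 3 (by simp), f5 3 (by simp), f4 3 (by simp)])
      (by rw [f6 4 (by simp), f5 4 (by simp), f4 4 (by simp)])) (fun j => ?_)
      fun σ7 g0 g1 => .inl ⟨g0, f, hf, g1⟩
    by_cases hj : c.top j
    · rw [z6 j (not_not.2 hj), hT' j hj, (hf' j).1 hj]; rfl
    · rw [hR' j hj, (hf' j).2 hj]; rfl
  · obtain ⟨-, hno⟩ := hfound.resolve_right fun h => by omega
    refine WP.store (by simp [Expr.Inb]) (by simp [Expr.Inb]) (by simpa [Expr.eval] using hE.pos)
      (.inr ⟨by simp [write, Expr.eval], fun hsol => ?_⟩)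
    obtain ⟨h, hcurve⟩ := Cfg.Planar.exists_curve hsol
    obtain ⟨u, hu, h1, h2, h3⟩ := hcurve.exists_row_pos hyr
    exact hno u hu ⟨by rw [hM0 u hu]; exact h1, h2, h3⟩

theorem chk_mainP : mainP.chk = true := by decide

theorem depth_mainP : mainP.depth = 3 := by decide

theorem coef_mainP : mainP.coef ≤ 2048 := by decide

end Algo

theorem Instance.input {n m : ℕ} (I : Instance n m) {E : WordRAM.Env} (hE : E.x = I.realInput) :
    Algo.Input E I.cfg := by
  refine ⟨fun i => ?_, fun i => ?_, fun j hj => ?_, fun j hj => ?_⟩ <;> rw [hE]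
  · simp [realInput, cfg]
  · simp [realInput, cfg]
  · have : I.side j = .top := hj
    simp [realInput, cfg, this]
  · have : ¬ I.side j = .top := hj
    simp [realInput, cfg, this]

theorem Instance.initStore_le {n m : ℕ} (I : Instance n m) (a i : ℕ) : I.initStore a i ≤ n := by
  have := I.le
  unfold initStore
  split
  · exact le_rfl
  · exact this
  · split_ifs <;> omega
  · exact Nat.zero_le n

open Algo in
theorem Instance.exists_exec {n m : ℕ} (I : Instance n m) {L : Limits} (hb : 64 ≤ L.banks)
    (hs : 2 * ((n + 1) * (n + 1)) ≤ L.size) (hw : (n + mainP.tb (n + 1) + 2) ^ 40 ≤ L.word) :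
    ∃ σ t, Exec L I.realInput mainP I.initStore σ t ∧ t ≤ mainP.tb (n + 1) ∧
      I.IsCorrectOutput σ := by
  have hS : 1 < L.size := by
    have := Nat.mul_pos n.succ_pos n.succ_pos
    exact lt_of_lt_of_le (by simp only [Nat.succ_eq_add_one] at this; clear hw; omega) hs
  obtain ⟨σ, t, h1, h2, -, h3⟩ := wp_mainP (σ := I.initStore)
    (E := ⟨L, I.realInput, n + 1, n + mainP.tb (n + 1), hb, hw⟩)
    ⟨(Nat.le_mul_of_pos_left _ two_pos).trans hs, rfl, I.le⟩ hS (I.input rfl) rfl rfl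
    (fun j => by simp [Instance.initStore, Instance.cfg])
    (fun j => by simp [Instance.initStore, Instance.cfg])
    (fun b hb i => by
      obtain ⟨b, rfl⟩ := Nat.exists_eq_add_of_le hb
      rw [Nat.add_comm]; rfl)
    chk_mainP n I.initStore_le le_rfl
  refine ⟨σ, t, h1, h2, ?_⟩
  simpa only [Instance.IsCorrectOutput, Instance.Solvable, I.isPlanarSolution_iff] using h3

namespace Algo

theorem tb_mainP (n : ℕ) : mainP.tb (n + 1) ≤ 2048 * (n + 1) ^ 3 := by
  have h := Prog.tb_le (B := n + 1) (by omega) mainP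
  rw [depth_mainP] at h
  exact h.trans (Nat.mul_le_mul_right _ coef_mainP)

set_option exponentiation.threshold 2048 in
/-- As the program runs in polynomial time, polynomially many values of a word suffice. -/
theorem word_mainP (n : ℕ) : (n + mainP.tb (n + 1) + 2) ^ 40 ≤ (n + 2) ^ 2048 := by
  have h1 := tb_mainP n
  have h2 : (2 : ℕ) ^ 12 ≤ (n + 2) ^ 12 := Nat.pow_le_pow_left (by omega) 12
  have h3 : n + mainP.tb (n + 1) + 2 ≤ 2 ^ 12 * (n + 2) ^ 3 := by
    have h4 : (n + 1) ^ 3 ≤ (n + 2) ^ 3 := Nat.pow_le_pow_left (by omega) 3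
    have h5 : n + 2 ≤ (n + 2) ^ 3 := Nat.le_self_pow (by omega) _
    omega
  calc (n + mainP.tb (n + 1) + 2) ^ 40 ≤ ((n + 2) ^ 12 * (n + 2) ^ 3) ^ 40 :=
        Nat.pow_le_pow_left (h3.trans (Nat.mul_le_mul_right _ h2)) 40
    _ = (n + 2) ^ ((12 + 3) * 40) := by rw [← pow_add, ← pow_mul]
    _ ≤ (n + 2) ^ 2048 := Nat.pow_le_pow_right (by omega) (by omega)

end Algo

end BoundaryLabeling

/-- A single program solves Two-Sided Boundary Labeling with Adjacent Sides in `O(n ^ 3)` time on a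
machine with a constant number of banks of `O(n ^ 2)` words of `O(log n)` bits. -/
theorem mainTheorem2 :
    ∃ (p : WordRAM.Prog) (C : ℕ), ∀ (n m : ℕ) (I : BoundaryLabeling.Instance n m),
      ∃ (σ : WordRAM.Store) (t : ℕ),
        WordRAM.Exec ⟨C, C * (n + 1) ^ 2, (n + 2) ^ C⟩ I.realInput p I.initStore σ t ∧
        t ≤ C * (n + 1) ^ 3 ∧
        I.IsCorrectOutput σ := by
  refine ⟨BoundaryLabeling.Algo.mainP, 2048, fun n m I => ?_⟩
  obtain ⟨σ, t, h1, h2, h3⟩ := I.exists_exec (L := ⟨2048, 2048 * (n + 1) ^ 2, (n + 2) ^ 2048⟩)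
    (by simp only; omega) (by simp only; rw [sq]; omega) (BoundaryLabeling.Algo.word_mainP n)
  exact ⟨σ, t, h1, h2.trans (BoundaryLabeling.Algo.tb_mainP n), h3⟩
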